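/- Let $p\ge 1$, $N\ge 1$ be integers, $g\in\mathbb C\setminus\{0\}$, and let $b=(b_n)_{n\ge1}$ be a finitely supported complex sequence (the background). Put $x_n=b_n+t_n$, where $t_1,\dots,t_N$ are formal variables and $t_n=0$ for $n>N$; let $R=\mathbb C[[t_1,\dots,t_N]]$ and consider pseudo-differential operators over $R$ in $\partial=g\,\partial/\partial x_1$. Let $\boldsymbol P,\boldsymbol Q$ be differential operators solving the Douglas equation $[\boldsymbol P,\boldsymbol Q]=g\boldsymbol 1$ together with $g\,\partial\boldsymbol P/\partial x_n=[(\boldsymbol L^n)_+,\boldsymbol P]$ and $g\,\partial\boldsymbol Q/\partial x_n=[(\boldsymbol L^n)_+,\boldsymbol Q]$ $(1\le n\le N)$, where $\boldsymbol L^p=\boldsymbol P$ and $\boldsymbol L=\boldsymbol W\partial\boldsymbol W^{-1}$ with a Sato operator $\boldsymbol W=1+\sum_{n\ge1}w_n\partial^{-n}$, $g\,\partial\boldsymbol W/\partial x_n=(\boldsymbol L^n)_+\boldsymbol W-\boldsymbol W\partial^n$. Normalize $\boldsymbol W$ and the origin of the times by $\boldsymbol W^{-1}\boldsymbol Q\boldsymbol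 W|_{t=0}=\frac1p\bigl[\sum_{n\ge1}n b_n\partial^{n-p}+g\gamma\,\partial^{-p}\bigr]$ with a constant $\gamma$. Let $\Psi(x;\lambda)=\boldsymbol W e^{g^{-1}\sum_n x_n\lambda^n}$ be the Baker–Akhiezer function. Let $\alpha_n=\sum_{r+s=n}{:}\psi_r\bar\psi_s{:}$ be the current modes of the free fermions $\psi,\bar\psi$ (so $[\alpha_n,\alpha_m]=n\delta_{n+m,0}$), with Dirac vacuum $|0\rangle$; $\partial\phi(\lambda)=\sum_{n\in\mathbb Z}\alpha_n\lambda^{-n-1}$ and $\phi_+(\lambda)=-\sum_{n>0}\frac{\alpha_n}{n}\lambda^{-n}$; and for $\zeta=\lambda^p$, $\partial\varphi_0(\zeta)=\frac1p\sum_{n\in\mathbb Z}\alpha_n\zeta^{-n/p-1}$ and $\varphi_{0,+}(\zeta)=\phi_+(\lambda)$. Let $\langle x/g|=\langle0|e^{g^{-1}\sum_n x_n\alpha_n}$, and let $|\Phi\rangle=e^{-g^{-1}\sum_n b_n\alpha_n}|\Phi_b\rangle$, where $|\Phi_b\rangle=\prod_{k\ge0}\bigl[\oint\frac{d\lambda}{2\pi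 i}\bar\psi(\lambda)\Phi_k(b;\lambda)\bigr]|\Omega\rangle$ is the decomposable state of the functions $\Phi_k(x;\lambda)=[\partial^k\boldsymbol W]_{\partial\to\lambda}$ at $x=b$. (i) The functions $P(x;\lambda),Q(x;\lambda)\in R((\lambda^{-1}))$ with $\boldsymbol P\Psi=P\Psi$ and $\boldsymbol Q\Psi=Q\Psi$ exist, are unique, and are $$P=\lambda^p=\zeta,\qquad Q=g\,\frac{\lambda^{1-p}}{p}\,\frac{\langle x/g|\partial\phi(\lambda)\,e^{\phi_+(\lambda)}|\Phi\rangle}{\langle x/g|e^{\phi_+(\lambda)}|\Phi\rangle}+\frac{g\gamma}{p\,\zeta}=g\,\frac{\langle x/g|\partial\varphi_0(\zeta)\,e^{\varphi_{0,+}(\zeta)}|\Phi\rangle}{\langle x/g|e^{\varphi_{0,+}(\zeta)}|\Phi\rangle}+\frac{g\gamma}{p\,\zeta},$$ where the numerators are Laurent series in $\lambda^{-1}$ over $R$ and the denominator is invertible. (ii) Consequently $Q$ tends to the disk amplitude as $g\to0$: for a family of such solutions with $p,N,b,\gamma$ fixed and $g$ in a set $S\subset\mathbb C\setminus\{0\}$,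 suppose that the connected correlators in the background $b$, generated by $$\log\frac{\langle b/g|e^{\sum_{n\ge1} j_n\alpha_n}|\Phi\rangle}{\langle b/g|\Phi\rangle},$$ have genus expansions $\langle\mathcal O_{n_1}\cdots\mathcal O_{n_M}\rangle_{\rm c}=\sum_{h\ge0}g^{2h+M-2}\langle\mathcal O_{n_1}\cdots\mathcal O_{n_M}\rangle_{\rm c}^{(h)}$ $(M\ge1)$, asymptotic as $g\to0$ in $S$. Then, coefficient by coefficient in $t$ and $\lambda$, both $g\,\langle x/g|\partial\varphi_0(\zeta)|\Phi\rangle/\langle x/g|\Phi\rangle$ and $Q(x;\lambda)$ converge as $g\to0$ in $S$ to the disk amplitude $$\langle\partial\varphi_0(\zeta)\rangle^{(0)}=\frac1p\sum_{n\ge1}n x_n\,\zeta^{n/p-1}+\frac1p\sum_{n\ge1}\langle\mathcal O_n\rangle^{(0)}_x\,\zeta^{-n/p-1},$$ where $\langle\mathcal O_n\rangle^{(0)}_x=\sum_m\langle\mathcal O_n\prod_i\mathcal O_i^{m_i}\rangle^{(0)}_{\rm c}\prod_i t_i^{m_i}/m_i!$, the sum running over $m\in\mathbb Z_{\ge0}^N$.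 -/

import Mathlib

open Filter Topology Asymptotics

noncomputable section

namespace MinimalString

/-! ## Coefficient ring: formal power series in the KP times around a background

`b : ℕ →₀ ℂ` is a background (only `b n` with `1 ≤ n` matters).  The KP times are
`x n = b n + t n`, where `t 1, …, t N` are formal variables and `t n = 0` for `n > N`.
The variable with index `i : Fin N` is `t (i + 1)`. -/

/-- Formal power series in `t 1, …, t N`. -/
abbrev TimeRing (N : ℕ) := MvPowerSeries (Fin N) ℂ

/-- The KP time `x n = b n + t n`, with `t n = 0` unless `1 ≤ n ≤ N`. -/
def time (N : ℕ) (b : ℕ →₀ ℂ) (n : ℕ) : TimeRing N :=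
  MvPowerSeries.C (b n) +
    if h : 1 ≤ n ∧ n ≤ N then MvPowerSeries.X (⟨n - 1, by omega⟩ : Fin N) else 0

/-- The derivation `∂/∂x_{i+1}` of the coefficient ring. -/
def dTime {N : ℕ} (i : Fin N) (f : TimeRing N) : TimeRing N := MvPowerSeries.pderiv ℂ i f

theorem dTime_iterate_zero {N : ℕ} (i : Fin N) (k : ℕ) : (dTime i)^[k] (0 : TimeRing N) = 0 := by
  induction k with
  | zero => rfl
  | succ k ih => rw [Function.iterate_succ_apply', ih]; simp [dTime]

/-! ## Pseudo-differential operators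

A pseudo-differential operator `∑ a_k ∂^k` (orders bounded above) is stored as the Laurent series
in `∂⁻¹` with the coefficients on the left: the coefficient at `i` multiplies `∂^(-i)`.
Here `∂ = g ∂/∂x_1`. -/

/-- Pseudo-differential operators with coefficients in the ring of formal power series. -/
abbrev PsiDO (N : ℕ) := LaurentSeries (TimeRing N)

section Operators

variable {N : ℕ} [NeZero N]

/-- The coefficient of `∂^(-m)` in `A ∘ B`, from
`∂^n ∘ f = ∑_k g^k (n choose k) (∂^k f / ∂x_1^k) ∂^(n-k)`, `n ∈ ℤ`.
Only finitely many terms are non-zero. -/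
def compCoeff (g : ℂ) (A B : PsiDO N) (m : ℤ) : TimeRing N :=
  ∑ᶠ q : ℤ × ℕ, A.coeff q.1 *
    ((Ring.choose (-q.1) q.2 : ℤ) • (g ^ q.2 • ((dTime (0 : Fin N))^[q.2] (B.coeff (m - q.1 - q.2)))))

theorem compCoeff_support (g : ℂ) (A B : PsiDO N) :
    BddBelow (Function.support (compCoeff g A B)) := by
  refine ⟨A.order + B.order, fun m hm => ?_⟩
  by_contra! hlt
  apply hm
  unfold compCoeff
  refine finsum_eq_zero_of_forall_eq_zero fun q => ?_
  by_cases h1 : q.1 < A.order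
  · rw [HahnSeries.coeff_eq_zero_of_lt_order h1, zero_mul]
  · have h2 : m - q.1 - q.2 < B.order := by omega
    rw [HahnSeries.coeff_eq_zero_of_lt_order h2, dTime_iterate_zero]
    simp

/-- Composition of pseudo-differential operators. -/
def comp (g : ℂ) (A B : PsiDO N) : PsiDO N :=
  HahnSeries.ofSuppBddBelow (compCoeff g A B) (compCoeff_support g A B)

/-- `∂^k`, `k ∈ ℤ`. -/
def delPow (N : ℕ) (k : ℤ) : PsiDO N := HahnSeries.single (-k) 1

/-- The composition power `A^n`. -/
def opPow (g : ℂ) (A : PsiDO N) : ℕ → PsiDO N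
  | 0 => delPow N 0
  | n + 1 => comp g A (opPow g A n)

/-- The differential-operator part `A₊` (non-negative powers of `∂`). -/
def posPart (A : PsiDO N) : PsiDO N := HahnSeries.truncLT (1 : ℤ) A

/-- `A` is a differential operator: no negative power of `∂` occurs. -/
def IsDiffOp (A : PsiDO N) : Prop := ∀ i : ℤ, 0 < i → A.coeff i = 0

/-- The commutator `[A, B]`. -/
def commOp (g : ℂ) (A B : PsiDO N) : PsiDO N := comp g A B - comp g B A

/-- `∂A/∂x_{i+1}`, coefficientwise. -/
def dTimeOp (i : Fin N) (A : PsiDO N) : PsiDO N := A.map (MvPowerSeries.pderiv ℂ i)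

/-- The constant-coefficient symbol `(1/p) (∑_{n ≥ 1} n b_n ∂^(n-p) + g γ ∂^(-p))`. -/
def backgroundSymbol (N p : ℕ) (g : ℂ) (b : ℕ →₀ ℂ) (γ : ℂ) : PsiDO N :=
  (p : ℂ)⁻¹ • ((∑ n ∈ b.support, ((n : ℂ) * b n) • delPow N ((n : ℤ) - p)) +
    (g * γ) • delPow N (-(p : ℤ)))

/-- Evaluation of all coefficients at the background `x = b` (that is, `t = 0`), again regarded
as an operator with (constant) coefficients in the ring of power series. -/
def atBackground (A : PsiDO N) : PsiDO N :=
  (A.map (MvPowerSeries.constantCoeff (σ := Fin N) (R := ℂ))).map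
    (MvPowerSeries.C (σ := Fin N) (R := ℂ))

/-- A solution of the Douglas equation near the background `b`, with its Lax operator and its
Sato operator.  The Sato operator of a Lax operator is unique only up to right multiplication by
an operator with constant coefficients; this freedom, together with the origin of the times, is
fixed by the value of `W⁻¹ Q W` at the background, which also defines the constant `γ`. -/
structure DouglasSolution (N : ℕ) [NeZero N] (p : ℕ) (g : ℂ) (b : ℕ →₀ ℂ) (γ : ℂ) where
  /-- the operator `P` -/
  P : PsiDO N
  /-- the operator `Q` -/
  Q : PsiDO N
  /-- the Lax operator -/
  L : PsiDO N
  /-- the Sato operator -/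
  W : PsiDO N
  /-- the operator `W⁻¹ Q W` -/
  A : PsiDO N
  diffOp_P : IsDiffOp P
  diffOp_Q : IsDiffOp Q
  /-- `[P, Q] = g 1` -/
  douglas : commOp g P Q = g • delPow N 0
  /-- `L^p = P` -/
  lax_pow : opPow g L p = P
  /-- `g ∂P/∂x_n = [(L^n)₊, P]` -/
  flow_P : ∀ i : Fin N, g • dTimeOp i P = commOp g (posPart (opPow g L ((i : ℕ) + 1))) P
  /-- `g ∂Q/∂x_n = [(L^n)₊, Q]` -/
  flow_Q : ∀ i : Fin N, g • dTimeOp i Q = commOp g (posPart (opPow g L ((i : ℕ) + 1))) Q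
  /-- `W = 1 + w_1 ∂⁻¹ + w_2 ∂⁻² + ⋯` -/
  sato_coeff_zero : W.coeff 0 = 1
  sato_coeff_neg : ∀ i : ℤ, i < 0 → W.coeff i = 0
  /-- `L = W ∂ W⁻¹` -/
  dressing : comp g L W = comp g W (delPow N 1)
  /-- `g ∂W/∂x_n = (L^n)₊ W - W ∂^n` -/
  sato : ∀ i : Fin N, g • dTimeOp i W =
    comp g (posPart (opPow g L ((i : ℕ) + 1))) W - comp g W (delPow N (((i : ℕ) : ℤ) + 1))
  conj : comp g Q W = comp g W A
  normalized : atBackground A = backgroundSymbol N p g b γ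

/-! ## Functions of `λ` and the Baker–Akhiezer function

Formal Laurent series in `λ⁻¹` are elements of `LaurentSeries (TimeRing N)`: the coefficient at `i`
multiplies `λ^(-i)`.  Such a series `F` also stands for the formal function
`F(x; λ) exp(g⁻¹ ∑ x_n λ^n)`. -/

/-- `λ^k`, `k ∈ ℤ`, as a Laurent series in `λ⁻¹`. -/
def lam (N : ℕ) (k : ℤ) : LaurentSeries (TimeRing N) := HahnSeries.single (-k) 1

/-- The action of `A` on `F exp(g⁻¹ ∑ x_n λ^n)`, with the exponential factor stripped off the
result.  On the prefactor `F`, `∂` acts as `λ + g ∂/∂x_1`, so that `∂^k` acts as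
`∑_j (k choose j) λ^(k-j) (g ∂/∂x_1)^j`; this is the formula of `comp`. -/
def act (g : ℂ) (A : PsiDO N) (F : LaurentSeries (TimeRing N)) : LaurentSeries (TimeRing N) :=
  comp g A F

/-- The Baker–Akhiezer function `Ψ = W exp(g⁻¹ ∑ x_n λ^n)`, without the exponential factor. -/
def bakerAkhiezer (g : ℂ) (W : PsiDO N) : LaurentSeries (TimeRing N) := act g W 1

end Operators

/-! ## Free fermions

The basis vectors of the fermion Fock space are the semi-infinite products
`ψ̄_{s_0+1/2} ψ̄_{s_1+1/2} ⋯ |Ω⟩`, `s_0 < s_1 < ⋯`, whose set `S ⊆ ℤ` of occupied levels differs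
from `{0, 1, 2, …}` by a finite set `T`; the basis is indexed by `T`, and `T = ∅` is the Dirac
vacuum.  A state is a formal (possibly infinite) combination of basis vectors.  Level `k` is
created by `ψ̄_{k+1/2}` and annihilated by `ψ_{-k-1/2}`. -/

/-- States of the (completed) fermion Fock space over a commutative ring. -/
abbrev Fock (A : Type*) := Finset ℤ → A

/-- Level `k` is occupied in the basis vector with index `T`. -/
def Occ (T : Finset ℤ) (k : ℤ) : Prop := Xor (0 ≤ k) (k ∈ T)

/-- The sign `(-1)^(number of occupied levels below k)`, with `{s ≥ 0 : s < k}` and `T` counted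
modulo 2. -/
def levelSign (T : Finset ℤ) (k : ℤ) : ℤ := (-1) ^ (k.toNat + (T.filter (· < k)).card)

section Fermions

variable {A : Type*} [CommRing A]

open Classical in
/-- `ψ̄_{k+1/2}`: create level `k`. -/
def psiBar (k : ℤ) : Module.End A (Fock A) where
  toFun f T := if Occ T k then levelSign T k • f (symmDiff T {k}) else 0
  map_add' f f' := by
    funext T
    by_cases h : Occ T k <;> simp [h]
  map_smul' c f := by
    funext T
    by_cases h : Occ T k <;> simp [h, mul_left_comm]

open Classical in
/-- `ψ_{-k-1/2}`: annihilate level `k`. -/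
def psi (k : ℤ) : Module.End A (Fock A) where
  toFun f T := if Occ T k then 0 else levelSign T k • f (symmDiff T {k})
  map_add' f f' := by
    funext T
    by_cases h : Occ T k <;> simp [h]
  map_smul' c f := by
    funext T
    by_cases h : Occ T k <;> simp [h, mul_left_comm]

/-- The product `ψ_{-k-1/2} ψ̄_{j+1/2}`, normal ordered with respect to the Dirac vacuum
(`ψ_r` is an annihilator for `r > 0`, that is, for `k < 0`). -/
def normalOrd (k j : ℤ) : Module.End A (Fock A) :=
  if k < 0 then -(psiBar j * psi k) else psi k * psiBar j

theorem normalOrd_support (n : ℤ) (f : Fock A) (T : Finset ℤ) :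
    (Function.support fun k : ℤ => normalOrd k (k + n) f T).Finite := by
  refine Set.Finite.subset
    ((T ∪ T.image (fun a => a - n)) ∪ Finset.Ico (-n) 0).finite_toSet fun k hk => ?_
  by_contra hmem
  simp only [Finset.coe_union, Set.mem_union, Finset.mem_coe, Finset.mem_image,
    Finset.mem_Ico, not_or, not_and, not_exists] at hmem
  obtain ⟨⟨h1, h2⟩, h3⟩ := hmem
  have h2' : k + n ∉ T := fun h => h2 _ h (by omega)
  apply hk
  by_cases hneg : k < 0
  · have : ¬ Occ T (k + n) := by
      have : ¬ (0 ≤ k + n) := fun h => by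
        have := h3 (by omega)
        omega
      simp [Occ, Xor, this, h2']
    simp [normalOrd, hneg, psiBar, this]
  · have : Occ T k := Or.inl ⟨by omega, h1⟩
    simp [normalOrd, hneg, psi, this]

/-- The current modes `α_n`, from `∂φ(λ) = ∑ α_n λ^(-n-1) = :ψ(λ) ψ̄(λ):`, that is
`α_n = ∑_{r+s=n} :ψ_r ψ̄_s:`. -/
def alpha (n : ℤ) : Module.End A (Fock A) where
  toFun f T := ∑ᶠ k : ℤ, normalOrd k (k + n) f T
  map_add' f f' := by
    funext T
    simp only [map_add, Pi.add_apply]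
    exact finsum_add_distrib (normalOrd_support n f T) (normalOrd_support n f' T)
  map_smul' c f := by
    funext T
    simp only [map_smul, Pi.smul_apply, RingHom.id_apply]
    exact (smul_finsum' c (normalOrd_support n f T)).symm

/-- `∮ dλ/(2πi) ψ̄(λ) v(λ) = ∑_l v_l ψ̄_{l+1/2}` for `v(λ) = ∑ v_l λ^l`, with `v_l = 0` for
large `l`. -/
def wedge (v : ℤ → A) (f : Fock A) : Fock A := fun T => ∑ᶠ l : ℤ, v l * psiBar l f T

open Classical in
/-- `ψ̄_{M+1/2} ψ̄_{M+3/2} ⋯ |Ω⟩`: the levels `M, M+1, …` are occupied. -/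
def vac (M : ℕ) : Fock A := fun T => if T = Finset.Ico (0 : ℤ) M then 1 else 0

/-- The decomposable state `∏_{k ≥ 0} [∮ dλ/(2πi) ψ̄(λ) v_k(λ)] |Ω⟩`, where
`v_k(λ) = λ^k + lower powers`.  The coefficient of a basis vector in
`[∮ ψ̄ v_0] ⋯ [∮ ψ̄ v_{M-1}] ψ̄_{M+1/2} ψ̄_{M+3/2} ⋯ |Ω⟩` does not depend on `M` as soon as all
levels `≥ M` are occupied in this basis vector, and such an `M` is taken. -/
def decomposable (v : ℕ → ℤ → A) : Fock A := fun T =>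
  (List.range (T.sup Int.toNat + 1)).foldr (fun k f => wedge (v k) f) (vac (T.sup Int.toNat + 1)) T

end Fermions

/-- Operators on the complex Fock space. -/
abbrev FockEnd := Module.End ℂ (Fock ℂ)

/-! ## Formal exponentials and logarithms -/

/-- `exp f` for a power series `f` without constant term, over a possibly non-commutative ring. -/
def fexp {σ B : Type*} [Ring B] [Algebra ℂ B] (f : MvPowerSeries σ B) : MvPowerSeries σ B :=
  fun m => ∑ k ∈ Finset.range (m.degree + 1),
    ((k.factorial : ℂ)⁻¹) • MvPowerSeries.coeff m (f ^ k)

/-- `log f` for a power series `f` with constant term `1`. -/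
def flog {σ : Type*} (f : MvPowerSeries σ ℂ) : MvPowerSeries σ ℂ :=
  fun m => ∑ k ∈ Finset.Icc 1 m.degree, ((-1) ^ (k + 1) / (k : ℂ)) * MvPowerSeries.coeff m ((f - 1) ^ k)

open Classical in
/-- The linear form `∑_s a_s t_s`. -/
def linForm {σ B : Type*} [Semiring B] (a : σ → B) : MvPowerSeries σ B :=
  fun m => ∑ s ∈ m.support, if m = Finsupp.single s 1 then a s else 0

/-- `⟨0| exp(∑_s t_s a_s) |f⟩` as a power series in the `t_s`. -/
def coherent {σ : Type*} (a : σ → FockEnd) (f : Fock ℂ) : MvPowerSeries σ ℂ :=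
  fun m => (MvPowerSeries.coeff m (fexp (linForm a)) : FockEnd) f ∅

/-- `φ₊(λ) = - ∑_{n>0} (α_n / n) λ^(-n)`, as a power series in `λ⁻¹`. -/
def phiPlus : PowerSeries FockEnd :=
  PowerSeries.mk fun n => if n = 0 then 0 else -((n : ℂ)⁻¹ • alpha (n : ℤ))

/-- The coefficient of `λ^(-l)` in `exp φ₊(λ)`. -/
def expPhiPlus (l : ℕ) : FockEnd :=
  PowerSeries.coeff l (fexp (σ := Unit) phiPlus : PowerSeries FockEnd)

/-! ## The state and its correlators

The state `|Φ⟩` belonging to the origin `x = 0` is only formal, since the background need not be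
removable: `|Φ⟩ = exp(-g⁻¹ ∑ b_n α_n) |Φ_b⟩`, where `|Φ_b⟩` is the decomposable state of the point
of the Grassmannian at `x = b`.  So `⟨x/g| O |Φ⟩` is by definition
`⟨0| exp(g⁻¹ ∑ t_n α_n) O' |Φ_b⟩`, `x = b + t`, with
`O' = exp(g⁻¹ ∑ b_n α_n) O exp(-g⁻¹ ∑ b_n α_n)`. -/

section Correlators

variable {N : ℕ} [NeZero N]

/-- The state `|Φ_b⟩`, decomposable with the vectors `Φ_k(b; λ)`, where
`Φ_k(x; λ)` is the symbol of `∂^k ∘ W` with `∂` replaced by `λ`. -/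
def ketAt (g : ℂ) (W : PsiDO N) : Fock ℂ :=
  decomposable fun k l =>
    MvPowerSeries.constantCoeff ((comp g (delPow N k) W).coeff (-l))

/-- `α_n` conjugated with `exp(g⁻¹ ∑ b_m α_m)`: as `[α_m, α_n]` is a scalar, this is
`α_n + g⁻¹ ∑ b_m [α_m, α_n]`. -/
def alphaAt (g : ℂ) (b : ℕ →₀ ℂ) (n : ℤ) : FockEnd :=
  alpha n + g⁻¹ • ∑ m ∈ b.support, b m • ⁅(alpha (m : ℤ) : FockEnd), (alpha n : FockEnd)⁆

/-- `⟨0| exp(g⁻¹ ∑_{n ≤ N} t_n α_n) |f⟩`. -/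
def bra (N : ℕ) (g : ℂ) (f : Fock ℂ) : TimeRing N :=
  coherent (fun i : Fin N => g⁻¹ • alpha (((i : ℕ) : ℤ) + 1)) f

/-- `τ(x) = ⟨x/g|Φ⟩`. -/
def tau (g : ℂ) (W : PsiDO N) : TimeRing N := bra N g (ketAt g W)

/-- `⟨x/g| e^{φ₊(λ)} |Φ⟩`, as a series in `λ⁻¹`. -/
def vertexCorr (g : ℂ) (W : PsiDO N) : LaurentSeries (TimeRing N) :=
  HahnSeries.ofPowerSeries ℤ (TimeRing N)
    (PowerSeries.mk fun l => bra N g (expPhiPlus l (ketAt g W)))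

/-- The coefficient of `λ^k` in `⟨x/g| ∂φ(λ) e^{φ₊(λ)} |Φ⟩`, where `∂φ(λ) = ∑ α_n λ^(-n-1)`. -/
def currentCorr (g : ℂ) (b : ℕ →₀ ℂ) (W : PsiDO N) (k : ℤ) : TimeRing N :=
  ∑ᶠ l : ℕ, bra N g (alphaAt g b (-k - 1 - l) (expPhiPlus l (ketAt g W)))

/-- The coefficient of `ζ^(k/p) = λ^k` in `⟨x/g| ∂φ₀(ζ) e^{φ₀₊(ζ)} |Φ⟩`, where
`∂φ₀(ζ) = (1/p) ∑ α_n ζ^(-n/p-1)` and `φ₀₊(ζ) = φ₊(λ)`. -/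
def currentCorrZeta (p : ℕ) (g : ℂ) (b : ℕ →₀ ℂ) (W : PsiDO N) (k : ℤ) : TimeRing N :=
  (p : ℂ)⁻¹ • ∑ᶠ l : ℕ, bra N g (alphaAt g b (-k - p - l) (expPhiPlus l (ketAt g W)))

/-- The coefficient of `ζ^(k/p)` in the one-point function
`⟨∂φ₀(ζ)⟩ = ⟨x/g| ∂φ₀(ζ) |Φ⟩ / ⟨x/g|Φ⟩`. -/
def onePoint (p : ℕ) (g : ℂ) (b : ℕ →₀ ℂ) (W : PsiDO N) (k : ℤ) : TimeRing N :=
  ((p : ℂ)⁻¹ • bra N g (alphaAt g b (-k - p) (ketAt g W))) * Ring.inverse (tau g W)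

/-- The generating function of connected correlators of the local operators `O_n`, `n ≥ 1`, in the
background `b`: `log (⟨b/g| exp(∑ j_n α_n) |Φ⟩ / ⟨b/g|Φ⟩)`.  The variable of index `n` is
`j_{n+1}`. -/
def freeEnergy (g : ℂ) (W : PsiDO N) : MvPowerSeries ℕ ℂ :=
  flog ((ketAt g W ∅)⁻¹ • coherent (fun n : ℕ => alpha ((n : ℤ) + 1)) (ketAt g W))

/-- `∏ (m_s)!`. -/
def multiFactorial {σ : Type*} (m : σ →₀ ℕ) : ℂ := m.prod fun _ k => (k.factorial : ℂ)

/-- The connected correlator `⟨∏_n O_{n+1}^{m_n}⟩_c`. -/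
def connected (g : ℂ) (W : PsiDO N) (m : ℕ →₀ ℕ) : ℂ :=
  multiFactorial m * MvPowerSeries.coeff m (freeEnergy g W)

end Correlators

section WeakCoupling

variable {N : ℕ} [NeZero N]

/-- The connected correlators of a family of solutions with couplings `g ∈ S` have the asymptotic
genus expansion `⟨∏_n O_{n+1}^{m_n}⟩_c = ∑_h g^(2h+|m|-2) V h m` as `g → 0`. -/
def HasGenusExpansion {p : ℕ} {b : ℕ →₀ ℂ} {γ : ℂ} {S : Set ℂ}
    (sol : (g : S) → DouglasSolution N p g b γ) (V : ℕ → (ℕ →₀ ℕ) → ℂ) : Prop :=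
  ∀ m : ℕ →₀ ℕ, m ≠ 0 → ∀ H : ℕ,
    (fun g : S => connected (g : ℂ) (sol g).W m -
        ∑ h ∈ Finset.range (H + 1), (g : ℂ) ^ (2 * (h : ℤ) + m.degree - 2) * V h m)
      =O[comap Subtype.val (𝓝 (0 : ℂ))] fun g : S => (g : ℂ) ^ (2 * (H : ℤ) + m.degree)

/-- The genus-zero one-point function `⟨O_n⟩^(0)`, `n ≥ 1`, in the background `x = b + t`:
`∑_m ⟨O_n ∏_i O_i^{m_i}⟩^(0) ∏_i t_i^{m_i} / m_i!`. -/
def sphereOnePoint (N : ℕ) (V : ℕ → (ℕ →₀ ℕ) → ℂ) (n : ℕ) : TimeRing N :=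
  fun m => (multiFactorial m)⁻¹ *
    V 0 (m.mapDomain (fun i : Fin N => (i : ℕ)) + Finsupp.single (n - 1) 1)

/-- The coefficient of `ζ^(k/p)` in the disk amplitude
`⟨∂φ₀(ζ)⟩^(0) = (1/p) ∑_{n≥1} n x_n ζ^(n/p-1) + (1/p) ∑_{n≥1} ⟨O_n⟩^(0) ζ^(-n/p-1)`. -/
def diskAmplitude (N p : ℕ) (b : ℕ →₀ ℂ) (V : ℕ → (ℕ →₀ ℕ) → ℂ) (k : ℤ) : TimeRing N :=
  (p : ℂ)⁻¹ • (if 0 < k + p then ((k + p : ℤ) : ℂ) • time N b (k + p).toNat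
    else if k + p < 0 then sphereOnePoint N V (-(k + p)).toNat else 0)

end WeakCoupling

end MinimalString

end

open MinimalString

/-! Conjugation by the Sato operator makes the Douglas equation solvable. With `A` standing for `W⁻¹
Q W`, the Douglas equation becomes `[∂^p, A] = g` and the flows become `g ∂A/∂x_n = [∂^n, A]`. These
equations fix `A` up to its value at `t = 0`, and the normalization gives `A = (1/p) (∑ n x_n
∂^(n-p) + g γ ∂^(-p))` (`DouglasSolution.A_eq`, `symbol_eq`). Since `A` is affine in `x_1`, the
symbol of `W ∘ A` has only two terms, and `Q Ψ` is `(1/p) λ^(1-p) (g ∂/∂λ + ∑ n x_n λ^(n-1))` acting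
on `W`, plus the `γ` term.

Two fermionic facts turn this into correlators. Sato's formula `τ W = ⟨x/g| e^{φ₊(λ)} |Φ⟩`
(`tau_smul_eq_vertexCorr`) comes from a uniqueness argument: all covariant time derivatives of
either side, taken at `t = 0`, lie in the span of the vectors `Φ_k(b; λ)`, while their difference
has no non-negative power of `λ`. The span contains no such non-zero vector, so the Taylor
coefficients of the difference vanish degree by degree. On the fermionic side this uses `⟨0|
e^{φ₊(λ)} = ⟨1| ψ(λ)` with the charge-one vacuum `⟨1|` (`expPhiPlus_apply_empty`), and the fact that
contracting `ψ(λ)` with a decomposable state gives combinations of its defining vectors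
(`exists_psi_decomposable`). Secondly, inserting `∂φ(λ)` next to `e^{φ₊(λ)}` amounts to `∂/∂λ + g⁻¹
∑ n x_n λ^(n-1)` (`coeff_currentSeries`): positive modes differentiate the exponential, the others
act on the bra as multiplication by times. As `τ` is free of `λ`, it cancels from the quotient.

For the limit, `Q` is the time series plus `(g/p) λ^(1-p) ∂_λ log V` and the `γ` term, with `V` the
vertex correlator. Keep all sources `j_n` in `V` and let `Y_n = ∂ log V / ∂j_n`. Equality of mixed
derivatives expresses the coefficient of `λ^(-l)` in `Y_n` by source derivatives of lower
coefficients (`sourceLogDer_recursion`). At `l = 0` it is the derivative of the free energy, of size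
`g^(|d|-1)` at degree `d`. Each further source derivative gains a power of `g`, so every `l > 0`
drops out and only the planar one-point functions remain. -/

noncomputable section

namespace MinimalString

/-! ## Laurent series bounded below -/

section LowBound

variable {R : Type*} [CommRing R]

/-- All coefficients below `a` vanish. -/
def LowBound (A : LaurentSeries R) (a : ℤ) : Prop := ∀ i < a, A.coeff i = 0

theorem exists_lowBound (A : LaurentSeries R) : ∃ a, LowBound A a :=
  ⟨A.order, fun _ hi => HahnSeries.coeff_eq_zero_of_lt_order hi⟩

theorem LowBound.mono {A : LaurentSeries R} {a b : ℤ} (h : LowBound A a) (hb : b ≤ a) :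
    LowBound A b := fun i hi => h i (by omega)

theorem lowBound_zero (a : ℤ) : LowBound (0 : LaurentSeries R) a := fun _ _ => by simp

theorem LowBound.add {A B : LaurentSeries R} {a : ℤ} (hA : LowBound A a) (hB : LowBound B a) :
    LowBound (A + B) a := fun i hi => by simp [hA i hi, hB i hi]

theorem LowBound.sub {A B : LaurentSeries R} {a : ℤ} (hA : LowBound A a) (hB : LowBound B a) :
    LowBound (A - B) a := fun i hi => by simp [hA i hi, hB i hi]

theorem LowBound.nsmul {A : LaurentSeries R} {a : ℤ} (r : ℕ) (hA : LowBound A a) :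
    LowBound (r • A) a := fun i hi => by rw [HahnSeries.coeff_smul, hA i hi, smul_zero]

theorem LowBound.sum {ι : Type*} {s : Finset ι} {f : ι → LaurentSeries R} {a : ℤ}
    (h : ∀ i ∈ s, LowBound (f i) a) : LowBound (∑ i ∈ s, f i) a := fun j hj => by
  rw [HahnSeries.coeff_sum]
  exact Finset.sum_eq_zero fun i hi => h i hi j hj

theorem coeff_mul_eq_sum {A B : LaurentSeries R} {a b : ℤ} (hA : LowBound A a) (hB : LowBound B b)
    (m : ℤ) : (A * B).coeff m = ∑ i ∈ Finset.Icc a (m - b), A.coeff i * B.coeff (m - i) := by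
  rw [HahnSeries.coeff_mul]
  refine Finset.sum_of_injOn (fun ij => ij.1) ?_ ?_ ?_ ?_
  · rintro ⟨i, j⟩ h ⟨i', j'⟩ h' hij
    simp only [Finset.mem_coe, Finset.mem_antidiagonal] at h h' hij
    ext <;> simp <;> omega
  · rintro ⟨i, j⟩ h
    simp only [Finset.mem_coe, Finset.mem_antidiagonal, HahnSeries.mem_support] at h
    have h1 : a ≤ i := by by_contra! h1; exact h.1 (hA i h1)
    have h2 : b ≤ j := by by_contra! h2; exact h.2.1 (hB j h2)
    simp; omega
  · intro i _ hi
    by_contra hne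
    apply hi
    refine ⟨(i, m - i), ?_, rfl⟩
    simp only [Finset.mem_coe, Finset.mem_antidiagonal, HahnSeries.mem_support]
    exact ⟨left_ne_zero_of_mul hne, right_ne_zero_of_mul hne, by ring⟩
  · rintro ⟨i, j⟩ h
    simp only [Finset.mem_antidiagonal] at h
    have : j = m - i := by omega
    subst this; rfl

theorem LowBound.mul {A B : LaurentSeries R} {a b : ℤ} (hA : LowBound A a) (hB : LowBound B b) :
    LowBound (A * B) (a + b) := fun m hm => by
  rw [coeff_mul_eq_sum hA hB, Finset.Icc_eq_empty (by omega), Finset.sum_empty]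

theorem lowBound_single (n : ℤ) (r : R) : LowBound (HahnSeries.single n r) n := fun i hi => by
  rw [HahnSeries.coeff_single_of_ne (by omega)]

/-- Series are separated by order, so an identity between compositions may be checked on truncated
sums, modulo arbitrarily high powers of `λ⁻¹`. -/
theorem eq_of_forall_lowBound_sub {A B : LaurentSeries R} (s : ℤ)
    (h : ∀ K : ℕ, LowBound (A - B) (s + K)) : A = B := by
  ext m
  have := h (m - s + 1).toNat m (by omega)
  simpa [sub_eq_zero] using this

/-- The Hasse derivative in `λ` of a series in `λ⁻¹`. -/
def hasseLam (k : ℕ) : LaurentSeries R →ₗ[R] LaurentSeries R where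
  toFun A := HahnSeries.ofSuppBddBelow
    -- The operator `(1/k!) ∂_λ^k` sends `λ^(k-j)` to `(k-j choose k) λ^(-j)`; the generalized
    -- binomial covers negative exponents.
    (fun j => (Ring.choose (k - j : ℤ) k : ℤ) • A.coeff (j - k)) (by
      obtain ⟨a, ha⟩ := exists_lowBound A
      refine ⟨a + k, fun j hj => ?_⟩
      by_contra! h
      exact hj (by simp [ha (j - k) (by omega)]))
  map_add' A B := by ext j; simp [smul_add]
  map_smul' c A := by ext j; simp [mul_left_comm]

theorem coeff_hasseLam (k : ℕ) (A : LaurentSeries R) (j : ℤ) :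
    (hasseLam k A).coeff j = (Ring.choose (k - j : ℤ) k : ℤ) • A.coeff (j - k) := rfl

theorem LowBound.hasseLam {A : LaurentSeries R} {a : ℤ} (h : LowBound A a) (k : ℕ) :
    LowBound (hasseLam k A) (a + k) := fun j hj => by
  rw [coeff_hasseLam, h _ (by omega), smul_zero]

@[simp] theorem hasseLam_zero (A : LaurentSeries R) : hasseLam 0 A = A := by
  ext j; simp [coeff_hasseLam]

/-- Coefficientwise this is the Vandermonde identity for generalized binomials, as the exponents of
the two factors add up. -/
theorem hasseLam_mul (k : ℕ) (A B : LaurentSeries R) :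
    hasseLam k (A * B) =
      ∑ ij ∈ Finset.HasAntidiagonal.antidiagonal k, hasseLam ij.1 A * hasseLam ij.2 B := by
  obtain ⟨a, hA⟩ := exists_lowBound A
  obtain ⟨b, hB⟩ := exists_lowBound B
  ext m
  rw [HahnSeries.coeff_sum, coeff_hasseLam, coeff_mul_eq_sum hA hB, Finset.smul_sum]
  have key : ∀ ij ∈ Finset.HasAntidiagonal.antidiagonal k, (hasseLam ij.1 A * hasseLam ij.2 B).coeff m =
      ∑ i ∈ Finset.Icc a (m - k - b), (Ring.choose (-i : ℤ) ij.1 *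
        Ring.choose (-(m - k - i) : ℤ) ij.2) • (A.coeff i * B.coeff (m - k - i)) := by
    rintro ⟨u, v⟩ huv
    rw [Finset.HasAntidiagonal.mem_antidiagonal] at huv
    simp only at huv ⊢
    rw [coeff_mul_eq_sum (hA.hasseLam u) (hB.hasseLam v)]
    have : Finset.Icc (a + u) (m - (b + v)) =
        (Finset.Icc a (m - k - b)).map (addRightEmbedding (u : ℤ)) := by
      rw [Finset.map_add_right_Icc]; congr 1; omega
    rw [this, Finset.sum_map]
    refine Finset.sum_congr rfl fun i _ => ?_
    simp only [addRightEmbedding_apply, coeff_hasseLam]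
    have e1 : m - (i + u) - v = m - k - i := by omega
    have e2 : (u : ℤ) - (i + u) = -i := by ring
    have e3 : (v : ℤ) - (m - (i + u)) = -(m - k - i) := by omega
    rw [e1, e2, e3, add_sub_cancel_right, smul_mul_smul_comm]
  rw [Finset.sum_congr rfl key, Finset.sum_comm]
  refine Finset.sum_congr rfl fun i _ => ?_
  rw [← Finset.sum_smul, ← Ring.add_choose_eq k (Commute.all _ _)]
  congr 2; ring

theorem hasseLam_hasseLam (i k : ℕ) (A : LaurentSeries R) :
    hasseLam i (hasseLam k A) = (i + k).choose i • hasseLam (i + k) A := by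
  ext m
  rw [HahnSeries.coeff_smul]
  simp only [coeff_hasseLam]
  have e1 : m - i - k = m - ((i + k : ℕ) : ℤ) := by push_cast; ring
  rw [e1, smul_smul, ← Nat.cast_smul_eq_nsmul ℤ, smul_smul]
  congr 1
  have := Ring.choose_smul_choose (((i + k : ℕ) : ℤ) - m) (n := i + k) (k := k) (by omega)
  have e2 : (((i + k : ℕ) : ℤ) - m) - k = i - m := by push_cast; ring
  have e3 : (k : ℤ) - (m - i) = ((i + k : ℕ) : ℤ) - m := by push_cast; ring
  rw [e2, Nat.add_sub_cancel] at this
  rw [e3, mul_comm, ← this, nsmul_eq_mul, Nat.choose_symm_add]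

theorem hasseLam_single (k : ℕ) (n : ℤ) (r : R) :
    hasseLam k (HahnSeries.single n r) =
      HahnSeries.single (n + k) ((Ring.choose (-n : ℤ) k : ℤ) • r) := by
  ext j
  rw [coeff_hasseLam]
  by_cases h : j = n + k
  · subst h
    simp
  · rw [HahnSeries.coeff_single_of_ne h, HahnSeries.coeff_single_of_ne (by omega), smul_zero]

theorem hasseLam_one_mul (A B : LaurentSeries R) :
    hasseLam 1 (A * B) = hasseLam 1 A * B + A * hasseLam 1 B := by
  rw [hasseLam_mul, Finset.Nat.antidiagonal_succ]
  simp [add_comm]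

/-! ### Derivations of the coefficient ring, applied to series. -/

/-- Apply a derivation of the coefficients to a Laurent series. -/
def mapDer [Algebra ℂ R] (d : Derivation ℂ R R) :
    LaurentSeries R →ₗ[ℂ] LaurentSeries R where
  toFun A := A.map d
  map_add' A B := by ext j; simp
  map_smul' c A := by ext j; simp

variable [Algebra ℂ R] (d e : Derivation ℂ R R)

@[simp] theorem coeff_mapDer (A : LaurentSeries R) (j : ℤ) :
    (mapDer d A).coeff j = d (A.coeff j) := rfl

theorem coeff_mapDer_iterate (n : ℕ) (A : LaurentSeries R) (j : ℤ) :
    ((mapDer d)^[n] A).coeff j = d^[n] (A.coeff j) := by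
  induction n with
  | zero => rfl
  | succ n ih => rw [Function.iterate_succ_apply', Function.iterate_succ_apply', coeff_mapDer, ih]

theorem mapDer_iterate_map_sum {ι : Type*} (n : ℕ) (s : Finset ι) (f : ι → LaurentSeries R) :
    (mapDer d)^[n] (∑ i ∈ s, f i) = ∑ i ∈ s, (mapDer d)^[n] (f i) := by
  rw [← Module.End.coe_pow, map_sum]

theorem mapDer_iterate_sub (n : ℕ) (A B : LaurentSeries R) :
    (mapDer d)^[n] (A - B) = (mapDer d)^[n] A - (mapDer d)^[n] B := by
  rw [← Module.End.coe_pow, map_sub]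

theorem LowBound.mapDer {A : LaurentSeries R} {a : ℤ} (h : LowBound A a) :
    LowBound (mapDer d A) a := fun j hj => by simp [h j hj]

theorem LowBound.mapDer_iterate {A : LaurentSeries R} {a : ℤ} (h : LowBound A a) (n : ℕ) :
    LowBound ((MinimalString.mapDer d)^[n] A) a := by
  induction n with
  | zero => exact h
  | succ n ih => rw [Function.iterate_succ_apply']; exact ih.mapDer d

theorem mapDer_mul (A B : LaurentSeries R) :
    mapDer d (A * B) = mapDer d A * B + A * mapDer d B := by
  obtain ⟨a, hA⟩ := exists_lowBound A
  obtain ⟨b, hB⟩ := exists_lowBound B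
  ext m
  rw [HahnSeries.coeff_add, coeff_mapDer, coeff_mul_eq_sum hA hB,
    coeff_mul_eq_sum (hA.mapDer d) hB, coeff_mul_eq_sum hA (hB.mapDer d),
    ← Finset.sum_add_distrib, map_sum]
  refine Finset.sum_congr rfl fun i _ => ?_
  simp only [Derivation.leibniz, coeff_mapDer, smul_eq_mul]
  ring

theorem mapDer_iterate_mul (n : ℕ) (A B : LaurentSeries R) :
    (mapDer d)^[n] (A * B) = ∑ ij ∈ Finset.HasAntidiagonal.antidiagonal n,
      n.choose ij.1 • ((mapDer d)^[ij.1] A * (mapDer d)^[ij.2] B) := by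
  induction n with
  | zero => simp
  | succ n ih =>
    rw [Function.iterate_succ_apply', ih, Finset.sum_antidiagonal_choose_succ_nsmul
      (fun i j => (mapDer d)^[i] A * (mapDer d)^[j] B), map_sum, ← Finset.sum_add_distrib]
    refine Finset.sum_congr rfl fun ij hij => ?_
    have hs : n.choose ij.2 = n.choose ij.1 := by
      rw [← Nat.choose_symm_of_eq_add (Finset.HasAntidiagonal.mem_antidiagonal.mp hij).symm]
    rw [map_nsmul, mapDer_mul, hs, ← smul_add, add_comm, Function.iterate_succ_apply',
      Function.iterate_succ_apply']

theorem mapDer_hasseLam (k : ℕ) (A : LaurentSeries R) :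
    mapDer d (hasseLam k A) = hasseLam k (mapDer d A) := by
  ext m
  simp only [coeff_mapDer, coeff_hasseLam, map_zsmul]

theorem mapDer_iterate_hasseLam (n k : ℕ) (A : LaurentSeries R) :
    (mapDer d)^[n] (hasseLam k A) = hasseLam k ((mapDer d)^[n] A) := by
  induction n with
  | zero => rfl
  | succ n ih => rw [Function.iterate_succ_apply', ih, mapDer_hasseLam, Function.iterate_succ_apply']

theorem mapDer_mapDer_comm (h : ∀ r, d (e r) = e (d r)) (A : LaurentSeries R) :
    mapDer d (mapDer e A) = mapDer e (mapDer d A) := by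
  ext m; simp [h]

end LowBound

/-! ## Composition of pseudo-differential operators -/

section Comp

variable {N : ℕ} [NeZero N] (g : ℂ)

/-- The derivation `g ∂/∂x_1` of the coefficient ring. -/
def del (N : ℕ) [NeZero N] (g : ℂ) : Derivation ℂ (TimeRing N) (TimeRing N) :=
  g • MvPowerSeries.pderiv ℂ (0 : Fin N)

theorem del_iterate (k : ℕ) (f : TimeRing N) :
    (del N g)^[k] f = g ^ k • (dTime (0 : Fin N))^[k] f := by
  induction k with
  | zero => simp
  | succ k ih =>
    rw [Function.iterate_succ_apply', ih, Function.iterate_succ_apply', Derivation.map_smul, pow_succ,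
      mul_smul]
    rfl

/-- The symbol product formula `A ∘ B = ∑_k (1/k!) (∂_λ^k A) (∂^k B)`. The `k`th term has order at
least `a + b + k` in `λ⁻¹`, so cutting at `K` is exact below `a + b + K`. -/
theorem coeff_comp {A B : PsiDO N} {a b : ℤ} (hA : LowBound A a) (hB : LowBound B b)
    {m : ℤ} {K : ℕ} (hm : m < a + b + K) :
    (comp g A B).coeff m =
      ∑ k ∈ Finset.range K, (hasseLam k A * (mapDer (del N g))^[k] B).coeff m := by
  change compCoeff g A B m = _
  unfold compCoeff
  rw [finsum_eq_sum_of_support_subset (s := Finset.Icc a (m - b) ×ˢ Finset.range K),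
    Finset.sum_product, Finset.sum_comm]
  · refine Finset.sum_congr rfl fun k _ => ?_
    rw [coeff_mul_eq_sum (hA.hasseLam k) ((hB.mapDer_iterate (del N g) k).mono
      (show b - k ≤ b by omega))]
    have : Finset.Icc (a + k) (m - (b - k)) =
        (Finset.Icc a (m - b)).map (addRightEmbedding (k : ℤ)) := by
      rw [Finset.map_add_right_Icc]; congr 1; omega
    rw [this, Finset.sum_map]
    refine Finset.sum_congr rfl fun i _ => ?_
    simp only [addRightEmbedding_apply, coeff_hasseLam, coeff_mapDer_iterate, del_iterate,
      add_sub_cancel_right]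
    have e2 : (k : ℤ) - (i + k) = -i := by ring
    rw [e2, sub_sub, mul_smul_comm, smul_mul_assoc]
  · rintro ⟨i, k⟩ h
    have h1 : a ≤ i := by by_contra! h1; exact h (by simp [hA i h1])
    have h2 : b ≤ m - i - k := by
      by_contra! h2; exact h (by simp [hB _ h2, dTime_iterate_zero])
    simp; omega

theorem comp_approx {A B : PsiDO N} {a b : ℤ} (hA : LowBound A a) (hB : LowBound B b) (K : ℕ) :
    LowBound (comp g A B - ∑ k ∈ Finset.range K, hasseLam k A * (mapDer (del N g))^[k] B)
      (a + b + K) := fun m hm => by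
  rw [HahnSeries.coeff_sub, HahnSeries.coeff_sum, coeff_comp g hA hB hm, sub_self]

theorem LowBound.comp {A B : PsiDO N} {a b : ℤ} (hA : LowBound A a) (hB : LowBound B b) :
    LowBound (comp g A B) (a + b) := fun m hm => by
  rw [coeff_comp g hA hB (K := 0) (by simpa using hm)]; simp

theorem exists_coeff_comp (A B : PsiDO N) (m : ℤ) : ∃ K₀ : ℕ, ∀ K ≥ K₀, (comp g A B).coeff m =
    ∑ k ∈ Finset.range K, (hasseLam k A * (mapDer (del N g))^[k] B).coeff m := by
  obtain ⟨a, hA⟩ := exists_lowBound A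
  obtain ⟨b, hB⟩ := exists_lowBound B
  exact ⟨(m - a - b + 1).toNat, fun K hK => coeff_comp g hA hB (by omega)⟩

/-- Terms outside the triangle `i + j < K` vanish, so the triangular sum may be replaced by a square
one. This brings the two truncations in `comp_assoc` to one form. -/
theorem sum_range_antidiagonal {M : Type*} [AddCommMonoid M] (K : ℕ) (u : ℕ → ℕ → M)
    (hu : ∀ i j, K ≤ i + j → u i j = 0) :
    ∑ l ∈ Finset.range K, ∑ ij ∈ Finset.HasAntidiagonal.antidiagonal l, u ij.1 ij.2 =
      ∑ i ∈ Finset.range K, ∑ j ∈ Finset.range K, u i j := by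
  rw [← Finset.sum_product', Finset.sum_sigma']
  refine Finset.sum_bij_ne_zero (fun x _ _ => x.2) ?_ ?_ ?_ ?_
  · rintro ⟨l, i, j⟩ h _
    simp at h ⊢; omega
  · rintro ⟨l, i, j⟩ h _ ⟨l', i', j'⟩ h' _ hh
    simp at h h' hh
    obtain ⟨rfl, rfl⟩ := hh
    obtain ⟨_, rfl⟩ := h
    obtain ⟨_, rfl⟩ := h'
    rfl
  · rintro ⟨i, j⟩ _ hne
    refine ⟨⟨i + j, i, j⟩, ?_, hne, rfl⟩
    have : i + j < K := by by_contra! h; exact hne (hu i j h)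
    simpa using this
  · rintro ⟨l, i, j⟩ _ _; rfl

/-- Composition is associative. -/
theorem comp_assoc (A B C : PsiDO N) : comp g (comp g A B) C = comp g A (comp g B C) := by
  obtain ⟨a, hA⟩ := exists_lowBound A
  obtain ⟨b, hB⟩ := exists_lowBound B
  obtain ⟨c, hC⟩ := exists_lowBound C
  set D := (mapDer (del N g) : PsiDO N →ₗ[ℂ] PsiDO N) with hD
  -- Both bracketings expand into the same triple sum. In `T i j k`, `i` pairs the `λ`-derivatives
  -- of `A` with `x`-derivatives of `C`, `j` pairs `B` with `C`, and `k` pairs `A` with `B`. Each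
  -- index raises the order by one, so only `i + j + k < K` matters at precision `K`.
  let T : ℕ → ℕ → ℕ → PsiDO N := fun i j k =>
    (i + k).choose i • (hasseLam (i + k) A * (hasseLam j (D^[k] B) * D^[i + j] C))
  have hT : ∀ i j k, LowBound (T i j k) (a + b + c + i + j + k) := fun i j k =>
    (((hA.hasseLam _).mul (((hB.mapDer_iterate _ k).hasseLam j).mul
      (hC.mapDer_iterate _ _))).nsmul _).mono (by push_cast; omega)
  have hL : ∀ K : ℕ, LowBound (comp g (comp g A B) C - ∑ l ∈ Finset.range K,
      ∑ k ∈ Finset.range K, ∑ ij ∈ Finset.HasAntidiagonal.antidiagonal l, T ij.1 ij.2 k) (a + b + c + K) := by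
    intro K
    have h1 := comp_approx g (hA.comp g hB) hC K
    have h2 := comp_approx g hA hB K
    have h3 : LowBound (∑ l ∈ Finset.range K, hasseLam l (comp g A B -
        ∑ k ∈ Finset.range K, hasseLam k A * D^[k] B) * D^[l] C) (a + b + c + K) :=
      LowBound.sum fun l _ => ((h2.hasseLam l).mul (hC.mapDer_iterate _ l)).mono (by omega)
    refine ((h1.add h3)).mono le_rfl |> fun h => ?_
    convert h using 1
    rw [← hD, sub_add, ← Finset.sum_sub_distrib]
    congr 1
    refine Finset.sum_congr rfl fun l _ => ?_
    rw [← sub_mul, ← map_sub, sub_sub_cancel, map_sum, Finset.sum_mul]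
    refine Finset.sum_congr rfl fun k _ => ?_
    rw [hasseLam_mul, Finset.sum_mul]
    refine Finset.sum_congr rfl fun ij hij => ?_
    rw [Finset.HasAntidiagonal.mem_antidiagonal] at hij
    simp only [T]
    rw [hasseLam_hasseLam, hij, smul_mul_assoc, smul_mul_assoc, mul_assoc]
  have hR : ∀ K : ℕ, LowBound (comp g A (comp g B C) - ∑ n ∈ Finset.range K,
      ∑ j ∈ Finset.range K, ∑ ik ∈ Finset.HasAntidiagonal.antidiagonal n, T ik.1 j ik.2) (a + b + c + K) := by
    intro K
    have h1 := comp_approx g hA (hB.comp g hC) K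
    have h2 := comp_approx g hB hC K
    have h3 : LowBound (∑ n ∈ Finset.range K, hasseLam n A * D^[n] (comp g B C -
        ∑ k ∈ Finset.range K, hasseLam k B * D^[k] C)) (a + b + c + K) :=
      LowBound.sum fun l _ => ((hA.hasseLam l).mul (h2.mapDer_iterate _ l)).mono (by omega)
    have h := (h1.mono (show a + b + c + K ≤ _ by omega)).add h3
    convert h using 1
    rw [← hD, sub_add, ← Finset.sum_sub_distrib]
    congr 1
    refine Finset.sum_congr rfl fun n _ => ?_
    rw [← mul_sub, ← mapDer_iterate_sub, sub_sub_cancel, mapDer_iterate_map_sum, Finset.mul_sum]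
    refine Finset.sum_congr rfl fun j _ => ?_
    rw [mapDer_iterate_mul, Finset.mul_sum]
    conv_lhs => rw [← Finset.HasAntidiagonal.map_swap_antidiagonal, Finset.sum_map]
    refine Finset.sum_congr rfl fun ik hik => ?_
    rw [Finset.HasAntidiagonal.mem_antidiagonal] at hik
    simp only [T, Function.Embedding.coeFn_mk, Prod.fst_swap, Prod.snd_swap]
    have hs : n.choose ik.2 = n.choose ik.1 := by
      rw [← Nat.choose_symm_of_eq_add hik.symm]
    rw [add_comm ik.2 ik.1, hik, hs, mapDer_iterate_hasseLam, ← Function.iterate_add_apply, mul_smul_comm]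
  refine eq_of_forall_lowBound_sub (a + b + c) fun K => ?_
  have h := (hL K).sub (hR K)
  intro m hm
  have h' := h m hm
  rw [HahnSeries.coeff_sub, HahnSeries.coeff_sub, HahnSeries.coeff_sub] at h'
  have hz : ∀ i j k, K ≤ i + j + k → (T i j k).coeff m = 0 := fun i j k hK =>
    hT i j k m (by omega)
  have e1 : (∑ l ∈ Finset.range K, ∑ k ∈ Finset.range K,
      ∑ ij ∈ Finset.HasAntidiagonal.antidiagonal l, T ij.1 ij.2 k).coeff m =
      ∑ i ∈ Finset.range K, ∑ j ∈ Finset.range K, ∑ k ∈ Finset.range K, (T i j k).coeff m := by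
    simp only [HahnSeries.coeff_sum]
    rw [← sum_range_antidiagonal K (fun i j => ∑ k ∈ Finset.range K, (T i j k).coeff m)
      fun i j hij => Finset.sum_eq_zero fun k _ => hz i j k (by omega)]
    exact Finset.sum_congr rfl fun l _ => Finset.sum_comm
  have e2 : (∑ n ∈ Finset.range K, ∑ j ∈ Finset.range K,
      ∑ ik ∈ Finset.HasAntidiagonal.antidiagonal n, T ik.1 j ik.2).coeff m =
      ∑ i ∈ Finset.range K, ∑ j ∈ Finset.range K, ∑ k ∈ Finset.range K, (T i j k).coeff m := by
    simp only [HahnSeries.coeff_sum]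
    have := sum_range_antidiagonal K (fun i k => ∑ j ∈ Finset.range K, (T i j k).coeff m)
      fun i k hik => Finset.sum_eq_zero fun j _ => hz i j k (by omega)
    calc _ = _ := Finset.sum_congr rfl fun l _ => Finset.sum_comm
      _ = _ := this
      _ = ∑ i ∈ Finset.range K, ∑ j ∈ Finset.range K, ∑ k ∈ Finset.range K,
          (T i j k).coeff m := Finset.sum_congr rfl fun l _ => Finset.sum_comm
  rw [e1, e2] at h'
  rw [HahnSeries.coeff_sub]
  linear_combination h'

/-! ### Linearity and the derivations -/

theorem comp_add_left (A A' B : PsiDO N) : comp g (A + A') B = comp g A B + comp g A' B := by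
  ext1; funext m
  obtain ⟨K₁, h₁⟩ := exists_coeff_comp g (A + A') B m
  obtain ⟨K₂, h₂⟩ := exists_coeff_comp g A B m
  obtain ⟨K₃, h₃⟩ := exists_coeff_comp g A' B m
  have l1 : K₁ ≤ K₁ + K₂ + K₃ := by omega
  have l2 : K₂ ≤ K₁ + K₂ + K₃ := by omega
  have l3 : K₃ ≤ K₁ + K₂ + K₃ := by omega
  rw [HahnSeries.coeff_add, h₁ _ l1, h₂ _ l2, h₃ _ l3, ← Finset.sum_add_distrib]
  simp only [map_add, add_mul, HahnSeries.coeff_add]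

omit [NeZero N] in
theorem csmul_eq_smul (c : ℂ) (A : PsiDO N) : c • A = (MvPowerSeries.C c : TimeRing N) • A := by
  ext m : 2
  rw [HahnSeries.coeff_smul, HahnSeries.coeff_smul, smul_eq_mul, MvPowerSeries.smul_eq_C_mul]

omit [NeZero N] in
theorem coeff_smul_mul (f : TimeRing N) (A B : PsiDO N) (m : ℤ) :
    (f • A * B).coeff m = f • (A * B).coeff m := by
  rw [← HahnSeries.C_mul_eq_smul, mul_assoc, HahnSeries.C_mul_eq_smul, HahnSeries.coeff_smul]

omit [NeZero N] in
theorem coeff_mul_csmul (c : ℂ) (A B : PsiDO N) (m : ℤ) :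
    (A * c • B).coeff m = c • (A * B).coeff m := by
  rw [csmul_eq_smul, mul_comm, coeff_smul_mul, mul_comm, smul_eq_mul, MvPowerSeries.smul_eq_C_mul]

theorem comp_smul_left (f : TimeRing N) (A B : PsiDO N) :
    comp g (f • A) B = f • comp g A B := by
  ext1; funext m
  obtain ⟨K₁, h₁⟩ := exists_coeff_comp g (f • A) B m
  obtain ⟨K₂, h₂⟩ := exists_coeff_comp g A B m
  have l1 : K₁ ≤ K₁ + K₂ := by omega
  have l2 : K₂ ≤ K₁ + K₂ := by omega
  rw [HahnSeries.coeff_smul, h₁ _ l1, h₂ _ l2, Finset.smul_sum]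
  simp only [map_smul, coeff_smul_mul]

theorem comp_add_right (A B B' : PsiDO N) : comp g A (B + B') = comp g A B + comp g A B' := by
  ext1; funext m
  obtain ⟨K₁, h₁⟩ := exists_coeff_comp g A (B + B') m
  obtain ⟨K₂, h₂⟩ := exists_coeff_comp g A B m
  obtain ⟨K₃, h₃⟩ := exists_coeff_comp g A B' m
  have l1 : K₁ ≤ K₁ + K₂ + K₃ := by omega
  have l2 : K₂ ≤ K₁ + K₂ + K₃ := by omega
  have l3 : K₃ ≤ K₁ + K₂ + K₃ := by omega
  rw [HahnSeries.coeff_add, h₁ _ l1, h₂ _ l2, h₃ _ l3, ← Finset.sum_add_distrib]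
  simp only [← Module.End.coe_pow, map_add, mul_add, HahnSeries.coeff_add]

theorem comp_smul_right (c : ℂ) (A B : PsiDO N) : comp g A (c • B) = c • comp g A B := by
  ext1; funext m
  obtain ⟨K₁, h₁⟩ := exists_coeff_comp g A (c • B) m
  obtain ⟨K₂, h₂⟩ := exists_coeff_comp g A B m
  have l1 : K₁ ≤ K₁ + K₂ := by omega
  have l2 : K₂ ≤ K₁ + K₂ := by omega
  rw [HahnSeries.coeff_smul, h₁ _ l1, h₂ _ l2, Finset.smul_sum]
  simp only [← Module.End.coe_pow, map_smul, coeff_mul_csmul]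

theorem comp_zero_left (B : PsiDO N) : comp g 0 B = 0 := by
  have := comp_add_left g 0 0 B
  simpa using this

theorem comp_neg_left (A B : PsiDO N) : comp g (-A) B = -comp g A B := by
  rw [eq_neg_iff_add_eq_zero, ← comp_add_left, neg_add_cancel]
  exact comp_zero_left g B

theorem comp_neg_right (A B : PsiDO N) : comp g A (-B) = -comp g A B := by
  rw [eq_neg_iff_add_eq_zero, ← comp_add_right, neg_add_cancel]
  have := comp_add_right g A 0 0
  simpa using this

theorem comp_sub_left (A A' B : PsiDO N) : comp g (A - A') B = comp g A B - comp g A' B := by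
  rw [sub_eq_add_neg, comp_add_left, comp_neg_left, sub_eq_add_neg]

theorem comp_sub_right (A B B' : PsiDO N) : comp g A (B - B') = comp g A B - comp g A B' := by
  rw [sub_eq_add_neg, comp_add_right, comp_neg_right, sub_eq_add_neg]

theorem comp_csmul_left (c : ℂ) (A B : PsiDO N) : comp g (c • A) B = c • comp g A B := by
  rw [csmul_eq_smul, csmul_eq_smul, comp_smul_left]

theorem comp_sum_left {ι : Type*} (s : Finset ι) (f : ι → PsiDO N) (B : PsiDO N) :
    comp g (∑ i ∈ s, f i) B = ∑ i ∈ s, comp g (f i) B := by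
  classical
  induction s using Finset.induction_on with
  | empty => simpa using comp_zero_left g B
  | insert a s ha ih => rw [Finset.sum_insert ha, comp_add_left, ih, Finset.sum_insert ha]

theorem pderiv_pderiv_comm {σ : Type*} (i j : σ) (f : MvPowerSeries σ ℂ) :
    MvPowerSeries.pderiv ℂ i (MvPowerSeries.pderiv ℂ j f) =
      MvPowerSeries.pderiv ℂ j (MvPowerSeries.pderiv ℂ i f) := by
  classical
  ext m
  simp only [MvPowerSeries.coeff_pderiv]
  rw [add_right_comm]
  by_cases h : i = j
  · subst h; rfl
  · simp [h, Ne.symm h]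
    ring

omit [NeZero N] in
theorem dTimeOp_eq (i : Fin N) : (dTimeOp i : PsiDO N → PsiDO N) =
    mapDer (MvPowerSeries.pderiv ℂ i) := rfl

theorem dTimeOp_comp (i : Fin N) (A B : PsiDO N) :
    dTimeOp i (comp g A B) = comp g (dTimeOp i A) B + comp g A (dTimeOp i B) := by
  rw [dTimeOp_eq]
  ext1; funext m
  obtain ⟨K₁, h₁⟩ := exists_coeff_comp g A B m
  obtain ⟨K₂, h₂⟩ := exists_coeff_comp g (mapDer (MvPowerSeries.pderiv ℂ i) A) B m
  obtain ⟨K₃, h₃⟩ := exists_coeff_comp g A (mapDer (MvPowerSeries.pderiv ℂ i) B) m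
  have l1 : K₁ ≤ K₁ + K₂ + K₃ := by omega
  have l2 : K₂ ≤ K₁ + K₂ + K₃ := by omega
  have l3 : K₃ ≤ K₁ + K₂ + K₃ := by omega
  have hc : ∀ r : TimeRing N, MvPowerSeries.pderiv ℂ i (del N g r) =
      del N g (MvPowerSeries.pderiv ℂ i r) := fun r => by
    simp only [del, Derivation.smul_apply, Derivation.map_smul, pderiv_pderiv_comm i]
  have hk : ∀ k, mapDer (MvPowerSeries.pderiv ℂ i) ((mapDer (del N g))^[k] B) =
      (mapDer (del N g))^[k] (mapDer (MvPowerSeries.pderiv ℂ i) B) := by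
    intro k
    induction k with
    | zero => rfl
    | succ k ih =>
      rw [Function.iterate_succ_apply', mapDer_mapDer_comm _ _ hc, ih,
        Function.iterate_succ_apply']
  rw [HahnSeries.coeff_add, coeff_mapDer, h₁ _ l1, h₂ _ l2, h₃ _ l3, ← Finset.sum_add_distrib,
    map_sum]
  refine Finset.sum_congr rfl fun k _ => ?_
  rw [← coeff_mapDer, mapDer_mul, mapDer_hasseLam, HahnSeries.coeff_add, hk]

/-! ### Special factors -/

/-- An operand affine in `x_1` leaves only the first two terms of the symbol product. Applied to
`W⁻¹ Q W`, the second term is the source of the `∂/∂λ` in `Q`. -/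
theorem comp_of_del_del_eq_zero {A B : PsiDO N} (h : mapDer (del N g) (mapDer (del N g) B) = 0) :
    comp g A B = A * B + hasseLam 1 A * mapDer (del N g) B := by
  ext1; funext m
  obtain ⟨K, hK⟩ := exists_coeff_comp g A B m
  have hz : ∀ k, (mapDer (del N g))^[k + 2] B = 0 := fun k => by
    rw [Function.iterate_add_apply]
    change (mapDer (del N g))^[k] (mapDer (del N g) (mapDer (del N g) B)) = 0
    rw [h, ← Module.End.coe_pow, map_zero]
  rw [hK (K + 2) (by omega), add_comm K 2, Finset.sum_range_add, Finset.sum_eq_zero (s := .range K)]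
  · simp [Finset.sum_range_succ]
  · intro k _
    rw [add_comm 2 k, hz, mul_zero, HahnSeries.coeff_zero]

theorem comp_of_del_eq_zero {A B : PsiDO N} (h : mapDer (del N g) B = 0) :
    comp g A B = A * B := by
  rw [comp_of_del_del_eq_zero g (by rw [h, map_zero]), h, mul_zero, add_zero]

omit [NeZero N] in
theorem mapDer_single (d : Derivation ℂ (TimeRing N) (TimeRing N)) (k : ℤ) (r : TimeRing N) :
    mapDer d (HahnSeries.single k r) = HahnSeries.single k (d r) := by
  ext1; funext j
  rw [coeff_mapDer]
  by_cases h : j = k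
  · subst h; simp
  · simp [HahnSeries.coeff_single_of_ne h]

omit [NeZero N] in
theorem mapDer_delPow (d : Derivation ℂ (TimeRing N) (TimeRing N)) (k : ℤ) :
    mapDer d (delPow N k) = 0 := by
  rw [delPow, mapDer_single]; simp

theorem comp_delPow (A : PsiDO N) (k : ℤ) : comp g A (delPow N k) = A * delPow N k :=
  comp_of_del_eq_zero g (mapDer_delPow _ _)

omit [NeZero N] in
theorem delPow_mul (j k : ℤ) : delPow N j * delPow N k = delPow N (j + k) := by
  simp [delPow, HahnSeries.single_mul_single]; ring_nf

theorem delPow_comp_delPow (j k : ℤ) : comp g (delPow N j) (delPow N k) = delPow N (j + k) := by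
  rw [comp_delPow, delPow_mul]

omit [NeZero N] in
theorem delPow_zero : delPow N 0 = 1 := rfl

theorem delPow_one_comp (B : PsiDO N) :
    comp g (delPow N 1) B = delPow N 1 * B + mapDer (del N g) B := by
  ext1; funext m
  obtain ⟨K, hK⟩ := exists_coeff_comp g (delPow N 1) B m
  rw [hK (K + 2) (by omega), add_comm K 2, Finset.sum_range_add, Finset.sum_eq_zero (s := .range K)]
  · simp [Finset.sum_range_succ, delPow, hasseLam_single]
  · intro k _
    have : Ring.choose (1 : ℤ) (2 + k) = 0 := by
      have := Ring.choose_natCast (R := ℤ) 1 (2 + k)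
      rw [Nat.choose_eq_zero_of_lt (by omega)] at this
      simpa using this
    simp [delPow, hasseLam_single, this]

theorem delPow_zero_comp (B : PsiDO N) : comp g (delPow N 0) B = B := by
  ext1; funext m
  obtain ⟨K, hK⟩ := exists_coeff_comp g (delPow N 0) B m
  rw [hK (K + 1) (by omega), add_comm K 1, Finset.sum_range_add, Finset.sum_eq_zero (s := .range K)]
  · simp [delPow]
  · intro k _
    have : Ring.choose (0 : ℤ) (1 + k) = 0 := by
      have := Ring.choose_natCast (R := ℤ) 0 (1 + k)
      rw [Nat.choose_eq_zero_of_lt (by omega)] at this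
      simpa using this
    rw [delPow, hasseLam_single, neg_zero, neg_zero, this, zero_smul, map_zero, zero_mul,
      HahnSeries.coeff_zero]

end Comp

/-! ## Canonical anticommutation relations -/

section RingIdentities

variable {R : Type*} [Ring R]

theorem anticomm_quadratic_left {x y z c : R} (h : y * z = -(z * y)) (hc : c * z = z * c) :
    (-(x * y) + c) * z - z * (-(x * y) + c) = (z * x + x * z) * y := by
  rw [add_mul, mul_add, hc, neg_mul, mul_assoc, h]
  noncomm_ring

theorem anticomm_quadratic_right {x y z c : R} (h : z * x = -(x * z)) (hc : c * z = z * c) :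
    (-(x * y) + c) * z - z * (-(x * y) + c) = -(x * (y * z + z * y)) := by
  rw [add_mul, mul_add, hc, mul_neg, ← mul_assoc z, h]
  noncomm_ring

/-- Here `c`, `d`, `e` are the normal-ordering constants of the original bilinear and of the two
shifted ones; the mismatch `e - d` produces the central term of the Heisenberg relations. -/
theorem comm_quadratic {a x y x' y' c d e : R} (h1 : a * y - y * a = y') (h2 : a * x - x * a = -x')
    (hc : c * a = a * c) :
    a * (-(x * y) + c) - (-(x * y) + c) * a =
      (-(x * y') + d) - (-(x' * y) + e) + (e - d) := by
  rw [sub_eq_iff_eq_add] at h1 h2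
  rw [mul_add, add_mul, hc, mul_neg, neg_mul, ← mul_assoc, h2, mul_assoc, add_mul, mul_assoc x, h1]
  noncomm_ring

end RingIdentities

section Fermions

theorem occ_symmDiff_of_ne {T : Finset ℤ} {j k : ℤ} (h : j ≠ k) :
    Occ (symmDiff T {k}) j ↔ Occ T j := by
  simp [Occ, Finset.mem_symmDiff, h]

theorem occ_symmDiff_self {T : Finset ℤ} {k : ℤ} : Occ (symmDiff T {k}) k ↔ ¬ Occ T k := by
  by_cases h1 : 0 ≤ k <;> by_cases h2 : k ∈ T <;> simp [Occ, Xor, Finset.mem_symmDiff, h1, h2]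

theorem levelSign_symmDiff (T : Finset ℤ) (j k : ℤ) :
    levelSign (symmDiff T {k}) j = if k < j then -levelSign T j else levelSign T j := by
  have hc : (symmDiff T {k}).filter (· < j) =
      if k < j then symmDiff (T.filter (· < j)) {k} else T.filter (· < j) := by
    ext x
    split_ifs with h <;> simp only [Finset.mem_filter, Finset.mem_symmDiff, Finset.mem_singleton]
    · by_cases hx : x = k
      · subst hx; simp [h]
      · simp [hx]
    · by_cases hx : x = k
      · subst hx; simp [h]
      · simp [hx]
  unfold levelSign
  rw [hc]
  split_ifs with h
  · by_cases hk : k ∈ T.filter (· < j)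
    · have : symmDiff (T.filter (· < j)) {k} = (T.filter (· < j)).erase k := by
        ext x; by_cases hx : x = k
        · subst hx; simp [Finset.mem_symmDiff] at hk ⊢; tauto
        · simp [Finset.mem_symmDiff, hx]
      rw [this, ← Finset.card_erase_add_one hk, ← add_assoc, pow_succ]
      ring
    · have : symmDiff (T.filter (· < j)) {k} = insert k (T.filter (· < j)) := by
        ext x; by_cases hx : x = k
        · subst hx; simp [Finset.mem_symmDiff] at hk ⊢; tauto
        · simp [Finset.mem_symmDiff, hx]
      rw [this, Finset.card_insert_of_notMem hk, ← add_assoc, pow_succ]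
      ring
  · rfl

theorem levelSign_mul_self (T : Finset ℤ) (k : ℤ) : levelSign T k * levelSign T k = 1 := by
  rw [levelSign, ← mul_pow]; simp

theorem symmDiff_symmDiff_singleton (T : Finset ℤ) (k : ℤ) :
    symmDiff (symmDiff T {k}) {k} = T := symmDiff_symmDiff_cancel_right _ _

theorem levelSign_swap (T : Finset ℤ) {j k : ℤ} (h : j ≠ k) :
    levelSign T k * levelSign (symmDiff T {k}) j =
      -(levelSign T j * levelSign (symmDiff T {j}) k) := by
  rw [levelSign_symmDiff, levelSign_symmDiff]
  rcases lt_or_gt_of_ne h with h | h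
  · rw [if_neg (by omega), if_pos h]; ring
  · rw [if_pos h, if_neg (by omega)]; ring

open Classical in
theorem psiBar_apply (k : ℤ) (f : Fock ℂ) (T : Finset ℤ) :
    psiBar k f T = if Occ T k then levelSign T k • f (symmDiff T {k}) else 0 := rfl

open Classical in
theorem psi_apply (k : ℤ) (f : Fock ℂ) (T : Finset ℤ) :
    psi k f T = if Occ T k then 0 else levelSign T k • f (symmDiff T {k}) := rfl

theorem smul_symmDiff_swap (T : Finset ℤ) (f : Fock ℂ) {j k : ℤ} (h : j ≠ k) :
    levelSign T k • levelSign (symmDiff T {k}) j • f (symmDiff (symmDiff T {k}) {j}) =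
      -(levelSign T j • levelSign (symmDiff T {j}) k • f (symmDiff (symmDiff T {j}) {k})) := by
  rw [smul_smul, smul_smul, levelSign_swap T h, neg_smul, symmDiff_right_comm]

theorem smul_symmDiff_self (T : Finset ℤ) (f : Fock ℂ) (k : ℤ) :
    levelSign T k • levelSign (symmDiff T {k}) k • f (symmDiff (symmDiff T {k}) {k}) = f T := by
  rw [smul_smul, levelSign_symmDiff, if_neg (lt_irrefl k), levelSign_mul_self, one_smul,
    symmDiff_symmDiff_singleton]

theorem psi_mul_psiBar_add (k j : ℤ) :
    (psi k * psiBar j + psiBar j * psi k : FockEnd) = if k = j then 1 else 0 := by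
  ext f T
  simp only [LinearMap.add_apply, Pi.add_apply, Module.End.mul_apply, psi_apply, psiBar_apply]
  by_cases h : k = j
  · subst h
    rw [if_pos rfl, occ_symmDiff_self]
    have := smul_symmDiff_self T f k
    by_cases hk : Occ T k <;> simp only [hk, not_true, not_false_iff, if_true, if_false, this,
      smul_zero, add_zero, zero_add, Module.End.one_apply]
  · rw [if_neg h, occ_symmDiff_of_ne h, occ_symmDiff_of_ne (Ne.symm h)]
    by_cases hk : Occ T k <;> by_cases hj : Occ T j <;> simp only [hk, hj, if_true, if_false,
      smul_zero, add_zero, LinearMap.zero_apply, Pi.zero_apply]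
    rw [smul_symmDiff_swap T f (Ne.symm h), neg_add_cancel]

theorem psi_mul_psi (k j : ℤ) : (psi k * psi j : FockEnd) = -(psi j * psi k) := by
  ext f T
  simp only [LinearMap.neg_apply, Pi.neg_apply, Module.End.mul_apply, psi_apply]
  by_cases h : k = j
  · subst h
    rw [occ_symmDiff_self]
    by_cases hk : Occ T k <;> simp [hk]
  · rw [occ_symmDiff_of_ne h, occ_symmDiff_of_ne (Ne.symm h)]
    by_cases hk : Occ T k <;> by_cases hj : Occ T j <;> simp only [hk, hj, if_true, if_false,
      smul_zero, neg_zero]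
    exact smul_symmDiff_swap T f (Ne.symm h)

theorem psiBar_mul_psiBar (k j : ℤ) : (psiBar k * psiBar j : FockEnd) = -(psiBar j * psiBar k) := by
  ext f T
  simp only [LinearMap.neg_apply, Pi.neg_apply, Module.End.mul_apply, psiBar_apply]
  by_cases h : k = j
  · subst h
    rw [occ_symmDiff_self]
    by_cases hk : Occ T k <;> simp [hk]
  · rw [occ_symmDiff_of_ne h, occ_symmDiff_of_ne (Ne.symm h)]
    by_cases hk : Occ T k <;> by_cases hj : Occ T j <;> simp only [hk, hj, if_true, if_false,
      smul_zero, neg_zero]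
    exact smul_symmDiff_swap T f (Ne.symm h)

/-- One formula on both sides of the Fermi level: normal ordering is `-ψ̄ψ` plus a constant, so
commutators need no case distinction. -/
theorem normalOrd_eq (k j : ℤ) : (normalOrd k j : FockEnd) =
    -(psiBar j * psi k) + if k = j ∧ 0 ≤ k then 1 else 0 := by
  unfold normalOrd
  have := psi_mul_psiBar_add k j
  by_cases hk : k < 0
  · rw [if_pos hk, if_neg (by omega), add_zero]
  · rw [if_neg hk, eq_neg_add_iff_add_eq, add_comm, this]
    by_cases h : k = j <;> simp [h]
    omega

theorem lie_normalOrd_psi (k j i : ℤ) :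
    (normalOrd k j * psi i - psi i * normalOrd k j : FockEnd) = if i = j then psi k else 0 := by
  have h1 := psi_mul_psi k i
  have h2 := psi_mul_psiBar_add i j
  rw [normalOrd_eq]
  set c : FockEnd := if k = j ∧ 0 ≤ k then 1 else 0 with hc
  have hcc : c * psi i = psi i * c := by rw [hc]; split_ifs <;> simp
  rw [anticomm_quadratic_left h1 hcc, h2]
  split_ifs <;> simp

theorem lie_normalOrd_psiBar (k j i : ℤ) :
    (normalOrd k j * psiBar i - psiBar i * normalOrd k j : FockEnd) =
      if k = i then -psiBar j else 0 := by
  have h1 := psiBar_mul_psiBar i j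
  have h2 := psi_mul_psiBar_add k i
  rw [normalOrd_eq]
  set c : FockEnd := if k = j ∧ 0 ≤ k then 1 else 0 with hc
  have hcc : c * psiBar i = psiBar i * c := by rw [hc]; split_ifs <;> simp
  rw [anticomm_quadratic_right h1 hcc, h2]
  split_ifs <;> simp

/-! ## Functionals with finite support -/

/-- A functional on the Fock space that depends on finitely many components only. -/
def FinSupp (c : Fock ℂ →ₗ[ℂ] ℂ) : Prop :=
  ∃ s : Finset (Finset ℤ), ∀ f : Fock ℂ, (∀ T ∈ s, f T = 0) → c f = 0

/-- The component of a state at a basis vector. -/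
def component (T : Finset ℤ) : Fock ℂ →ₗ[ℂ] ℂ := LinearMap.proj T

@[simp] theorem component_apply (T : Finset ℤ) (f : Fock ℂ) : component T f = f T := rfl

theorem finSupp_component (T : Finset ℤ) : FinSupp (component T) :=
  ⟨{T}, fun f hf => hf T (by simp)⟩

/-- Operators each of whose output components depends on finitely many input components preserve
this class of functionals. This is how the infinite sums over modes are handled in the completed
Fock space. -/
theorem FinSupp.comp_of_component {c : Fock ℂ →ₗ[ℂ] ℂ} (hc : FinSupp c) {O : FockEnd}
    (hO : ∀ T, FinSupp (component T ∘ₗ O)) : FinSupp (c ∘ₗ O) := by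
  classical
  obtain ⟨s, hs⟩ := hc
  choose t ht using hO
  exact ⟨s.biUnion t, fun f hf => hs _ fun T hT => ht T f fun U hU =>
    hf U (Finset.mem_biUnion.mpr ⟨T, hT, hU⟩)⟩

theorem FinSupp.psi {c : Fock ℂ →ₗ[ℂ] ℂ} (hc : FinSupp c) (k : ℤ) : FinSupp (c ∘ₗ psi k) :=
  hc.comp_of_component fun T => ⟨{symmDiff T {k}}, fun f hf => by
    simp [psi_apply, hf (symmDiff T {k}) (by simp)]⟩

theorem FinSupp.psiBar {c : Fock ℂ →ₗ[ℂ] ℂ} (hc : FinSupp c) (k : ℤ) :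
    FinSupp (c ∘ₗ psiBar k) :=
  hc.comp_of_component fun T => ⟨{symmDiff T {k}}, fun f hf => by
    simp [psiBar_apply, hf (symmDiff T {k}) (by simp)]⟩

theorem FinSupp.normalOrd {c : Fock ℂ →ₗ[ℂ] ℂ} (hc : FinSupp c) (k j : ℤ) :
    FinSupp (c ∘ₗ normalOrd k j) := by
  unfold MinimalString.normalOrd
  split_ifs
  · obtain ⟨s, hs⟩ := (hc.psiBar j).psi k
    exact ⟨s, fun f hf => by simpa using hs f hf⟩
  · exact (hc.psi k).psiBar j

/-- Normal ordering puts on the left an operator that kills the component `T` for all but finitely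
many `k`: `ψ` on an occupied level, or `ψ̄` on an empty one. The exceptional set does not depend on
the state. -/
theorem exists_normalOrd_eq_zero (n : ℤ) (T : Finset ℤ) : ∃ K : Finset ℤ, ∀ k ∉ K, ∀ f : Fock ℂ,
    normalOrd k (k + n) f T = 0 := by
  refine ⟨(T ∪ T.image (fun a => a - n)) ∪ Finset.Ico (-n) 0, fun k hk f => ?_⟩
  simp only [Finset.mem_union, Finset.mem_image, Finset.mem_Ico, not_or, not_and, not_exists] at hk
  obtain ⟨⟨h1, h2⟩, h3⟩ := hk
  have h2' : k + n ∉ T := fun h => h2 _ h (by omega)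
  by_cases hneg : k < 0
  · have : ¬ Occ T (k + n) := by
      have : ¬ (0 ≤ k + n) := fun h => by
        have := h3 (by omega)
        omega
      simp [Occ, Xor, this, h2']
    simp [MinimalString.normalOrd, hneg, psiBar_apply, this]
  · have : Occ T k := Or.inl ⟨by omega, h1⟩
    simp [MinimalString.normalOrd, hneg, psi_apply, this]

theorem alpha_apply (n : ℤ) (f : Fock ℂ) (T : Finset ℤ) :
    alpha n f T = ∑ᶠ k : ℤ, normalOrd k (k + n) f T := rfl

theorem alpha_apply_eq_sum {n : ℤ} {T : Finset ℤ} {K : Finset ℤ}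
    {f : Fock ℂ} (hK : ∀ k ∉ K, normalOrd k (k + n) f T = 0) :
    alpha n f T = ∑ k ∈ K, normalOrd k (k + n) f T := by
  rw [alpha_apply]
  refine finsum_eq_sum_of_support_subset _ fun k hk => ?_
  by_contra h
  exact hk (hK k h)

theorem FinSupp.alpha {c : Fock ℂ →ₗ[ℂ] ℂ} (hc : FinSupp c) (n : ℤ) : FinSupp (c ∘ₗ alpha n) := by
  classical
  refine hc.comp_of_component fun T => ?_
  obtain ⟨K, hK⟩ := exists_normalOrd_eq_zero n T
  choose t ht using fun k => (finSupp_component T).normalOrd k (k + n)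
  refine ⟨K.biUnion t, fun f hf => ?_⟩
  rw [LinearMap.comp_apply, component_apply, alpha_apply_eq_sum fun k hk => hK k hk f]
  exact Finset.sum_eq_zero fun k hk => ht k f fun U hU => hf U (Finset.mem_biUnion.mpr ⟨k, hk, hU⟩)

/-- Finitely supported functionals commute with the sum defining `α_n`. -/
theorem FinSupp.alpha_eq {c : Fock ℂ →ₗ[ℂ] ℂ} (hc : FinSupp c) (n : ℤ) (f : Fock ℂ) :
    (Function.support fun k : ℤ => c (MinimalString.normalOrd k (k + n) f)).Finite ∧
      c (MinimalString.alpha n f) = ∑ᶠ k : ℤ, c (MinimalString.normalOrd k (k + n) f) := by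
  classical
  obtain ⟨s, hs⟩ := hc
  choose K hK using exists_normalOrd_eq_zero n
  have h0 : ∀ k ∉ s.biUnion K, c (MinimalString.normalOrd k (k + n) f) = 0 := fun k hk =>
    hs _ fun T hT => hK T k (fun h => hk (Finset.mem_biUnion.mpr ⟨T, hT, h⟩)) f
  have hsub : (Function.support fun k : ℤ => c (MinimalString.normalOrd k (k + n) f)) ⊆
      s.biUnion K := fun k hk => by
    by_contra h; exact hk (h0 k h)
  refine ⟨(Finset.finite_toSet _).subset hsub, ?_⟩
  rw [finsum_eq_sum_of_support_subset _ hsub, ← map_sum, ← sub_eq_zero, ← map_sub]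
  refine hs _ fun T hT => ?_
  rw [Pi.sub_apply, sub_eq_zero, Finset.sum_apply]
  exact alpha_apply_eq_sum fun k hk => hK T k (fun h => hk (Finset.mem_biUnion.mpr ⟨T, hT, h⟩)) f

theorem finsum_eq_single_ite {M : Type*} [AddCommMonoid M] (i : ℤ) (x : ℤ → M) :
    ∑ᶠ k : ℤ, (if k = i then x k else 0) = x i := by
  rw [finsum_eq_single _ i fun k hk => if_neg hk, if_pos rfl]

/-! ### Commutators of the currents with fermions and with each other. -/

theorem lie_alpha_psi (n i : ℤ) : (alpha n * psi i - psi i * alpha n : FockEnd) = psi (i - n) := by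
  ext f T
  have h1 := (finSupp_component T).alpha_eq n (psi i f)
  have h2 := ((finSupp_component T).psi i).alpha_eq n f
  have e : ∀ k, component T (normalOrd k (k + n) (psi i f)) -
      (component T ∘ₗ psi i) (normalOrd k (k + n) f) = if k = i - n then psi k f T else 0 := by
    intro k
    have := congrArg (fun O : FockEnd => O f T) (lie_normalOrd_psi k (k + n) i)
    simp only [LinearMap.sub_apply, Module.End.mul_apply, Pi.sub_apply] at this
    rw [component_apply, LinearMap.comp_apply, component_apply, this]
    by_cases h : i = k + n
    · rw [if_pos h, if_pos (by omega)]
    · rw [if_neg h, if_neg (by omega)]; rfl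
  calc (alpha n * psi i - psi i * alpha n : FockEnd) f T
      = component T (alpha n (psi i f)) - (component T ∘ₗ psi i) (alpha n f) := rfl
    _ = psi (i - n) f T := by
      rw [h1.2, h2.2, ← finsum_sub_distrib h1.1 h2.1, finsum_congr e, finsum_eq_single_ite]

theorem lie_alpha_psiBar (n i : ℤ) :
    (alpha n * psiBar i - psiBar i * alpha n : FockEnd) = -psiBar (i + n) := by
  ext f T
  have h1 := (finSupp_component T).alpha_eq n (psiBar i f)
  have h2 := ((finSupp_component T).psiBar i).alpha_eq n f
  have e : ∀ k, component T (normalOrd k (k + n) (psiBar i f)) -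
      (component T ∘ₗ psiBar i) (normalOrd k (k + n) f) =
        if k = i then -psiBar (k + n) f T else 0 := by
    intro k
    have := congrArg (fun O : FockEnd => O f T) (lie_normalOrd_psiBar k (k + n) i)
    simp only [LinearMap.sub_apply, Module.End.mul_apply, Pi.sub_apply] at this
    rw [component_apply, LinearMap.comp_apply, component_apply, this]
    by_cases h : k = i
    · rw [if_pos h, if_pos h]; rfl
    · rw [if_neg h, if_neg h]; rfl
  calc (alpha n * psiBar i - psiBar i * alpha n : FockEnd) f T
      = component T (alpha n (psiBar i f)) - (component T ∘ₗ psiBar i) (alpha n f) := rfl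
    _ = -psiBar (i + n) f T := by
      rw [h1.2, h2.2, ← finsum_sub_distrib h1.1 h2.1, finsum_congr e,
        finsum_eq_single_ite i fun k => -psiBar (k + n) f T]

theorem lie_alpha_normalOrd (m k j : ℤ) :
    (alpha m * normalOrd k j - normalOrd k j * alpha m : FockEnd) =
      normalOrd (k - m) j - normalOrd k (j + m) +
        ((if k = j + m ∧ 0 ≤ k then 1 else 0) - if k = j + m ∧ m ≤ k then 1 else 0) := by
  have h1 := lie_alpha_psi m k
  have h2 := lie_alpha_psiBar m j
  rw [normalOrd_eq k j, normalOrd_eq (k - m) j, normalOrd_eq k (j + m)]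
  set c : FockEnd := if k = j ∧ 0 ≤ k then 1 else 0 with hc
  have hcc : c * alpha m = alpha m * c := by rw [hc]; split_ifs <;> simp
  have e1 : (if k - m = j ∧ 0 ≤ k - m then 1 else 0 : FockEnd) =
      if k = j + m ∧ m ≤ k then 1 else 0 := by
    congr 1; apply propext; constructor <;> intro h <;> omega
  rw [e1]
  exact comm_quadratic h1 h2 hcc

/-- The Heisenberg commutation relations. -/
theorem lie_alpha_alpha (m : ℕ) (n : ℤ) :
    (alpha m * alpha n - alpha n * alpha m : FockEnd) = if (m : ℤ) + n = 0 then (m : FockEnd) else 0 := by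
  ext f T
  have h1 := ((finSupp_component T).alpha m).alpha_eq n f
  have h2 := (finSupp_component T).alpha_eq n (alpha m f)
  have h3 := (finSupp_component T).alpha_eq (n + m) f
  set a : ℤ → ℂ := fun k => component T (normalOrd k (k + (n + m)) f) with ha
  -- The shift by `m` moves exactly the levels `0 ≤ k < m` across the Fermi level; each contributes
  -- one unit to the central term.
  set χ : ℤ → ℂ := fun k => if (m : ℤ) + n = 0 ∧ 0 ≤ k ∧ k < m then f T else 0 with hχ
  have hfin : (Function.support χ).Finite := by
    refine (Set.finite_Ico (0 : ℤ) m).subset fun k hk => ?_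
    by_contra h
    exact hk (if_neg fun h' => h h'.2)
  have hfin' : (Function.support fun k => a (k - m)).Finite := by
    have := h3.1.preimage (f := fun k : ℤ => k - m) (sub_left_injective.injOn)
    exact this
  have e : ∀ k, (component T ∘ₗ alpha m) (normalOrd k (k + n) f) -
      component T (normalOrd k (k + n) (alpha m f)) = a (k - m) - a k + χ k := by
    intro k
    have := congrArg (fun O : FockEnd => O f T) (lie_alpha_normalOrd m k (k + n))
    simp only [LinearMap.sub_apply, Module.End.mul_apply, Pi.sub_apply, LinearMap.add_apply,
      Pi.add_apply] at this
    rw [component_apply, LinearMap.comp_apply, component_apply, this, ha]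
    simp only [component_apply]
    have e1 : k - m + (n + m) = k + n := by ring
    rw [e1, add_assoc k n]
    congr 1
    by_cases hmn : (m : ℤ) + n = 0
    · have e2 : k = k + (n + m) := by omega
      by_cases h4 : 0 ≤ k <;> by_cases h5 : (m : ℤ) ≤ k <;>
        simp [hχ, hmn, ← e2, h4, h5, not_lt.mpr, not_le.mp]
      all_goals omega
    · have e2 : ¬ k = k + (n + m) := by omega
      simp [hχ, hmn, e2]
  -- On a fixed component both sums are finite, so the shift is legitimate and the bilinear parts
  -- cancel.
  have hshift : ∑ᶠ k : ℤ, a (k - m) = ∑ᶠ k : ℤ, a k :=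
    finsum_comp_equiv (f := a) (Equiv.subRight (m : ℤ))
  calc (alpha m * alpha n - alpha n * alpha m : FockEnd) f T
      = (component T ∘ₗ alpha m) (alpha n f) - component T (alpha n (alpha m f)) := rfl
    _ = ∑ᶠ k, (a (k - m) - a k + χ k) := by
      rw [h1.2, h2.2, ← finsum_sub_distrib h1.1 h2.1, finsum_congr e]
    _ = ∑ᶠ k, χ k := by
      rw [finsum_add_distrib _ hfin, finsum_sub_distrib hfin' h3.1, hshift, sub_self, zero_add]
      exact (hfin'.union h3.1).subset (Function.support_sub _ _)
    _ = ∑ k ∈ Finset.Ico (0 : ℤ) m, if (m : ℤ) + n = 0 then f T else 0 := by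
      rw [finsum_eq_sum_of_support_subset (s := Finset.Ico (0 : ℤ) m)]
      · refine Finset.sum_congr rfl fun k hk => ?_
        rw [Finset.mem_Ico] at hk
        simp [hχ, hk]
      · intro k hk
        by_contra h
        refine hk (if_neg fun h' => h ?_)
        simpa using h'.2
    _ = _ := by
      by_cases h : (m : ℤ) + n = 0
      · simp [h]
      · simp [h]

theorem bracket_alpha (m : ℕ) (n : ℤ) :
    ⁅(alpha (m : ℤ) : FockEnd), (alpha n : FockEnd)⁆ =
      if (m : ℤ) + n = 0 then (m : FockEnd) else 0 := by
  rw [← lie_alpha_alpha]; rfl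

theorem alpha_mul_comm (m n : ℕ) :
    (alpha (m : ℤ) * alpha (n : ℤ) : FockEnd) = alpha (n : ℤ) * alpha (m : ℤ) := by
  have := lie_alpha_alpha m n
  rw [← sub_eq_zero, this]
  split_ifs with h
  · have : m = 0 := by omega
    simp [this]
  · rfl

/-- The Dirac vacuum is annihilated from the right by `α_n`, `n ≤ 0`. -/
theorem alpha_apply_empty {n : ℤ} (hn : n ≤ 0) (f : Fock ℂ) : alpha n f ∅ = 0 := by
  rw [alpha_apply]
  refine finsum_eq_zero_of_forall_eq_zero fun k => ?_
  by_cases hk : k < 0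
  · have : ¬ Occ ∅ (k + n) := by simp [Occ, Xor]; omega
    simp [normalOrd, hk, psiBar_apply, this]
  · have : Occ ∅ k := by simp [Occ, Xor]; omega
    simp [normalOrd, hk, psi_apply, this]

end Fermions

/-! ## Formal exponentials -/

section FormalExp

variable {σ : Type*}

theorem coeff_pow_of_degree_lt {B : Type*} [Semiring B] {f : MvPowerSeries σ B}
    (hf : MvPowerSeries.coeff 0 f = 0) (k : ℕ) :
    ∀ m : σ →₀ ℕ, m.degree < k → MvPowerSeries.coeff m (f ^ k) = 0 := by
  classical
  induction k with
  | zero => intro m hm; omega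
  | succ k ih =>
    intro m hm
    rw [pow_succ, MvPowerSeries.coeff_mul]
    refine Finset.sum_eq_zero fun x hx => ?_
    rw [Finset.HasAntidiagonal.mem_antidiagonal] at hx
    by_cases h : x.2 = 0
    · rw [h, hf, mul_zero]
    · rw [ih, zero_mul]
      have h1 : 0 < x.2.degree := by
        rw [Nat.pos_iff_ne_zero, Ne, Finsupp.degree_eq_zero_iff]; exact h
      have h2 : x.1.degree + x.2.degree = m.degree := by rw [← hx, map_add]
      omega

/-- The cutoff may be any `K` beyond the degree. This freedom is needed because differentiation
compares coefficients in neighbouring degrees, whose built-in cutoffs differ. -/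
theorem coeff_fexp {B : Type*} [Ring B] [Algebra ℂ B] {f : MvPowerSeries σ B}
    (hf : MvPowerSeries.coeff 0 f = 0) {m : σ →₀ ℕ} {K : ℕ} (hK : m.degree < K) :
    MvPowerSeries.coeff m (fexp f) =
      ∑ k ∈ Finset.range K, ((k.factorial : ℂ)⁻¹) • MvPowerSeries.coeff m (f ^ k) := by
  change ∑ k ∈ Finset.range (m.degree + 1), _ = _
  refine Finset.sum_subset (Finset.range_mono hK) fun k _ hk => ?_
  rw [coeff_pow_of_degree_lt hf k m (by simpa using hk), smul_zero]

theorem coeff_zero_fexp {B : Type*} [Ring B] [Algebra ℂ B] (f : MvPowerSeries σ B) :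
    MvPowerSeries.coeff 0 (fexp f) = 1 := by
  classical
  change ∑ k ∈ Finset.range ((0 : σ →₀ ℕ).degree + 1), _ = _
  simp

theorem pderiv_fexp {B : Type*} [CommRing B] [Algebra ℂ B] {f : MvPowerSeries σ B}
    (hf : MvPowerSeries.coeff 0 f = 0) (s : σ) :
    MvPowerSeries.pderiv B s (fexp f) = MvPowerSeries.pderiv B s f * fexp f := by
  classical
  ext m
  have hlt : ∀ x : σ →₀ ℕ, ∀ y ∈ Finset.HasAntidiagonal.antidiagonal x, y.2.degree < x.degree + 1 :=
    fun x y hy => by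
      rw [Finset.HasAntidiagonal.mem_antidiagonal] at hy
      rw [← hy, map_add]; omega
  rw [MvPowerSeries.coeff_pderiv, coeff_fexp hf (K := m.degree + 2) (by simp),
    MvPowerSeries.coeff_mul, Finset.sum_congr (s₂ := Finset.HasAntidiagonal.antidiagonal m) rfl
      fun y hy => by rw [coeff_fexp hf (hlt m y hy), Finset.mul_sum], Finset.sum_comm,
    Finset.sum_range_succ', add_mul, Finset.sum_mul]
  have h0 : ((Nat.factorial 0 : ℂ)⁻¹ • MvPowerSeries.coeff (m + Finsupp.single s 1) (f ^ 0)) *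
      ((m s : B) + 1) = 0 := by
    rw [pow_zero, MvPowerSeries.coeff_one, if_neg]
    · simp
    · intro h
      have := DFunLike.congr_fun h s
      simp at this
  rw [h0, add_zero, Finset.sum_congr rfl]
  intro k _
  rw [smul_mul_assoc, ← MvPowerSeries.coeff_pderiv, MvPowerSeries.pderiv_pow, Nat.add_sub_cancel]
  have : ((k + 1 : ℕ) : MvPowerSeries σ B) * f ^ k * MvPowerSeries.pderiv B s f =
      MvPowerSeries.C ((k + 1 : ℕ) : B) * (MvPowerSeries.pderiv B s f * f ^ k) := by
    rw [map_natCast]; ring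
  rw [this, MvPowerSeries.coeff_C_mul, MvPowerSeries.coeff_mul, Finset.mul_sum, Finset.smul_sum]
  refine Finset.sum_congr rfl fun x _ => ?_
  rw [Nat.factorial_succ, Nat.cast_mul, mul_inv, mul_comm (((k + 1 : ℕ) : ℂ)⁻¹), mul_smul,
    mul_smul_comm]
  congr 1
  have hk : ((k + 1 : ℕ) : ℂ) ≠ 0 := Nat.cast_ne_zero.mpr (by omega)
  rw [← map_natCast (algebraMap ℂ B), ← Algebra.smul_def, smul_smul, inv_mul_cancel₀ hk, one_smul]

theorem coeff_fexp_map {B C : Type*} [Ring B] [Algebra ℂ B] [Ring C] [Algebra ℂ C] (φ : C →ₐ[ℂ] B)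
    (f : MvPowerSeries σ C) (m : σ →₀ ℕ) :
    MvPowerSeries.coeff m (fexp (MvPowerSeries.map (φ : C →+* B) f)) =
      φ (MvPowerSeries.coeff m (fexp f)) := by
  change ∑ k ∈ Finset.range (m.degree + 1), _ = φ (∑ k ∈ Finset.range (m.degree + 1), _)
  rw [map_sum]
  refine Finset.sum_congr rfl fun k _ => ?_
  rw [map_smul, ← map_pow, MvPowerSeries.coeff_map]
  rfl

open Classical in
theorem coeff_linForm {B : Type*} [Semiring B] (a : σ → B) (m : σ →₀ ℕ) (s : σ) :
    MvPowerSeries.coeff (m + Finsupp.single s 1) (linForm a) = if m = 0 then a s else 0 := by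
  change ∑ u ∈ (m + Finsupp.single s 1).support, _ = _
  by_cases hm : m = 0
  · subst hm
    rw [if_pos rfl, zero_add, Finset.sum_eq_single s, if_pos rfl]
    · intro u _ hu
      rw [if_neg]
      intro h
      exact hu (Finsupp.single_left_injective one_ne_zero h).symm
    · intro h
      simp at h
  · rw [if_neg hm]
    refine Finset.sum_eq_zero fun u _ => if_neg fun h => hm ?_
    have h1 := congrArg Finsupp.degree h
    rw [map_add, Finsupp.degree_single, Finsupp.degree_single] at h1
    rw [← Finsupp.degree_eq_zero_iff]
    omega

open Classical in
theorem coeff_zero_linForm {B : Type*} [Semiring B] (a : σ → B) :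
    MvPowerSeries.coeff 0 (linForm a) = 0 := by
  exact Finset.sum_empty (ι := σ) (f := fun u => if (0 : σ →₀ ℕ) = Finsupp.single u 1 then a u else 0)

theorem map_linForm {B C : Type*} [Semiring B] [Semiring C] (φ : C →+* B) (a : σ → C) :
    MvPowerSeries.map φ (linForm a) = linForm fun s => φ (a s) := by
  ext m
  rw [MvPowerSeries.coeff_map]
  change φ (∑ u ∈ m.support, _) = ∑ u ∈ m.support, _
  rw [map_sum]
  refine Finset.sum_congr rfl fun u _ => ?_
  split_ifs <;> simp

theorem fexp_linForm_recursion_comm {C : Type*} [CommRing C] [Algebra ℂ C] (a : σ → C)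
    (m : σ →₀ ℕ) (s : σ) :
    ((m s : ℂ) + 1) • MvPowerSeries.coeff (m + Finsupp.single s 1) (fexp (linForm a)) =
      a s * MvPowerSeries.coeff m (fexp (linForm a)) := by
  classical
  have h := congrArg (MvPowerSeries.coeff m) (pderiv_fexp (coeff_zero_linForm a) s)
  have h2 : MvPowerSeries.pderiv C s (linForm a) = MvPowerSeries.C (a s) := by
    ext m
    rw [MvPowerSeries.coeff_pderiv, coeff_linForm, MvPowerSeries.coeff_C]
    split_ifs with hm
    · simp [hm]
    · simp
  rw [h2, MvPowerSeries.coeff_C_mul, MvPowerSeries.coeff_pderiv] at h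
  rw [← h, Algebra.smul_def, mul_comm]
  simp

/-- The coefficients of `F' = f' F` for `F = exp f`, a Newton-type recursion. -/
theorem fexp_recursion_comm {C : Type*} [CommRing C] [Algebra ℂ C] (f : PowerSeries C)
    (hf : PowerSeries.coeff 0 f = 0) (n : ℕ) :
    (n : ℂ) • PowerSeries.coeff n (fexp (σ := Unit) f : PowerSeries C) =
      ∑ j ∈ Finset.range n, ((j : ℂ) + 1) • (PowerSeries.coeff (j + 1) f *
        PowerSeries.coeff (n - 1 - j) (fexp (σ := Unit) f : PowerSeries C)) := by
  classical
  rcases n with _ | n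
  · simp
  have hf' : MvPowerSeries.coeff (0 : Unit →₀ ℕ) f = 0 := by
    rw [← hf, PowerSeries.coeff, Finsupp.single_zero]
  have h := congrArg (PowerSeries.coeff n) (pderiv_fexp hf' ())
  have hd : ∀ (F : PowerSeries C) n, PowerSeries.coeff n (MvPowerSeries.pderiv C () F) =
      ((n : ℂ) + 1) • PowerSeries.coeff (n + 1) F := by
    intro F n
    rw [PowerSeries.coeff, MvPowerSeries.coeff_pderiv, PowerSeries.coeff, Finsupp.single_add,
      Algebra.smul_def, mul_comm]
    simp
  rw [hd] at h
  push_cast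
  rw [h]
  refine (PowerSeries.coeff_mul n _ _).trans ?_
  rw [Finset.Nat.sum_antidiagonal_eq_sum_range_succ_mk]
  refine Finset.sum_congr rfl fun j _ => ?_
  rw [hd, smul_mul_assoc]

open scoped IsMulCommutative in
-- Differentiating an exponential is valid only when the exponent commutes with its derivative. The
-- modes involved commute, so identities are proved in the commutative algebra they generate and
-- carried back to `FockEnd`.
theorem exists_commRing_algHom {s : Set FockEnd} (hcomm : ∀ x ∈ s, ∀ y ∈ s, x * y = y * x) :
    ∃ (C : Type) (_ : CommRing C) (_ : Algebra ℂ C) (φ : C →ₐ[ℂ] FockEnd),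
      (∀ x ∈ s, ∃ c, φ c = x) ∧ ∀ c, φ c ∈ Algebra.adjoin ℂ s := by
  have := Algebra.isMulCommutative_adjoin ℂ hcomm
  refine ⟨Algebra.adjoin ℂ s, inferInstance, inferInstance, (Algebra.adjoin ℂ s).val,
    fun x hx => ⟨⟨x, Algebra.subset_adjoin hx⟩, rfl⟩, fun c => c.2⟩

variable {a : σ → FockEnd}

theorem mem_adjoin_and_recursion (ha : ∀ s u, a s * a u = a u * a s) (m : σ →₀ ℕ) :
    (MvPowerSeries.coeff m (fexp (linForm a)) : FockEnd) ∈ Algebra.adjoin ℂ (Set.range a) ∧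
    ∀ s, ((m s : ℂ) + 1) •
      (MvPowerSeries.coeff (m + Finsupp.single s 1) (fexp (linForm a)) : FockEnd) =
        a s * MvPowerSeries.coeff m (fexp (linForm a)) := by
  have hcomm : ∀ x ∈ Set.range a, ∀ y ∈ Set.range a, x * y = y * x := by
    rintro _ ⟨s, rfl⟩ _ ⟨u, rfl⟩; exact ha s u
  obtain ⟨C, _, _, φ, hφ, hmem⟩ := exists_commRing_algHom hcomm
  choose a' ha' using fun s => hφ (a s) ⟨s, rfl⟩
  have e : ∀ m : σ →₀ ℕ, MvPowerSeries.coeff m (fexp (linForm a)) =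
      φ (MvPowerSeries.coeff m (fexp (linForm a'))) := by
    intro m
    have h : linForm a = MvPowerSeries.map (φ : C →+* FockEnd) (linForm a') := by
      rw [map_linForm]
      congr 1
      funext s
      exact (ha' s).symm
    rw [h, coeff_fexp_map]
  refine ⟨by rw [e]; exact hmem _, fun s => ?_⟩
  have := congrArg φ (fexp_linForm_recursion_comm a' m s)
  rw [map_smul, map_mul, ha'] at this
  rw [e, e]
  exact this

/-- The recursion is `λ ∂/∂λ` of `e^{φ₊(λ)}`, where the weights `1/n` in `φ₊` cancel. The mode `α_0`
in the generating set does not occur in `φ₊`, but commutes with the other modes in it. -/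
theorem expPhiPlus_mem_adjoin_and_recursion (l : ℕ) :
    expPhiPlus l ∈ Algebra.adjoin ℂ (Set.range fun n : ℕ => (alpha (n : ℤ) : FockEnd)) ∧
    (l : ℂ) • expPhiPlus l =
      -∑ j ∈ Finset.range l, (alpha ((j : ℤ) + 1) * expPhiPlus (l - 1 - j) : FockEnd) := by
  have hcomm : ∀ x ∈ Set.range (fun n : ℕ => (alpha (n : ℤ) : FockEnd)),
      ∀ y ∈ Set.range (fun n : ℕ => (alpha (n : ℤ) : FockEnd)), x * y = y * x := by
    rintro _ ⟨s, rfl⟩ _ ⟨u, rfl⟩; exact alpha_mul_comm s u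
  obtain ⟨C, _, _, φ, hφ, hmem⟩ := exists_commRing_algHom hcomm
  choose a' ha' using fun n : ℕ => hφ (alpha (n : ℤ)) ⟨n, rfl⟩
  let f : PowerSeries C := PowerSeries.mk fun n => if n = 0 then 0 else -((n : ℂ)⁻¹ • a' n)
  have e0 : MvPowerSeries.map (φ : C →+* FockEnd) f = phiPlus := by
    refine PowerSeries.ext fun n => ?_
    refine (PowerSeries.coeff_map (φ : C →+* FockEnd) n f).trans ?_
    rw [phiPlus, PowerSeries.coeff_mk, PowerSeries.coeff_mk]
    split_ifs
    · simp
    · rw [map_neg, ← ha' n]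
      congr 1
      exact map_smul φ _ _
  have e : ∀ l, expPhiPlus l = φ (PowerSeries.coeff l (fexp (σ := Unit) f : PowerSeries C)) := by
    intro l
    rw [expPhiPlus, ← e0]
    exact coeff_fexp_map φ f _
  refine ⟨by rw [e]; exact hmem _, ?_⟩
  have := congrArg φ (fexp_recursion_comm f (by simp [f]) l)
  rw [map_smul, map_sum] at this
  rw [e l, this, ← Finset.sum_neg_distrib]
  refine Finset.sum_congr rfl fun j _ => ?_
  rw [e (l - 1 - j)]
  have h1 : PowerSeries.coeff (j + 1) f = -(((j + 1 : ℕ) : ℂ)⁻¹ • a' (j + 1)) := by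
    simp [f]
  have h3 : ((j : ℂ) + 1) ≠ 0 := by exact_mod_cast Nat.succ_ne_zero j
  rw [h1, neg_mul, smul_mul_assoc, smul_neg, smul_smul]
  push_cast
  rw [mul_inv_cancel₀ h3, one_smul, map_neg, map_mul, ha']
  push_cast
  rfl

theorem expPhiPlus_zero : expPhiPlus 0 = 1 := by
  have := coeff_zero_fexp (σ := Unit) phiPlus
  rw [expPhiPlus, PowerSeries.coeff, Finsupp.single_zero]
  exact this

theorem commute_of_mem_adjoin {s : Set FockEnd} {x y : FockEnd} (hx : x ∈ Algebra.adjoin ℂ s)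
    (h : ∀ z ∈ s, y * z = z * y) : y * x = x * y := by
  induction hx using Algebra.adjoin_induction with
  | mem z hz => exact h z hz
  | algebraMap r => exact (Algebra.commutes r y).symm
  | add u v _ _ hu hv => rw [mul_add, add_mul, hu, hv]
  | mul u v _ _ hu hv => rw [← mul_assoc, hu, mul_assoc, hv, mul_assoc]

end FormalExp

/-! ## The vertex operator on the vacuum -/

section Vertex

/-- The index `{0}` is the vacuum with level `0` emptied, that is, the charge-one vacuum on which
the fermion form of `e^{φ₊}` is evaluated. -/
theorem occ_zero_iff (k : ℤ) : Occ {0} k ↔ 0 < k := by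
  simp only [Occ, Xor, Finset.mem_singleton]
  omega

theorem psi_apply_zero_of_pos {k : ℤ} (hk : 0 < k) (f : Fock ℂ) : psi k f {0} = 0 := by
  rw [psi_apply, if_pos ((occ_zero_iff k).mpr hk)]

theorem psi_zero_apply_zero (f : Fock ℂ) : psi 0 f {0} = f ∅ := by
  rw [psi_apply, if_neg (by rw [occ_zero_iff]; omega)]
  have h : ({0} : Finset ℤ).filter (· < 0) = ∅ := by ext x; simp; omega
  simp [levelSign, h]

theorem alpha_apply_zero (n : ℤ) (hn : 0 < n) (f : Fock ℂ) :
    alpha n f {0} = -∑ k ∈ Finset.Icc (1 - n) 0, psiBar (k + n) (psi k f) {0} := by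
  rw [alpha_apply_eq_sum (K := Finset.Icc (1 - n) 0), ← Finset.sum_neg_distrib]
  · refine Finset.sum_congr rfl fun k _ => ?_
    rw [normalOrd_eq, if_neg (by omega), add_zero]
    rfl
  · intro k hk
    rw [Finset.mem_Icc, not_and_or] at hk
    by_cases h : k < 0
    · rw [normalOrd, if_pos h]
      change -(psiBar (k + n) (psi k f) {0}) = 0
      rw [psiBar_apply, if_neg (by rw [occ_zero_iff]; omega), neg_zero]
    · rw [normalOrd, if_neg h]
      exact psi_apply_zero_of_pos (by omega) _

/-- Writing the currents as bilinears gives a sum of `ψ̄_{a+b+l} ψ_a ψ_b` over a region symmetric in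
`a` and `b` (subscripts denote levels). It vanishes because `ψ_a ψ_b` is antisymmetric. -/
theorem sum_alpha_psi_apply_zero (l : ℕ) (f : Fock ℂ) :
    ∑ b ∈ Finset.Icc (1 - l : ℤ) 0, alpha (b + l) (psi b f) {0} = 0 := by
  -- The condition encodes the lower limit from `alpha_apply_zero`; with it as a cutoff, the range
  -- of summation becomes a square and the two indices can be exchanged.
  set u : ℤ → ℤ → ℂ := fun a b => if (1 - l : ℤ) ≤ a + b then
    psiBar (a + b + l) (psi a (psi b f)) {0} else 0 with hu
  have hanti : ∀ a b, u a b = -u b a := by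
    intro a b
    have h := congrArg (fun O : FockEnd => psiBar (a + b + l) (O f) {0}) (psi_mul_psi a b)
    simp only [Module.End.mul_apply, LinearMap.neg_apply, map_neg, Pi.neg_apply] at h
    simp only [hu]
    rw [h, add_comm b a]
    split_ifs <;> simp
  have e : ∑ b ∈ Finset.Icc (1 - l : ℤ) 0, alpha (b + l) (psi b f) {0} =
      -∑ b ∈ Finset.Icc (1 - l : ℤ) 0, ∑ a ∈ Finset.Icc (1 - l : ℤ) 0, u a b := by
    rw [← Finset.sum_neg_distrib]
    refine Finset.sum_congr rfl fun b hb => ?_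
    rw [Finset.mem_Icc] at hb
    rw [alpha_apply_zero _ (by omega)]
    congr 1
    refine Finset.sum_subset_zero_on_sdiff ?_ ?_ ?_
    · exact Finset.Icc_subset_Icc (by omega) le_rfl
    · intro a ha
      simp only [Finset.mem_sdiff, Finset.mem_Icc] at ha
      exact if_neg (by omega)
    · intro a ha
      rw [Finset.mem_Icc] at ha
      simp only [hu]
      rw [if_pos (by omega), add_assoc]
  set S := ∑ b ∈ Finset.Icc (1 - l : ℤ) 0, ∑ a ∈ Finset.Icc (1 - l : ℤ) 0, u a b with hS
  have hSS : S = -S := by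
    conv_lhs => rw [hS, Finset.sum_comm]
    rw [hS, ← Finset.sum_neg_distrib]
    refine Finset.sum_congr rfl fun b _ => ?_
    rw [← Finset.sum_neg_distrib]
    exact Finset.sum_congr rfl fun a _ => hanti _ _
  rw [e, neg_eq_zero]
  linear_combination (1 / 2 : ℂ) * hSS

theorem commute_alpha_expPhiPlus (n l : ℕ) :
    (alpha (n : ℤ) * expPhiPlus l : FockEnd) = expPhiPlus l * alpha (n : ℤ) :=
  commute_of_mem_adjoin (expPhiPlus_mem_adjoin_and_recursion l).1 (by
    rintro _ ⟨k, rfl⟩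
    exact alpha_mul_comm n k)

/-- `⟨0| e^{φ₊(λ)}` is a fermion acting on the vacuum of charge one. -/
theorem expPhiPlus_apply_empty (l : ℕ) : ∀ f : Fock ℂ,
    expPhiPlus l f ∅ = psi (-l : ℤ) f {0} := by
  induction l using Nat.strong_induction_on with
  | _ l ih =>
  intro f
  rcases Nat.eq_zero_or_pos l with h0 | hl
  · subst h0
    rw [expPhiPlus_zero]
    simpa using (psi_zero_apply_zero f).symm
  have hl' : (l : ℂ) ≠ 0 := Nat.cast_ne_zero.mpr (by omega)
  have hrec := congrArg (fun O : FockEnd => O f ∅) (expPhiPlus_mem_adjoin_and_recursion l).2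
  simp only [LinearMap.smul_apply, Pi.smul_apply, LinearMap.neg_apply, Pi.neg_apply,
    LinearMap.sum_apply, Finset.sum_apply] at hrec
  -- With `α` moved to the right, induction turns the exponential into a fermion. Moving `α` back
  -- leaves a commutator `ψ` at level `-l`, the same for each `j`; the `l` copies cancel the factor
  -- `l` of the recursion, and the remaining terms sum to zero by `sum_alpha_psi_apply_zero`.
  have hterm : ∀ j ∈ Finset.range l, (alpha ((j : ℤ) + 1) * expPhiPlus (l - 1 - j) : FockEnd) f ∅ =
      alpha ((j : ℤ) + 1) (psi ((j : ℤ) + 1 - l) f) {0} - psi (-l : ℤ) f {0} := by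
    intro j hj
    rw [Finset.mem_range] at hj
    have h1 := commute_alpha_expPhiPlus (j + 1) (l - 1 - j)
    push_cast at h1
    rw [h1, Module.End.mul_apply, ih (l - 1 - j) (by omega)]
    have h2 : (-((l - 1 - j : ℕ) : ℤ)) = (j : ℤ) + 1 - l := by omega
    rw [h2]
    have h3 := congrArg (fun O : FockEnd => O f {0}) (lie_alpha_psi ((j : ℤ) + 1) ((j : ℤ) + 1 - l))
    simp only [LinearMap.sub_apply, Module.End.mul_apply, Pi.sub_apply] at h3
    have h4 : (j : ℤ) + 1 - l - ((j : ℤ) + 1) = -l := by ring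
    rw [h4] at h3
    linear_combination -h3
  rw [Finset.sum_congr rfl hterm, Finset.sum_sub_distrib] at hrec
  have hz : ∑ j ∈ Finset.range l, alpha ((j : ℤ) + 1) (psi ((j : ℤ) + 1 - l) f) {0} = 0 := by
    rw [← sum_alpha_psi_apply_zero l f]
    refine Finset.sum_nbij' (fun j => (j : ℤ) + 1 - l) (fun b => (b - 1 + l).toNat) ?_ ?_ ?_ ?_ ?_
    · intro j hj; simp at hj ⊢; omega
    · intro b hb; simp at hb ⊢; omega
    · intro j hj; simp at hj ⊢; omega
    · intro b hb; simp at hb ⊢; omega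
    · intro j hj
      ring_nf
  rw [hz] at hrec
  simp only [Finset.sum_const, Finset.card_range, nsmul_eq_mul, smul_eq_mul, zero_sub,
    neg_neg] at hrec
  exact mul_left_cancel₀ hl' hrec

end Vertex

/-! ## Decomposable states -/

section Decomposable

variable (v : ℕ → ℤ → ℂ)

theorem wedge_apply_eq_sum {w : ℤ → ℂ} {T : Finset ℤ} {K : Finset ℤ}
    (hK : ∀ l ∉ K, w l = 0 ∨ ¬ Occ T l) (f : Fock ℂ) :
    wedge w f T = ∑ l ∈ K, w l * psiBar l f T := by
  refine finsum_eq_sum_of_support_subset _ fun l hl => ?_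
  by_contra h
  rcases hK l h with h | h
  · exact hl (by simp [h])
  · exact hl (by simp [psiBar_apply, h])

/-- Only finitely many terms contribute to a component of a wedge product. -/
theorem exists_wedge_support {w : ℤ → ℂ} {m : ℤ} (hw : ∀ l, m < l → w l = 0) (T : Finset ℤ) :
    ∃ K : Finset ℤ, ∀ l ∉ K, w l = 0 ∨ ¬ Occ T l := by
  refine ⟨T ∪ Finset.Icc 0 m, fun l hl => ?_⟩
  simp only [Finset.mem_union, Finset.mem_Icc, not_or, not_and, not_le] at hl
  by_cases h : 0 ≤ l
  · exact Or.inl (hw l (hl.2 h))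
  · right
    simp [Occ, Xor, h, hl.1]

/-- A wedge product as a linear operator. -/
def wedgeOp (w : ℤ → ℂ) (m : ℤ) (hw : ∀ l, m < l → w l = 0) : FockEnd where
  toFun := wedge w
  map_add' f f' := by
    funext T
    obtain ⟨K, hK⟩ := exists_wedge_support hw T
    rw [Pi.add_apply, wedge_apply_eq_sum hK, wedge_apply_eq_sum hK, wedge_apply_eq_sum hK,
      ← Finset.sum_add_distrib]
    simp [mul_add]
  map_smul' c f := by
    funext T
    obtain ⟨K, hK⟩ := exists_wedge_support hw T
    rw [Pi.smul_apply, wedge_apply_eq_sum hK, wedge_apply_eq_sum hK, smul_eq_mul, Finset.mul_sum]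
    simp [mul_left_comm]

/-- The anticommutator of `ψ` at level `k` with `∮ ψ̄ w` is the number `w k`. -/
theorem psi_wedge {w : ℤ → ℂ} {m : ℤ} (hw : ∀ l, m < l → w l = 0) (k : ℤ) (f : Fock ℂ) :
    psi k (wedge w f) = w k • f - wedge w (psi k f) := by
  classical
  funext T
  obtain ⟨K₁, hK₁⟩ := exists_wedge_support hw T
  obtain ⟨K₂, hK₂⟩ := exists_wedge_support hw (symmDiff T {k})
  -- One finite range serves both components involved, and contains `k`, where the anticommutator is
  -- non-zero.
  set K := insert k (K₁ ∪ K₂) with hK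
  have h1 : ∀ l ∉ K, w l = 0 ∨ ¬ Occ T l := fun l hl => hK₁ l fun h => hl (by simp [hK, h])
  have h2 : ∀ l ∉ K, w l = 0 ∨ ¬ Occ (symmDiff T {k}) l :=
    fun l hl => hK₂ l fun h => hl (by simp [hK, h])
  have e : psi k (wedge w f) T = ∑ l ∈ K, w l * (psi k (psiBar l f)) T := by
    rw [psi_apply, wedge_apply_eq_sum h2]
    simp only [psi_apply]
    split_ifs
    · simp
    · rw [Finset.smul_sum]
      exact Finset.sum_congr rfl fun l _ => (mul_smul_comm _ _ _).symm
  rw [e, Pi.sub_apply, Pi.smul_apply, wedge_apply_eq_sum h1, eq_sub_iff_add_eq,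
    ← Finset.sum_add_distrib]
  have h3 : ∀ l ∈ K, w l * psi k (psiBar l f) T + w l * psiBar l (psi k f) T =
      if k = l then w l * f T else 0 := by
    intro l _
    have := congrArg (fun O : FockEnd => O f T) (psi_mul_psiBar_add k l)
    simp only [LinearMap.add_apply, Module.End.mul_apply, Pi.add_apply] at this
    rw [← mul_add, this]
    split_ifs <;> simp
  rw [Finset.sum_congr rfl h3, Finset.sum_ite_eq, if_pos (by simp [hK]), smul_eq_mul]

/-- `[∮ ψ̄ v_0] ⋯ [∮ ψ̄ v_{i-1}] f`. -/
def wedgeList (i : ℕ) (f : Fock ℂ) : Fock ℂ :=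
  (List.range i).foldr (fun k f => wedge (v k) f) f

theorem wedgeList_succ (i : ℕ) (f : Fock ℂ) :
    wedgeList v (i + 1) f = wedgeList v i (wedge (v i) f) := by
  simp [wedgeList, List.range_succ]

theorem decomposable_apply (T : Finset ℤ) : decomposable v T =
    wedgeList v (T.sup Int.toNat + 1) (vac (T.sup Int.toNat + 1)) T := rfl

variable {v} (hv : ∀ (k : ℕ) (l : ℤ), (k : ℤ) < l → v k l = 0)
include hv

theorem wedgeList_add (i : ℕ) (f f' : Fock ℂ) :
    wedgeList v i (f + f') = wedgeList v i f + wedgeList v i f' := by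
  induction i generalizing f f' with
  | zero => rfl
  | succ i ih =>
    rw [wedgeList_succ, wedgeList_succ, wedgeList_succ, ← ih]
    congr 1
    exact map_add (wedgeOp (v i) i (hv i)) f f'

/-- A level that is unoccupied in every component of a state stays so under lower wedge products. -/
theorem wedgeList_apply_eq_zero {i : ℕ} {j : ℤ} (hj : (i : ℤ) ≤ j) {f : Fock ℂ}
    (hf : ∀ T, Occ T j → f T = 0) : ∀ T, Occ T j → wedgeList v i f T = 0 := by
  induction i generalizing f with
  | zero => exact hf
  | succ i ih =>
    rw [wedgeList_succ]
    refine ih (by push_cast at hj; omega) fun T hT => ?_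
    refine finsum_eq_zero_of_forall_eq_zero fun l => ?_
    by_cases hl : (i : ℤ) < l
    · rw [hv i l hl, zero_mul]
    · have hne : j ≠ l := by push_cast at hj; omega
      rw [psiBar_apply]
      split_ifs
      · rw [hf _ ((occ_symmDiff_of_ne hne).mpr hT), smul_zero, mul_zero]
      · rw [mul_zero]

omit hv in
theorem occ_of_vac_ne_zero {M : ℕ} {T : Finset ℤ} {k : ℤ} (h : (vac M T : ℂ) ≠ 0) :
    Occ T k ↔ (M : ℤ) ≤ k := by
  have hT : T = Finset.Ico (0 : ℤ) M := by
    by_contra hT; exact h (if_neg hT)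
  subst hT
  by_cases h1 : 0 ≤ k <;> by_cases h2 : k < M <;> simp [Occ, Xor, h1, h2] <;> omega

/-- The approximations of a decomposable state are eventually constant. -/
theorem wedgeList_vac_succ (hmonic : ∀ k : ℕ, v k k = 1) {M : ℕ} {T : Finset ℤ} (hT : Occ T M) :
    wedgeList v (M + 1) (vac (M + 1)) T = wedgeList v M (vac M) T := by
  classical
  -- The leading term of `v M` fills level `M` and rebuilds `vac M`. The remainder lives on
  -- components with level `M` empty; lower wedge products, having powers below `M`, cannot fill it,
  -- whereas `T` has it occupied.
  have hdecomp : wedge (v M) (vac (M + 1)) = vac M + (wedge (v M) (vac (M + 1)) - vac M) := by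
    rw [add_sub_cancel]
  rw [wedgeList_succ, hdecomp, wedgeList_add hv, Pi.add_apply, add_eq_left]
  refine wedgeList_apply_eq_zero hv le_rfl (fun U hU => ?_) T hT
  rw [Pi.sub_apply, sub_eq_zero]
  have h1 : wedge (v M) (vac (M + 1)) U = psiBar (M : ℤ) (vac (M + 1)) U := by
    refine (finsum_eq_single _ (M : ℤ) fun l hl => ?_).trans (by rw [hmonic, one_mul])
    rw [psiBar_apply]
    split_ifs with h
    · by_cases h2 : (vac (M + 1) (symmDiff U {l}) : ℂ) = 0
      · rw [h2, smul_zero, mul_zero]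
      · have := (occ_of_vac_ne_zero h2 (k := M)).mp
          ((occ_symmDiff_of_ne (Ne.symm hl)).mpr hU)
        push_cast at this; omega
    · rw [mul_zero]
  rw [h1, psiBar_apply, if_pos hU]
  by_cases hUM : U = Finset.Ico (0 : ℤ) M
  · have h3 : symmDiff U {(M : ℤ)} = Finset.Ico (0 : ℤ) (M + 1 : ℕ) := by
      subst hUM
      ext x
      simp only [Finset.mem_symmDiff, Finset.mem_Ico, Finset.mem_singleton]
      push_cast; omega
    have h4 : levelSign U M = 1 := by
      have : U.filter (· < (M : ℤ)) = U := by
        subst hUM; ext x; simp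
      rw [levelSign, this, hUM, Int.toNat_natCast, Int.card_Ico]
      simp
    rw [h4, h3, one_smul, vac, vac, if_pos rfl, if_pos hUM]
  · rw [vac, vac, if_neg hUM, if_neg, smul_zero]
    intro h
    apply hUM
    rw [← symmDiff_symmDiff_singleton U M, h]
    ext x
    simp only [Finset.mem_symmDiff, Finset.mem_Ico, Finset.mem_singleton]
    push_cast; omega

theorem decomposable_eq_of_le (hmonic : ∀ k : ℕ, v k k = 1) {M : ℕ} {T : Finset ℤ}
    (hT : ∀ x ∈ T, x < M) : decomposable v T = wedgeList v M (vac M) T := by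
  have hocc : ∀ i : ℕ, (∀ x ∈ T, x < i) → Occ T i := fun i hi =>
    Or.inl ⟨Int.natCast_nonneg i, fun h => lt_irrefl _ (hi _ h)⟩
  have key : ∀ i d : ℕ, (∀ x ∈ T, x < i) →
      wedgeList v (i + d) (vac (i + d)) T = wedgeList v i (vac i) T := by
    intro i d hi
    induction d with
    | zero => rfl
    | succ d ih =>
      rw [← ih, ← add_assoc]
      refine wedgeList_vac_succ hv hmonic (hocc _ fun x hx => ?_)
      have := hi x hx
      push_cast; omega
  have h0 : ∀ x ∈ T, x < ((T.sup Int.toNat + 1 : ℕ) : ℤ) := fun x hx => by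
    have : x.toNat ≤ T.sup Int.toNat := Finset.le_sup (f := Int.toNat) hx
    push_cast; omega
  rw [decomposable_apply, ← key _ M h0, add_comm, key M _ hT]

/-- Contraction of a fermion with a wedge product. -/
theorem exists_psi_wedgeList (i : ℕ) (g : Fock ℂ) (T : Finset ℤ) : ∃ c : ℕ → ℂ, ∀ k : ℤ,
    psi k (wedgeList v i g) T =
      ∑ a ∈ Finset.range i, c a * v a k + (-1) ^ i * wedgeList v i (psi k g) T := by
  induction i generalizing g with
  | zero => exact ⟨0, fun k => by simp [wedgeList]⟩
  | succ i ih =>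
    obtain ⟨c, hc⟩ := ih (wedge (v i) g)
    refine ⟨fun a => if a = i then (-1) ^ i * wedgeList v i g T else c a, fun k => ?_⟩
    have hsmul : ∀ (x : ℂ) (f : Fock ℂ), wedgeList v i (x • f) = x • wedgeList v i f := by
      intro x
      clear hc ih c
      induction i with
      | zero => intro f; rfl
      | succ i ih =>
        intro f
        rw [wedgeList_succ, wedgeList_succ, ← ih]
        congr 1
        exact map_smul (wedgeOp (v i) i (hv i)) x f
    rw [wedgeList_succ, hc, psi_wedge (hv i), sub_eq_add_neg, ← neg_one_smul ℂ (wedge _ _),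
      wedgeList_add hv, hsmul, hsmul, Finset.sum_range_succ, wedgeList_succ]
    have h : ∑ a ∈ Finset.range i, (if a = i then (-1) ^ i * wedgeList v i g T else c a) * v a k =
        ∑ a ∈ Finset.range i, c a * v a k := by
      refine Finset.sum_congr rfl fun a ha => ?_
      rw [if_neg (by rw [Finset.mem_range] at ha; omega)]
    simp only [h, if_true, Pi.add_apply, Pi.smul_apply, smul_eq_mul]
    ring

/-- `∑_k λ^k ψ_{-k-1/2}` applied to a decomposable state has its components in the span of the
vectors defining the state. -/
theorem exists_psi_decomposable (hmonic : ∀ k : ℕ, v k k = 1) (T : Finset ℤ) :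
    ∃ (M : ℕ) (c : ℕ → ℂ), ∀ k : ℤ,
      psi k (decomposable v) T = ∑ a ∈ Finset.range M, c a * v a k := by
  obtain ⟨M, hM⟩ : ∃ M : ℕ, ∀ x ∈ T, x < M := by
    refine ⟨T.sup Int.toNat + 1, fun x hx => ?_⟩
    have : x.toNat ≤ T.sup Int.toNat := Finset.le_sup (f := Int.toNat) hx
    push_cast; omega
  obtain ⟨c, hc⟩ := exists_psi_wedgeList hv M (vac M) T
  refine ⟨M, c, fun k => ?_⟩
  -- Levels at or above `M` are occupied in `T`, so `ψ` gives zero there, as do the vectors `v a`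
  -- with `a < M`. Below `M`, `ψ` annihilates the tail `vac M` and only contractions with the `v a`
  -- are left.
  by_cases hk : (M : ℤ) ≤ k
  · rw [psi_apply, if_pos]
    · symm
      refine Finset.sum_eq_zero fun a ha => ?_
      rw [Finset.mem_range] at ha
      rw [hv a k (by omega), mul_zero]
    · exact Or.inl ⟨by omega, fun h => by have := hM k h; omega⟩
  · have h1 : psi k (decomposable v) T = psi k (wedgeList v M (vac M)) T := by
      rw [psi_apply, psi_apply]
      rw [decomposable_eq_of_le hv hmonic (M := M)]
      intro x hx
      rw [Finset.mem_symmDiff, Finset.mem_singleton] at hx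
      rcases hx with hx | hx
      · exact hM x hx.1
      · rw [hx.1]; omega
    have h2 : psi k (vac M : Fock ℂ) = 0 := by
      funext U
      rw [psi_apply]
      split_ifs with h
      · rfl
      · by_cases h3 : (vac M (symmDiff U {k}) : ℂ) = 0
        · rw [h3, smul_zero]; rfl
        · have := (occ_of_vac_ne_zero h3 (k := k)).mp (occ_symmDiff_self.mpr h)
          exact absurd this hk
    have h3 : wedgeList v M (0 : Fock ℂ) = 0 := by
      have := wedgeList_add hv M 0 0
      simpa using this
    rw [h1, hc, h2, h3, Pi.zero_apply, mul_zero, add_zero]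

theorem decomposable_empty (hmonic : ∀ k : ℕ, v k k = 1) : decomposable v ∅ = 1 := by
  rw [decomposable_eq_of_le hv hmonic (M := 0) (by simp)]
  rw [show wedgeList v 0 (vac 0) = vac 0 from rfl, vac, if_pos (by simp)]

end Decomposable

/-! ## The tau function -/

section Tau

variable {N : ℕ} [NeZero N] {g : ℂ}

/-- `g ∂/∂x_{i+1}` acting on `F exp(g⁻¹ ∑ x_n λ^n)`, without the exponential factor. -/
def nabla (g : ℂ) (i : Fin N) (F : LaurentSeries (TimeRing N)) : LaurentSeries (TimeRing N) :=
  g • dTimeOp i F + delPow N ((i : ℕ) + 1) * F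

/-- Iterated application of `nabla`. -/
def nablaWord (g : ℂ) : List (Fin N) → LaurentSeries (TimeRing N) → LaurentSeries (TimeRing N)
  | [], F => F
  | i :: w, F => nablaWord g w (nabla g i F)

/-- The coefficients of a series at `t = 0`, as a function of the power of `λ`. -/
def evalZero : LaurentSeries (TimeRing N) →ₗ[ℂ] (ℤ → ℂ) where
  toFun F l := MvPowerSeries.constantCoeff (F.coeff (-l))
  map_add' F G := by funext l; simp
  map_smul' c F := by
    funext l
    simp only [HahnSeries.coeff_smul, MvPowerSeries.smul_eq_C_mul, map_mul,
      MvPowerSeries.constantCoeff_C, RingHom.id_apply, Pi.smul_apply, smul_eq_mul]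

omit [NeZero N] in
theorem evalZero_apply (F : LaurentSeries (TimeRing N)) (l : ℤ) :
    evalZero F l = MvPowerSeries.constantCoeff (F.coeff (-l)) := rfl

omit [NeZero N] in
theorem evalZero_smul (f : TimeRing N) (F : LaurentSeries (TimeRing N)) :
    evalZero (f • F) = MvPowerSeries.constantCoeff f • evalZero F := by
  funext l
  simp [evalZero_apply]

omit [NeZero N] in
theorem coeff_delPow_mul (k : ℤ) (F : LaurentSeries (TimeRing N)) (j : ℤ) :
    (delPow N k * F).coeff j = F.coeff (j + k) := by
  rw [delPow, HahnSeries.coeff_single_mul, one_mul, sub_neg_eq_add]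

omit [NeZero N] in
theorem coeff_nabla (i : Fin N) (F : LaurentSeries (TimeRing N)) (j : ℤ) :
    (nabla g i F).coeff j = g • MvPowerSeries.pderiv ℂ i (F.coeff j) +
      F.coeff (j + ((i : ℕ) + 1)) := by
  rw [nabla, HahnSeries.coeff_add, coeff_delPow_mul, HahnSeries.coeff_smul]
  rfl

omit [NeZero N] in
theorem coeff_coeff_nabla (i : Fin N) (F : LaurentSeries (TimeRing N)) (j : ℤ) (m : Fin N →₀ ℕ) :
    MvPowerSeries.coeff m ((nabla g i F).coeff j) =
      g * (MvPowerSeries.coeff (m + Finsupp.single i 1) (F.coeff j) * (m i + 1)) +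
      MvPowerSeries.coeff m (F.coeff (j + ((i : ℕ) + 1))) := by
  rw [coeff_nabla, map_add, map_smul, MvPowerSeries.coeff_pderiv, smul_eq_mul]

omit [NeZero N] in
theorem nabla_add (i : Fin N) (F G : LaurentSeries (TimeRing N)) :
    nabla g i (F + G) = nabla g i F + nabla g i G := by
  simp only [nabla, dTimeOp_eq, map_add, smul_add, mul_add]
  abel

omit [NeZero N] in
theorem nabla_smul (i : Fin N) (f : TimeRing N) (F : LaurentSeries (TimeRing N)) :
    nabla g i (f • F) = (g • MvPowerSeries.pderiv ℂ i f) • F + f • nabla g i F := by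
  ext j : 2
  simp only [coeff_nabla, HahnSeries.coeff_smul, HahnSeries.coeff_add, smul_eq_mul,
    Derivation.leibniz, smul_add, mul_add, MvPowerSeries.smul_eq_C_mul]
  ring

omit [NeZero N] in
theorem nablaWord_sub (w : List (Fin N)) (F G : LaurentSeries (TimeRing N)) :
    nablaWord g w (F - G) = nablaWord g w F - nablaWord g w G := by
  induction w generalizing F G with
  | nil => rfl
  | cons i w ih =>
    have h : nabla g i (F - G) = nabla g i F - nabla g i G := by
      rw [eq_sub_iff_add_eq, ← nabla_add, sub_add_cancel]
    rw [nablaWord, h, ih]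
    rfl

theorem nabla_zero_eq (F : LaurentSeries (TimeRing N)) :
    nabla g 0 F = comp g (delPow N 1) F := by
  rw [delPow_one_comp]
  ext j : 2
  rw [coeff_nabla, HahnSeries.coeff_add, coeff_delPow_mul, coeff_mapDer, add_comm]
  simp [del]

omit [NeZero N] in
theorem nabla_comm (i j : Fin N) (F : LaurentSeries (TimeRing N)) :
    nabla g i (nabla g j F) = nabla g j (nabla g i F) := by
  ext k : 2
  simp only [coeff_nabla, map_add, Derivation.map_smul, smul_add]
  rw [pderiv_pderiv_comm i j, add_right_comm k]
  abel

/-- The `R`-span of the functions `∂^k Ψ`. -/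
def waveModule (g : ℂ) (W : PsiDO N) : Submodule (TimeRing N) (LaurentSeries (TimeRing N)) :=
  Submodule.span _ (Set.range fun k : ℕ => comp g (delPow N k) W)

variable {W : PsiDO N}

/-- The Leibniz rule over the coefficient ring reduces invariance of the span to its generators. -/
theorem nabla_mem_of_forall {i : Fin N}
    (h : ∀ k : ℕ, nabla g i (comp g (delPow N k) W) ∈ waveModule g W)
    {F : LaurentSeries (TimeRing N)} (hF : F ∈ waveModule g W) : nabla g i F ∈ waveModule g W := by
  induction hF using Submodule.span_induction with
  | mem x hx => obtain ⟨k, rfl⟩ := hx; exact h k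
  | zero =>
    have : nabla g i (0 : LaurentSeries (TimeRing N)) = 0 := by
      have := nabla_add (g := g) i 0 0
      simpa using this
    rw [this]; exact Submodule.zero_mem _
  | add x y _ _ hx hy => rw [nabla_add]; exact Submodule.add_mem _ hx hy
  | smul a x hx hx' =>
    rw [nabla_smul]
    exact Submodule.add_mem _ (Submodule.smul_mem _ _ hx) (Submodule.smul_mem _ _ hx')

theorem nabla_zero_comp_delPow (k : ℕ) :
    nabla g 0 (comp g (delPow N k) W) = comp g (delPow N (k + 1 : ℕ)) W := by
  rw [nabla_zero_eq, ← comp_assoc, delPow_comp_delPow]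
  push_cast
  rw [add_comm]

theorem comp_posPart_mem (A : PsiDO N) : comp g (posPart A) W ∈ waveModule g W := by
  obtain ⟨a, ha⟩ := exists_lowBound A
  have h : posPart A = ∑ k ∈ Finset.range (1 - a).toNat, A.coeff (-(k : ℤ)) • delPow N (k : ℤ) := by
    ext j : 2
    rw [HahnSeries.coeff_sum]
    change (if j < 1 then A.coeff j else 0) = _
    simp only [HahnSeries.coeff_smul, delPow, HahnSeries.coeff_single]
    by_cases hj : j < 1
    · rw [if_pos hj]
      by_cases hja : j < a
      · rw [ha j hja]
        symm
        refine Finset.sum_eq_zero fun k hk => ?_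
        rw [Finset.mem_range] at hk
        rw [if_neg (by omega), smul_zero]
      · rw [Finset.sum_eq_single (-j).toNat]
        · rw [if_pos (by omega), smul_eq_mul, mul_one]
          congr 1; omega
        · intro k _ hk
          rw [if_neg (by omega), smul_zero]
        · intro h
          rw [Finset.mem_range] at h
          omega
    · rw [if_neg hj]
      symm
      refine Finset.sum_eq_zero fun k hk => ?_
      rw [if_neg (by omega), smul_zero]
  rw [h, comp_sum_left]
  refine Submodule.sum_mem _ fun k _ => ?_
  rw [comp_smul_left]
  exact Submodule.smul_mem _ _ (Submodule.subset_span ⟨k, rfl⟩)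

/-- The Sato equations keep the span of the functions `∂^k Ψ` invariant under the flows. -/
theorem nabla_mem_waveModule {L : PsiDO N} (hsato : ∀ i : Fin N, g • dTimeOp i W =
    comp g (posPart (opPow g L ((i : ℕ) + 1))) W - comp g W (delPow N (((i : ℕ) : ℤ) + 1)))
    (i : Fin N) {F : LaurentSeries (TimeRing N)} (hF : F ∈ waveModule g W) :
    nabla g i F ∈ waveModule g W := by
  refine nabla_mem_of_forall (fun k => ?_) hF
  induction k with
  | zero =>
    have : nabla g i W = comp g (posPart (opPow g L ((i : ℕ) + 1))) W := by
      -- The term `λ^n W` in `nabla` cancels `- W ∂^n`, leaving a differential operator acting on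
      -- `W`.
      rw [nabla, hsato, comp_delPow, mul_comm W]; simp
    rw [Nat.cast_zero, delPow_zero_comp, this]
    exact comp_posPart_mem _
  | succ k ih =>
    -- Here `∂` itself is the covariant derivative in `x_1`, and the covariant derivatives commute.
    rw [← nabla_zero_comp_delPow, nabla_comm]
    refine nabla_mem_of_forall (fun k => ?_) ih
    rw [nabla_zero_comp_delPow]
    exact Submodule.subset_span ⟨k + 1, rfl⟩

/-- The vectors `Φ_k(b; λ)`. -/
def frame (g : ℂ) (W : PsiDO N) (k : ℕ) (l : ℤ) : ℂ :=
  MvPowerSeries.constantCoeff ((comp g (delPow N k) W).coeff (-l))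

theorem ketAt_eq : ketAt g W = decomposable (frame g W) := rfl

theorem evalZero_mem_span {F : LaurentSeries (TimeRing N)} (hF : F ∈ waveModule g W) :
    evalZero F ∈ Submodule.span ℂ (Set.range (frame g W)) := by
  induction hF using Submodule.span_induction with
  | mem x hx => obtain ⟨k, rfl⟩ := hx; exact Submodule.subset_span ⟨k, rfl⟩
  | zero => rw [map_zero]; exact Submodule.zero_mem _
  | add x y _ _ hx hy => rw [map_add]; exact Submodule.add_mem _ hx hy
  | smul a x _ hx => rw [evalZero_smul]; exact Submodule.smul_mem _ _ hx

theorem evalZero_nablaWord_mem_span {L : PsiDO N} (hsato : ∀ i : Fin N, g • dTimeOp i W =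
    comp g (posPart (opPow g L ((i : ℕ) + 1))) W - comp g W (delPow N (((i : ℕ) : ℤ) + 1)))
    (w : List (Fin N)) {F : LaurentSeries (TimeRing N)} (hF : F ∈ waveModule g W) :
    evalZero (nablaWord g w F) ∈ Submodule.span ℂ (Set.range (frame g W)) := by
  induction w generalizing F with
  | nil => exact evalZero_mem_span hF
  | cons i w ih => exact ih (nabla_mem_waveModule hsato i hF)

/-! ### Uniqueness -/

section Frame

variable (hW0 : W.coeff 0 = 1) (hWneg : ∀ i : ℤ, i < 0 → W.coeff i = 0)
include hWneg

theorem frame_eq_zero (k : ℕ) (l : ℤ) (h : (k : ℤ) < l) : frame g W k l = 0 := by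
  have : LowBound (comp g (delPow N k) W) (-(k : ℤ) + 0) :=
    (lowBound_single (-(k : ℤ)) 1).comp g hWneg
  rw [frame, this _ (by omega), map_zero]

include hW0

theorem frame_self (k : ℕ) : frame g W k k = 1 := by
  rw [frame, delPow, coeff_comp g (lowBound_single (-(k : ℤ)) (1 : TimeRing N)) (b := 0) hWneg (K := 1)
    (by push_cast; omega)]
  simp [HahnSeries.coeff_single_mul, hW0]

/-- The vectors are monic, with leading powers `λ^0, λ^1, …`; the highest one present in a
combination shows up at a non-negative power. This is the transversality of the big cell. -/
theorem eq_zero_of_mem_span_frame {u : ℤ → ℂ} (hu : u ∈ Submodule.span ℂ (Set.range (frame g W)))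
    (h : ∀ l, 0 ≤ l → u l = 0) : u = 0 := by
  obtain ⟨c, rfl⟩ := Finsupp.mem_span_range_iff_exists_finsupp.mp hu
  by_cases hc : c = 0
  · simp [hc]
  exfalso
  have hne : c.support.Nonempty := Finsupp.support_nonempty_iff.mpr hc
  set K := c.support.max' hne with hK
  have hKm : K ∈ c.support := Finset.max'_mem _ _
  have h1 := h K (Int.natCast_nonneg K)
  rw [Finsupp.sum, Finset.sum_apply, Finset.sum_eq_single K] at h1
  · rw [Pi.smul_apply, frame_self hW0 hWneg, smul_eq_mul, mul_one] at h1
    exact (Finsupp.mem_support_iff.mp hKm) h1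
  · intro k hk hkK
    have : k < K := lt_of_le_of_ne (Finset.le_max' _ k hk) hkK
    rw [Pi.smul_apply, frame_eq_zero hWneg k K (by exact_mod_cast this), smul_zero]
  · intro h; exact absurd hKm h

end Frame

/-- The exponent of the monomial of a word. -/
def wordDegree (w : List (Fin N)) : Fin N →₀ ℕ := (w.map fun i => Finsupp.single i 1).sum

omit [NeZero N] in
theorem degree_wordDegree (w : List (Fin N)) : (wordDegree w).degree = w.length := by
  induction w with
  | nil => simp [wordDegree]
  | cons i w ih =>
    rw [wordDegree, List.map_cons, List.sum_cons, map_add]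
    rw [wordDegree] at ih
    rw [ih, Finsupp.degree_single, List.length_cons, add_comm]

omit [NeZero N] in
theorem exists_wordDegree_eq (m : Fin N →₀ ℕ) : ∃ w, wordDegree w = m := by
  induction m using Finsupp.induction_linear with
  | zero => exact ⟨[], rfl⟩
  | add m m' h h' =>
    obtain ⟨w, rfl⟩ := h
    obtain ⟨w', rfl⟩ := h'
    exact ⟨w ++ w', by simp [wordDegree]⟩
  | single i n => exact ⟨List.replicate n i, by simp [wordDegree]⟩

omit [NeZero N] in
-- When all Taylor coefficients of lower degree vanish, the multiplications by powers of `λ` inside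
-- `nabla` contribute nothing at `t = 0`. The word then reads off one Taylor coefficient, up to the
-- non-zero constant from iterated differentiation.
theorem exists_evalZero_nablaWord (hg : g ≠ 0) (w : List (Fin N)) : ∃ C : ℂ, C ≠ 0 ∧
    ∀ F : LaurentSeries (TimeRing N),
      (∀ (m : Fin N →₀ ℕ) (j : ℤ), m.degree < w.length → MvPowerSeries.coeff m (F.coeff j) = 0) →
      ∀ l, evalZero (nablaWord g w F) l = C * MvPowerSeries.coeff (wordDegree w) (F.coeff (-l)) := by
  induction w with
  | nil =>
    refine ⟨1, one_ne_zero, fun F _ l => ?_⟩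
    rw [one_mul]; rfl
  | cons i w ih =>
    obtain ⟨C, hC, h⟩ := ih
    have hne : ((wordDegree w i : ℂ) + 1) ≠ 0 := by exact_mod_cast Nat.succ_ne_zero (wordDegree w i)
    refine ⟨C * g * (wordDegree w i + 1), mul_ne_zero (mul_ne_zero hC hg) hne, fun F hF l => ?_⟩
    rw [nablaWord, h]
    · rw [coeff_coeff_nabla, hF (wordDegree w) _ (by rw [degree_wordDegree]; simp), add_zero]
      have : wordDegree (i :: w) = wordDegree w + Finsupp.single i 1 := by
        rw [wordDegree, List.map_cons, List.sum_cons, add_comm]; rfl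
      rw [this]
      ring
    · intro m j hm
      rw [coeff_coeff_nabla, hF m _ (by simp; omega),
        hF (m + Finsupp.single i 1) _ (by simp [Finsupp.degree_single]; omega)]
      ring

/-- By induction on the degree: the lowest Taylor coefficients form a vector of the span without
non-negative powers of `λ`, hence vanish. -/
theorem eq_zero_of_evalZero_nablaWord_mem (hg : g ≠ 0) (hW0 : W.coeff 0 = 1)
    (hWneg : ∀ i : ℤ, i < 0 → W.coeff i = 0) {F : LaurentSeries (TimeRing N)}
    (hF : ∀ w, evalZero (nablaWord g w F) ∈ Submodule.span ℂ (Set.range (frame g W)))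
    (hF0 : ∀ j ≤ 0, F.coeff j = 0) : F = 0 := by
  have key : ∀ d : ℕ, ∀ m : Fin N →₀ ℕ, m.degree = d → ∀ j, MvPowerSeries.coeff m (F.coeff j) = 0 := by
    intro d
    induction d using Nat.strong_induction_on with
    | _ d ih =>
      intro m hm j
      obtain ⟨w, rfl⟩ := exists_wordDegree_eq m
      obtain ⟨C, hC, h⟩ := exists_evalZero_nablaWord hg w
      have h' := h F fun m' j' hm' => ih _ (by rw [← hm, degree_wordDegree]; exact hm') m' rfl j'
      have hz : evalZero (nablaWord g w F) = 0 := by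
        refine eq_zero_of_mem_span_frame hW0 hWneg (hF w) fun l hl => ?_
        rw [h', hF0 _ (by omega), map_zero, mul_zero]
      have h2 := h' (-j)
      rw [hz, neg_neg] at h2
      exact (mul_eq_zero.mp h2.symm).resolve_left hC
  ext j m
  rw [key _ m rfl]
  simp

/-! ### Evolved states probed by a fermion and a finitely supported functional. -/

/-! ### The fermionic series -/

/-- The coefficient of `t^m` in `exp(g⁻¹ ∑ t_n α_n)`. -/
def flowCoeff (N : ℕ) (g : ℂ) (m : Fin N →₀ ℕ) : FockEnd :=
  MvPowerSeries.coeff m (fexp (linForm fun i : Fin N => g⁻¹ • alpha (((i : ℕ) : ℤ) + 1)))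

omit [NeZero N] in
theorem coeff_bra (f : Fock ℂ) (m : Fin N →₀ ℕ) :
    MvPowerSeries.coeff m (bra N g f) = flowCoeff N g m f ∅ := rfl

omit [NeZero N] in
theorem smul_alpha_comm (i j : Fin N) :
    (g⁻¹ • alpha (((i : ℕ) : ℤ) + 1) : FockEnd) * (g⁻¹ • alpha (((j : ℕ) : ℤ) + 1)) =
      (g⁻¹ • alpha (((j : ℕ) : ℤ) + 1)) * (g⁻¹ • alpha (((i : ℕ) : ℤ) + 1)) := by
  have := alpha_mul_comm (i + 1) (j + 1)
  push_cast at this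
  rw [smul_mul_smul_comm, smul_mul_smul_comm, this]

omit [NeZero N] in
theorem flowCoeff_zero : flowCoeff N g 0 = 1 := coeff_zero_fexp _

omit [NeZero N] in
theorem flowCoeff_add_single (hg : g ≠ 0) (m : Fin N →₀ ℕ) (i : Fin N) :
    (g * (m i + 1)) • flowCoeff N g (m + Finsupp.single i 1) =
      (alpha (((i : ℕ) : ℤ) + 1) : FockEnd) * flowCoeff N g m := by
  have := (mem_adjoin_and_recursion (smul_alpha_comm (N := N) (g := g)) m).2 i
  rw [mul_smul, flowCoeff, this, smul_mul_assoc, smul_smul, mul_inv_cancel₀ hg, one_smul]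
  rfl

omit [NeZero N] in
theorem flowCoeff_mul_comm (m : Fin N →₀ ℕ) {y : FockEnd}
    (hy : ∀ n : ℕ, y * alpha (n : ℤ) = alpha (n : ℤ) * y) :
    y * flowCoeff N g m = flowCoeff N g m * y := by
  refine commute_of_mem_adjoin (mem_adjoin_and_recursion (smul_alpha_comm (N := N) (g := g)) m).1 ?_
  rintro _ ⟨i, rfl⟩
  have := hy (i + 1)
  push_cast at this
  rw [mul_smul_comm, smul_mul_assoc, this]

/-- Finitely many basis vectors have all sufficiently high levels occupied in common. This bounds
the powers of `λ` from above in `fermionSeries`. -/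
theorem FinSupp.exists_psi_eq_zero {c : Fock ℂ →ₗ[ℂ] ℂ} (hc : FinSupp c) :
    ∃ M : ℤ, ∀ k, M < k → ∀ f, c (MinimalString.psi k f) = 0 := by
  obtain ⟨s, hs⟩ := hc
  obtain ⟨M, hM⟩ : ∃ M : ℤ, 0 ≤ M ∧ ∀ T ∈ s, ∀ x ∈ T, x ≤ M := by
    refine ⟨((s.sup fun T => T.sup Int.toNat : ℕ) : ℤ), Int.natCast_nonneg _, fun T hT x hx => ?_⟩
    have h1 : x.toNat ≤ T.sup Int.toNat := Finset.le_sup (f := Int.toNat) hx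
    have h2 := Finset.le_sup (f := fun T : Finset ℤ => T.sup Int.toNat) hT
    omega
  refine ⟨M, fun k hk f => hs _ fun T hT => ?_⟩
  rw [psi_apply, if_pos]
  exact Or.inl ⟨by omega, fun h => by have := hM.2 T hT k h; omega⟩

/-- `∑_k λ^k c(ψ_{-k-1/2} e^{g⁻¹ ∑ t_n α_n} |f⟩)`. -/
def fermionSeries (N : ℕ) (g : ℂ) (f : Fock ℂ) {c : Fock ℂ →ₗ[ℂ] ℂ} (hc : FinSupp c) :
    LaurentSeries (TimeRing N) :=
  HahnSeries.ofSuppBddBelow (fun j => fun m => c (psi (-j) (flowCoeff N g m f))) (by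
    obtain ⟨M, hM⟩ := hc.exists_psi_eq_zero
    refine ⟨-M, fun j hj => ?_⟩
    by_contra! h
    exact hj (funext fun m => hM _ (by omega) _))

omit [NeZero N] in
theorem coeff_coeff_fermionSeries (f : Fock ℂ) {c : Fock ℂ →ₗ[ℂ] ℂ} (hc : FinSupp c) (j : ℤ)
    (m : Fin N →₀ ℕ) : MvPowerSeries.coeff m ((fermionSeries N g f hc).coeff j) =
      c (psi (-j) (flowCoeff N g m f)) := rfl

omit [NeZero N] in
-- Differentiating the flow inserts `α_n` to the right of `ψ(λ)`; since `[α_n, ψ(λ)] = λ^n ψ(λ)`,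
-- the extra term of `nabla` moves it to the left, where it is absorbed by the functional.
theorem nabla_fermionSeries (hg : g ≠ 0) (f : Fock ℂ) {c : Fock ℂ →ₗ[ℂ] ℂ} (hc : FinSupp c)
    (i : Fin N) : nabla g i (fermionSeries N g f hc) =
      fermionSeries N g f (hc.alpha (((i : ℕ) : ℤ) + 1)) := by
  ext j m
  rw [coeff_coeff_nabla]
  simp only [coeff_coeff_fermionSeries]
  have h1 := congrArg (fun O : FockEnd => c (psi (-j) (O f))) (flowCoeff_add_single hg m i)
  simp only [LinearMap.smul_apply, map_smul, Module.End.mul_apply, smul_eq_mul] at h1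
  have h2 := congrArg (fun O : FockEnd => c (O (flowCoeff N g m f)))
    (lie_alpha_psi (((i : ℕ) : ℤ) + 1) (-j))
  simp only [LinearMap.sub_apply, Module.End.mul_apply, map_sub] at h2
  have e : -(j + (((i : ℕ) : ℤ) + 1)) = -j - (((i : ℕ) : ℤ) + 1) := by ring
  rw [e, ← h2, LinearMap.comp_apply]
  linear_combination h1

/-- Covariant derivatives only change the functional, so the induction runs over all of them at
once. At `t = 0` a functional is a finite combination of components, to which
`exists_psi_decomposable` applies. -/
theorem evalZero_nablaWord_fermionSeries_mem (hg : g ≠ 0) (hW0 : W.coeff 0 = 1)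
    (hWneg : ∀ i : ℤ, i < 0 → W.coeff i = 0) (w : List (Fin N)) {c : Fock ℂ →ₗ[ℂ] ℂ}
    (hc : FinSupp c) : evalZero (nablaWord g w (fermionSeries N g (ketAt g W) hc)) ∈
      Submodule.span ℂ (Set.range (frame g W)) := by
  classical
  induction w generalizing c with
  | cons i w ih => rw [nablaWord, nabla_fermionSeries hg]; exact ih _
  | nil =>
    obtain ⟨s, hs⟩ := hc
    have h1 : ∀ f : Fock ℂ, c f = ∑ T ∈ s, f T * c (Pi.single T 1) := by
      intro f
      have : c (f - ∑ T ∈ s, f T • (Pi.single T 1 : Fock ℂ)) = 0 := by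
        refine hs _ fun T hT => ?_
        rw [Pi.sub_apply, Finset.sum_apply, Finset.sum_eq_single T]
        · simp
        · intro U _ hU
          simp [Pi.single_eq_of_ne (Ne.symm hU)]
        · intro h; exact absurd hT h
      rw [map_sub, sub_eq_zero] at this
      rw [this, map_sum]
      simp
    choose M d hd using fun T => exists_psi_decomposable (v := frame g W) (frame_eq_zero hWneg)
      (frame_self hW0 hWneg) T
    have h2 : evalZero (nablaWord g [] (fermionSeries N g (ketAt g W) ⟨s, hs⟩)) =
        ∑ T ∈ s, ∑ a ∈ Finset.range (M T), (c (Pi.single T 1) * d T a) • frame g W a := by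
      funext l
      change c (psi (- -l) (flowCoeff N g 0 (ketAt g W))) = _
      rw [flowCoeff_zero, Module.End.one_apply, neg_neg, h1, Finset.sum_apply]
      refine Finset.sum_congr rfl fun T _ => ?_
      rw [ketAt_eq, hd, Finset.sum_mul, Finset.sum_apply]
      refine Finset.sum_congr rfl fun a _ => ?_
      rw [Pi.smul_apply, smul_eq_mul]
      ring
    rw [h2]
    exact Submodule.sum_mem _ fun T _ => Submodule.sum_mem _ fun a _ =>
      Submodule.smul_mem _ _ (Submodule.subset_span ⟨a, rfl⟩)

theorem vertexCorr_eq_fermionSeries :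
    vertexCorr g W = fermionSeries N g (ketAt g W) (finSupp_component {0}) := by
  ext j m
  rw [coeff_coeff_fermionSeries, component_apply]
  by_cases hj : j < 0
  · rw [psi_apply_zero_of_pos (by omega), vertexCorr, PowerSeries.coeff_coe, if_pos hj, map_zero]
  · obtain ⟨n, rfl⟩ := Int.eq_ofNat_of_zero_le (not_lt.mp hj)
    rw [vertexCorr, LaurentSeries.coeff_coe_powerSeries, PowerSeries.coeff_mk, coeff_bra,
      ← expPhiPlus_apply_empty, ← Module.End.mul_apply, ← Module.End.mul_apply, flowCoeff_mul_comm]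
    intro k
    exact (commute_alpha_expPhiPlus k n).symm

/-- The Baker–Akhiezer function in terms of the tau function. -/
theorem tau_smul_eq_vertexCorr (hg : g ≠ 0) (hW0 : W.coeff 0 = 1)
    (hWneg : ∀ i : ℤ, i < 0 → W.coeff i = 0) {L : PsiDO N}
    (hsato : ∀ i : Fin N, g • dTimeOp i W =
      comp g (posPart (opPow g L ((i : ℕ) + 1))) W - comp g W (delPow N (((i : ℕ) : ℤ) + 1))) :
    tau g W • W = vertexCorr g W := by
  rw [← sub_eq_zero]
  refine eq_zero_of_evalZero_nablaWord_mem hg hW0 hWneg (fun w => ?_) fun j hj => ?_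
  · rw [nablaWord_sub, map_sub]
    refine Submodule.sub_mem _ (evalZero_nablaWord_mem_span hsato w (Submodule.smul_mem _ _ ?_)) ?_
    · have : comp g (delPow N (0 : ℕ)) W = W := delPow_zero_comp g W
      exact Submodule.subset_span ⟨0, this⟩
    · rw [vertexCorr_eq_fermionSeries]
      exact evalZero_nablaWord_fermionSeries_mem hg hW0 hWneg w _
  -- Both `W` and `e^{φ₊(λ)}` begin with `1`, so the two sides agree at all non-negative powers of
  -- `λ`, where only `τ` occurs.
  · rw [HahnSeries.coeff_sub, HahnSeries.coeff_smul, vertexCorr, PowerSeries.coeff_coe]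
    rcases lt_or_eq_of_le hj with hj | rfl
    · rw [if_pos hj, hWneg j hj, smul_zero, sub_zero]
    · rw [hW0, if_neg (lt_irrefl 0), smul_eq_mul, mul_one]
      simp [expPhiPlus_zero, tau]

theorem constantCoeff_tau (hW0 : W.coeff 0 = 1) (hWneg : ∀ i : ℤ, i < 0 → W.coeff i = 0) :
    MvPowerSeries.constantCoeff (tau g W) = 1 := by
  rw [← MvPowerSeries.coeff_zero_eq_constantCoeff_apply, tau, coeff_bra, flowCoeff_zero]
  exact decomposable_empty (frame_eq_zero hWneg) (frame_self hW0 hWneg)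

end Tau

/-! ## The operator `W⁻¹ Q W` -/

section Douglas

variable {N : ℕ} [NeZero N] {g : ℂ} {W : PsiDO N}

theorem opPow_comp {L : PsiDO N} (h : comp g L W = comp g W (delPow N 1)) (n : ℕ) :
    comp g (opPow g L n) W = comp g W (delPow N n) := by
  induction n with
  | zero => rw [Nat.cast_zero, opPow, delPow_zero_comp, comp_delPow, delPow_zero, mul_one]
  | succ n ih =>
    rw [opPow, comp_assoc, ih, ← comp_assoc, h, comp_assoc, delPow_comp_delPow]
    push_cast
    rw [add_comm]

/-- `W` is monic, so the leading coefficient of `W ∘ Z` is that of `Z`. Relations can thus be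
conjugated by `W` without constructing its inverse. -/
theorem comp_left_cancel (hW0 : W.coeff 0 = 1) (hWneg : ∀ i : ℤ, i < 0 → W.coeff i = 0)
    {X Y : PsiDO N} (h : comp g W X = comp g W Y) : X = Y := by
  rw [← sub_eq_zero]
  by_contra hne
  have h0 : comp g W (X - Y) = 0 := by rw [comp_sub_right, h, sub_self]
  set Z := X - Y
  have hZ : LowBound Z Z.order := fun i hi => HahnSeries.coeff_eq_zero_of_lt_order hi
  have h1 : (comp g W Z).coeff Z.order = (0 : PsiDO N).coeff Z.order := by rw [h0]
  rw [coeff_comp g hWneg hZ (K := 1) (by push_cast; omega), Finset.sum_range_one, hasseLam_zero,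
    Function.iterate_zero, id_eq, coeff_mul_eq_sum hWneg hZ, sub_self, Finset.Icc_self,
    Finset.sum_singleton, hW0, one_mul, sub_zero, HahnSeries.coeff_zero] at h1
  exact hne (HahnSeries.coeff_order_eq_zero.mp h1)

omit [NeZero N] in
theorem hasseLam_delPow (k : ℕ) (n : ℤ) :
    hasseLam k (delPow N n) = HahnSeries.single (-n + k) ((Ring.choose n k : ℤ) • (1 : TimeRing N)) := by
  rw [delPow, hasseLam_single, neg_neg]

omit [NeZero N] in
theorem hasseLam_one_delPow (n : ℤ) :
    hasseLam 1 (delPow N n) = (n : ℂ) • delPow N (n - 1) := by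
  rw [hasseLam_delPow, Ring.choose_one_right, delPow]
  ext j : 2
  rw [HahnSeries.coeff_smul, HahnSeries.coeff_single, HahnSeries.coeff_single]
  push_cast
  have : -(n - 1) = -n + 1 := by ring
  rw [this]
  split_ifs
  · rw [zsmul_eq_mul, mul_one, MvPowerSeries.smul_eq_C_mul, mul_one, map_intCast]
  · rw [smul_zero]

/-- The leading part of `[∂^p, X]` is `p ∂^(p-1)` times the leading part of the derivative of `X`,
and `p ≠ 0`. -/
theorem del_eq_zero_of_comm {p : ℕ} (hp : 0 < p) {X : PsiDO N}
    (h : comp g (delPow N p) X = X * delPow N p) : mapDer (del N g) X = 0 := by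
  by_contra hne
  set Y := mapDer (del N g) X with hY
  obtain ⟨x, hx⟩ := exists_lowBound X
  have hYb : LowBound Y Y.order := fun i hi => HahnSeries.coeff_eq_zero_of_lt_order hi
  -- The order at which the first-derivative term starts; terms with two or more derivatives start
  -- later.
  set m : ℤ := Y.order - p + 1 with hm
  obtain ⟨K, hK⟩ := exists_coeff_comp g (delPow N p) X m
  have h1 := hK (K + 2) (by omega)
  have hz : ∀ k ∈ Finset.range K,
      (hasseLam (2 + k) (delPow N p) * (mapDer (del N g))^[2 + k] X).coeff m = 0 := by
    intro k _
    have e : (mapDer (del N g))^[2 + k] X = (mapDer (del N g))^[1 + k] Y := by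
      rw [hY, ← Function.iterate_succ_apply]; congr 1; omega
    rw [e]
    refine (((lowBound_single (-(p : ℤ)) (1 : TimeRing N)).hasseLam (2 + k)).mul
      (hYb.mapDer_iterate (del N g) (1 + k))) m ?_
    push_cast; omega
  rw [add_comm K 2, Finset.sum_range_add, Finset.sum_eq_zero hz, add_zero, h,
    Finset.sum_range_succ, Finset.sum_range_one, hasseLam_zero, Function.iterate_zero, id_eq,
    Function.iterate_one, mul_comm X, left_eq_add, hasseLam_delPow, HahnSeries.coeff_single_mul] at h1
  have e2 : m - (-(p : ℤ) + (1 : ℕ)) = Y.order := by rw [hm]; push_cast; ring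
  rw [e2, Ring.choose_one_right, smul_mul_assoc, one_mul, natCast_zsmul, ← Nat.cast_smul_eq_nsmul ℂ]
    at h1
  have hp' : (p : ℂ) ≠ 0 := Nat.cast_ne_zero.mpr (by omega)
  exact hne (HahnSeries.coeff_order_eq_zero.mp ((smul_eq_zero.mp h1).resolve_left hp'))

variable {p : ℕ} {b : ℕ →₀ ℂ} {γ : ℂ}

theorem DouglasSolution.P_comp_W (sol : DouglasSolution N p g b γ) :
    comp g sol.P sol.W = comp g sol.W (delPow N p) := by
  rw [← sol.lax_pow, opPow_comp sol.dressing]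

theorem DouglasSolution.comm_A (sol : DouglasSolution N p g b γ) :
    comp g (delPow N p) sol.A - comp g sol.A (delPow N p) = g • delPow N 0 := by
  refine comp_left_cancel (g := g) sol.sato_coeff_zero sol.sato_coeff_neg ?_
  rw [comp_sub_right, ← comp_assoc, ← sol.P_comp_W, comp_assoc, ← sol.conj, ← comp_assoc,
    ← comp_assoc, ← sol.conj, comp_assoc g sol.Q, ← sol.P_comp_W, ← comp_assoc, ← comp_sub_left]
  have := sol.douglas
  rw [commOp] at this
  rw [this, comp_csmul_left, delPow_zero_comp, comp_smul_right, comp_delPow, delPow_zero, mul_one]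

/-- The operators `(L^n)₊` from the flows of `Q` and of `W` cancel; only the undressed `∂^n`
remains. -/
theorem DouglasSolution.flow_A (sol : DouglasSolution N p g b γ) (i : Fin N) :
    g • dTimeOp i sol.A = comp g (delPow N (((i : ℕ) : ℤ) + 1)) sol.A -
      comp g sol.A (delPow N (((i : ℕ) : ℤ) + 1)) := by
  refine comp_left_cancel (g := g) sol.sato_coeff_zero sol.sato_coeff_neg ?_
  have h1 := congrArg (fun X => g • dTimeOp i X) sol.conj
  simp only [dTimeOp_comp, smul_add] at h1
  rw [← comp_csmul_left, ← comp_smul_right, ← comp_csmul_left, ← comp_smul_right, sol.flow_Q,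
    sol.sato, commOp, comp_sub_left, comp_sub_right, comp_sub_left, comp_assoc, sol.conj,
    comp_assoc g sol.Q, ← comp_assoc g sol.Q sol.W, sol.conj, comp_assoc g (posPart _) sol.W,
    comp_assoc g sol.W, comp_assoc g sol.W] at h1
  rw [comp_sub_right]
  have h2 : comp g sol.W (g • dTimeOp i sol.A) =
      comp g (posPart (opPow g sol.L (↑i + 1))) (comp g sol.W sol.A) -
        comp g sol.W (comp g sol.A (delPow N (↑↑i + 1))) -
        (comp g (posPart (opPow g sol.L (↑i + 1))) (comp g sol.W sol.A) -
          comp g sol.W (comp g (delPow N (↑↑i + 1)) sol.A)) := by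
    rw [eq_sub_iff_add_eq, add_comm, ← h1]
    abel
  rw [h2]
  abel

/-- The part of `W⁻¹ Q W` that is linear in the `t_n`. -/
def linearSymbol (N p : ℕ) : PsiDO N :=
  (p : ℂ)⁻¹ • ∑ i : Fin N, (((i : ℕ) : ℂ) + 1) •
    HahnSeries.single ((p : ℤ) - ((i : ℕ) + 1)) (MvPowerSeries.X i : TimeRing N)

omit [NeZero N] in
theorem mapDer_linearSymbol (d : Derivation ℂ (TimeRing N) (TimeRing N)) :
    mapDer d (linearSymbol N p) = (p : ℂ)⁻¹ • ∑ i : Fin N, (((i : ℕ) : ℂ) + 1) •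
      HahnSeries.single ((p : ℤ) - ((i : ℕ) + 1)) (d (MvPowerSeries.X i) : TimeRing N) := by
  simp only [linearSymbol, map_smul, map_sum, mapDer_single]

omit [NeZero N] in
theorem mapDer_backgroundSymbol (d : Derivation ℂ (TimeRing N) (TimeRing N)) :
    mapDer d (backgroundSymbol N p g b γ) = 0 := by
  simp [backgroundSymbol, map_smul, map_sum, map_add, mapDer_delPow]

omit [NeZero N] in
theorem pderiv_linearSymbol (i : Fin N) :
    mapDer (MvPowerSeries.pderiv ℂ i) (linearSymbol N p) =
      ((p : ℂ)⁻¹ * (((i : ℕ) : ℂ) + 1)) • delPow N ((i : ℕ) + 1 - p) := by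
  rw [mapDer_linearSymbol, Finset.sum_eq_single i, MvPowerSeries.pderiv_X_self, smul_smul, delPow]
  · congr 2; ring_nf
  · intro j _ hj
    rw [MvPowerSeries.pderiv_X_of_ne hj, map_zero, smul_zero]
  · simp

theorem del_linearSymbol : mapDer (del N g) (linearSymbol N p) =
    (g * (p : ℂ)⁻¹) • delPow N (1 - p) := by
  have h : mapDer (del N g) (linearSymbol N p) =
      g • mapDer (MvPowerSeries.pderiv ℂ (0 : Fin N)) (linearSymbol N p) := by
    ext j : 2; simp [del]
  rw [h, pderiv_linearSymbol, smul_smul]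
  simp

omit [NeZero N] in
theorem delPow_mul_smul_delPow (c c' : ℂ) (j k : ℤ) :
    (c • delPow N j) * (c' • delPow N k) = (c * c') • delPow N (j + k) := by
  ext m : 2
  rw [coeff_mul_csmul, mul_comm, coeff_mul_csmul, mul_comm, delPow_mul, HahnSeries.coeff_smul,
    smul_smul, mul_comm]

theorem comp_delPow_of_del {X : PsiDO N} (n : ℤ)
    (h : mapDer (del N g) X = (g * (p : ℂ)⁻¹) • delPow N (1 - p)) :
    comp g (delPow N n) X = delPow N n * X + (n * (g * (p : ℂ)⁻¹)) • delPow N (n - p) := by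
  rw [comp_of_del_del_eq_zero, h, hasseLam_one_delPow, delPow_mul_smul_delPow]
  · congr 3; ring
  · rw [h, map_smul, mapDer_delPow, smul_zero]

omit [NeZero N] in
theorem eq_C_of_pderiv_eq_zero {f : TimeRing N} (h : ∀ i, MvPowerSeries.pderiv ℂ i f = 0)
    (h0 : MvPowerSeries.constantCoeff f = 0) : f = 0 := by
  refine MvPowerSeries.pderiv.ext (fun i => ?_) ?_
  · rw [h, map_zero]
  · rw [h0, map_zero]

/-- The explicit symbol solves the same relations. Hence the difference commutes with `∂^p` and is
free of `x_1`; the flows then make it free of all times, and it vanishes at the background by the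
normalization. -/
theorem DouglasSolution.A_eq (hp : 0 < p) (hg : g ≠ 0) (sol : DouglasSolution N p g b γ) :
    sol.A = backgroundSymbol N p g b γ + linearSymbol N p := by
  have hp' : (p : ℂ) ≠ 0 := Nat.cast_ne_zero.mpr (by omega)
  set Z := sol.A - (backgroundSymbol N p g b γ + linearSymbol N p) with hZ
  have hA : sol.A = Z + (backgroundSymbol N p g b γ + linearSymbol N p) := by rw [hZ]; abel
  have hbl : mapDer (del N g) (backgroundSymbol N p g b γ + linearSymbol N p) =
      (g * (p : ℂ)⁻¹) • delPow N (1 - p) := by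
    rw [map_add, mapDer_backgroundSymbol, zero_add, del_linearSymbol]
  have hZd : mapDer (del N g) Z = 0 := by
    refine del_eq_zero_of_comm hp ?_
    have h1 := sol.comm_A
    rw [comp_delPow, hA, comp_add_right, comp_delPow_of_del (p : ℤ) hbl, add_mul, sub_self] at h1
    have h2 : ((p : ℤ) : ℂ) * (g * (p : ℂ)⁻¹) = g := by push_cast; field_simp
    rw [h2, mul_comm (delPow N p) (_ + _)] at h1
    rw [← sub_eq_zero]
    linear_combination h1
  have hAd : mapDer (del N g) sol.A = (g * (p : ℂ)⁻¹) • delPow N (1 - p) := by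
    rw [hA, map_add, hZd, hbl, zero_add]
  have hZi : ∀ i : Fin N, mapDer (MvPowerSeries.pderiv ℂ i) Z = 0 := by
    intro i
    have h1 := sol.flow_A i
    rw [comp_delPow, comp_delPow_of_del _ hAd, mul_comm (delPow N _), add_sub_cancel_left,
      dTimeOp_eq, hA, map_add, map_add, mapDer_backgroundSymbol, pderiv_linearSymbol, zero_add,
      smul_add, smul_smul] at h1
    have h2 : g * ((p : ℂ)⁻¹ * (((i : ℕ) : ℂ) + 1)) =
        (((i : ℕ) + 1 : ℤ) : ℂ) * (g * (p : ℂ)⁻¹) := by push_cast; ring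
    rw [h2, add_eq_right] at h1
    exact (smul_eq_zero.mp h1).resolve_left hg
  have hZ0 : Z = 0 := by
    ext j : 2
    refine eq_C_of_pderiv_eq_zero (fun i => ?_) ?_
    · rw [← coeff_mapDer, hZi]; rfl
    · have h1 := congrArg (fun X : PsiDO N => MvPowerSeries.constantCoeff (X.coeff j)) sol.normalized
      have h2 : MvPowerSeries.constantCoeff ((atBackground sol.A).coeff j) =
          MvPowerSeries.constantCoeff (sol.A.coeff j) := by
        change MvPowerSeries.constantCoeff (MvPowerSeries.C (MvPowerSeries.constantCoeff _)) = _
        rw [MvPowerSeries.constantCoeff_C]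
      have h3 : MvPowerSeries.constantCoeff ((linearSymbol N p).coeff j) = 0 := by
        have h5 : evalZero (linearSymbol N p) = 0 := by
          rw [linearSymbol, map_smul, map_sum, Finset.sum_eq_zero, smul_zero]
          intro i _
          rw [map_smul]
          have : evalZero (HahnSeries.single ((p : ℤ) - ((i : ℕ) + 1))
              (MvPowerSeries.X i : TimeRing N)) = 0 := by
            funext l
            rw [evalZero_apply, HahnSeries.coeff_single]
            split_ifs <;> simp
          rw [this, smul_zero]
        have := congrFun h5 (-j)
        rwa [evalZero_apply, neg_neg] at this
      rw [h2] at h1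
      rw [hZ, HahnSeries.coeff_sub, HahnSeries.coeff_add, map_sub, map_add, h3, h1]
      ring
  rw [hA, hZ0, zero_add]

/-! ## The time series -/

theorem exists_time_eq_zero (N : ℕ) (b : ℕ →₀ ℂ) : ∃ K, ∀ n, K < n → time N b n = 0 := by
  refine ⟨N + b.support.sup id, fun n hn => ?_⟩
  have h1 : b n = 0 := by
    by_contra h
    have : n ≤ b.support.sup id := Finset.le_sup (f := id) (Finsupp.mem_support_iff.mpr h)
    omega
  rw [time, h1, map_zero, dif_neg (by omega), zero_add]

/-- `∑_n n x_n λ^(n-1)`. -/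
def timeSeries (N : ℕ) (b : ℕ →₀ ℂ) : LaurentSeries (TimeRing N) :=
  -- The power `λ^(-j)` belongs to `n = 1 - j`. For `n ≤ 0` the truncation to `0` makes the
  -- prefactor vanish, so the value `b 0` never enters.
  HahnSeries.ofSuppBddBelow (fun j => (((1 - j).toNat : ℕ) : ℂ) • time N b (1 - j).toNat) (by
    obtain ⟨K, hK⟩ := exists_time_eq_zero N b
    refine ⟨-K, fun j hj => ?_⟩
    by_contra! h
    exact hj (by simp only; rw [hK _ (by omega), smul_zero]))

omit [NeZero N] in
theorem coeff_timeSeries (j : ℤ) : (timeSeries N b).coeff j =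
    (((1 - j).toNat : ℕ) : ℂ) • time N b (1 - j).toNat := rfl

omit [NeZero N] in
theorem symbol_eq : backgroundSymbol N p g b γ + linearSymbol N p =
    (p : ℂ)⁻¹ • (delPow N (1 - p) * timeSeries N b) + (g * γ / p) • delPow N (-p) := by
  ext j : 2
  have e : j + (1 - (p : ℤ)) = 1 - (p - j) := by ring
  simp only [backgroundSymbol, linearSymbol, HahnSeries.coeff_add, HahnSeries.coeff_smul,
    HahnSeries.coeff_sum, coeff_delPow_mul, coeff_timeSeries]
  rw [e, sub_sub_cancel]
  have hkey : ∑ n ∈ b.support, ((n : ℂ) * b n) • (delPow N ((n : ℤ) - p)).coeff j +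
      ∑ i : Fin N, (((i : ℕ) : ℂ) + 1) • (HahnSeries.single ((p : ℤ) - ((i : ℕ) + 1))
        (MvPowerSeries.X i : TimeRing N)).coeff j =
      ((((p : ℤ) - j).toNat : ℕ) : ℂ) • time N b ((p : ℤ) - j).toNat := by
    simp only [delPow, HahnSeries.coeff_single]
    by_cases hj : j ≤ p
    · obtain ⟨n, hn⟩ := Int.eq_ofNat_of_zero_le (sub_nonneg.mpr hj)
      rw [hn, time, smul_add, Int.toNat_natCast]
      congr 1
      · rw [Finset.sum_eq_single n]
        · rw [if_pos (by omega), mul_smul]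
          congr 1
          rw [MvPowerSeries.smul_eq_C_mul, mul_one]
        · intro k _ hk
          rw [if_neg (by omega), smul_zero]
        · intro h
          rw [Finsupp.notMem_support_iff.mp h, mul_zero, zero_smul]
      · split_ifs with h
        · rw [Finset.sum_eq_single ⟨n - 1, by omega⟩]
          · rw [if_pos (by simp only; omega)]
            congr 1
            have : (((n - 1 : ℕ) : ℂ) + 1) = ((n - 1 + 1 : ℕ) : ℂ) := by push_cast; rfl
            rw [this, Nat.sub_add_cancel h.1]
          · intro i _ hi
            rw [if_neg, smul_zero]
            intro h'
            apply hi
            ext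
            simp only
            omega
          · simp
        · rw [smul_zero]
          refine Finset.sum_eq_zero fun i _ => ?_
          rw [if_neg (by omega), smul_zero]
    · have : ((p : ℤ) - j).toNat = 0 := by omega
      rw [this, Nat.cast_zero, zero_smul, Finset.sum_eq_zero, Finset.sum_eq_zero, add_zero]
      · intro i _; rw [if_neg (by omega), smul_zero]
      · intro n _; rw [if_neg (by omega), smul_zero]
  rw [← hkey, smul_add, smul_add, smul_smul]
  have : (p : ℂ)⁻¹ * (g * γ) = g * γ / p := by ring
  rw [this]
  abel

/-- `Q Ψ` in terms of the times. -/
theorem DouglasSolution.Q_comp_W (hp : 0 < p) (hg : g ≠ 0) (sol : DouglasSolution N p g b γ) :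
    comp g sol.Q sol.W =
      sol.W * ((p : ℂ)⁻¹ • (delPow N (1 - p) * timeSeries N b) + (g * γ / p) • delPow N (-p)) +
      hasseLam 1 sol.W * ((g * (p : ℂ)⁻¹) • delPow N (1 - p)) := by
  have hd : mapDer (del N g) sol.A = (g * (p : ℂ)⁻¹) • delPow N (1 - p) := by
    rw [sol.A_eq hp hg, map_add, mapDer_backgroundSymbol, zero_add, del_linearSymbol]
  rw [sol.conj, comp_of_del_del_eq_zero, hd, sol.A_eq hp hg, symbol_eq]
  rw [hd, map_smul, mapDer_delPow, smul_zero]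

end Douglas

/-! ## Current modes against the flowing vacuum -/

section Currents

variable {N : ℕ} {g : ℂ} {b : ℕ →₀ ℂ}

/-- `⟨0| exp(g⁻¹ ∑ t_n α_n)` as a linear map. -/
def braHom (N : ℕ) (g : ℂ) : Fock ℂ →ₗ[ℂ] TimeRing N where
  toFun := bra N g
  map_add' f f' := by ext m; simp only [coeff_bra, map_add, Pi.add_apply]
  map_smul' c f := by
    ext m; simp only [coeff_bra, map_smul, Pi.smul_apply, RingHom.id_apply]

theorem braHom_apply (f : Fock ℂ) : braHom N g f = bra N g f := rfl

theorem smul_pderiv_bra (hg : g ≠ 0) (i : Fin N) (f : Fock ℂ) :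
    g • MvPowerSeries.pderiv ℂ i (bra N g f) = bra N g (alpha (((i : ℕ) : ℤ) + 1) f) := by
  ext m
  have h := congrArg (fun O : FockEnd => O f ∅) (flowCoeff_add_single hg m i)
  have h2 : (alpha (((i : ℕ) : ℤ) + 1) : FockEnd) * flowCoeff N g m =
      flowCoeff N g m * alpha (((i : ℕ) : ℤ) + 1) := by
    refine flowCoeff_mul_comm m fun n => ?_
    have := alpha_mul_comm (i + 1) n
    push_cast at this
    exact this
  rw [h2] at h
  rw [map_smul, MvPowerSeries.coeff_pderiv, smul_eq_mul, coeff_bra, coeff_bra]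
  simp only [LinearMap.smul_apply, Pi.smul_apply, Module.End.mul_apply, smul_eq_mul] at h
  rw [← h]
  ring

/-- When differentiation amounts to acting on the state, every Taylor coefficient reduces to a
constant term for another state. Identities for the evolved bra thus need checking only at `t = 0`.
-/
theorem eq_zero_of_smul_pderiv {G : Fock ℂ → TimeRing N}
    (h : ∀ (i : Fin N) f, g • MvPowerSeries.pderiv ℂ i (G f) = G (alpha (((i : ℕ) : ℤ) + 1) f))
    (hg : g ≠ 0) (h0 : ∀ f, MvPowerSeries.constantCoeff (G f) = 0) (f : Fock ℂ) : G f = 0 := by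
  have key : ∀ d : ℕ, ∀ m : Fin N →₀ ℕ, m.degree = d → ∀ f, MvPowerSeries.coeff m (G f) = 0 := by
    intro d
    induction d with
    | zero =>
      intro m hm f
      rw [(Finsupp.degree_eq_zero_iff m).mp hm, MvPowerSeries.coeff_zero_eq_constantCoeff_apply, h0]
    | succ d ih =>
      intro m hm f
      obtain ⟨i, hi⟩ : ∃ i, m i ≠ 0 := by
        by_contra! hall
        have : m = 0 := Finsupp.ext hall
        rw [this, map_zero] at hm
        omega
      have hmi : m - Finsupp.single i 1 + Finsupp.single i 1 = m :=
        tsub_add_cancel_of_le (Finsupp.single_le_iff.mpr (by omega))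
      have h1 := congrArg (MvPowerSeries.coeff (m - Finsupp.single i 1)) (h i f)
      have hdeg : (m - Finsupp.single i 1).degree = d := by
        have := congrArg Finsupp.degree hmi
        rw [map_add, Finsupp.degree_single] at this
        omega
      rw [map_smul, MvPowerSeries.coeff_pderiv, hmi, ih _ hdeg, smul_eq_mul] at h1
      have hne : (((m - Finsupp.single i 1 : Fin N →₀ ℕ) i : ℂ) + 1) ≠ 0 := Nat.cast_add_one_ne_zero _
      exact ((mul_eq_zero.mp ((mul_eq_zero.mp h1).resolve_left hg)).resolve_right hne)
  ext m
  rw [key _ m rfl, map_zero]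

theorem pderiv_time (i : Fin N) (r : ℕ) :
    MvPowerSeries.pderiv ℂ i (time N b r) = if r = i + 1 then 1 else 0 := by
  rw [time, map_add, MvPowerSeries.pderiv_C, zero_add]
  by_cases h : 1 ≤ r ∧ r ≤ N
  · rw [dif_pos h]
    by_cases hr : r = i + 1
    · have : (⟨r - 1, by omega⟩ : Fin N) = i := by ext; simp only; omega
      rw [this, MvPowerSeries.pderiv_X_self, if_pos hr]
    · rw [MvPowerSeries.pderiv_X_of_ne, if_neg hr]
      intro h'
      apply hr
      rw [← h']
      simp only
      omega
  · rw [dif_neg h, map_zero, if_neg]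
    intro hr
    have := i.2
    omega

theorem constantCoeff_time (r : ℕ) : MvPowerSeries.constantCoeff (time N b r) = b r := by
  rw [time, map_add, MvPowerSeries.constantCoeff_C]
  split_ifs <;> simp

/-- Both sides obey the same differential equations in `t`, by the Heisenberg relations, and vanish
at `t = 0`, where the vacuum bra kills `α_{-r}`. The difference of `time` and `b r` is just `t_r`.
-/
theorem bra_alpha_neg (hg : g ≠ 0) (r : ℕ) (f : Fock ℂ) :
    bra N g (alpha (-r : ℤ) f) =
      (g⁻¹ * r) • ((time N b r - MvPowerSeries.C (b r)) * bra N g f) := by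
  rw [← sub_eq_zero]
  refine eq_zero_of_smul_pderiv (G := fun f => bra N g (alpha (-r : ℤ) f) -
    (g⁻¹ * r) • ((time N b r - MvPowerSeries.C (b r)) * bra N g f)) (fun i f => ?_) hg
    (fun f => ?_) f
  · have h1 := congrArg (fun O : FockEnd => bra N g (O f)) (lie_alpha_alpha (i + 1) (-r : ℤ))
    have h2 : bra N g (((alpha ((i + 1 : ℕ) : ℤ) * alpha (-r : ℤ) -
        alpha (-r : ℤ) * alpha ((i + 1 : ℕ) : ℤ) : FockEnd)) f) =
        bra N g (alpha (((i : ℕ) : ℤ) + 1) (alpha (-r : ℤ) f)) -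
        bra N g (alpha (-r : ℤ) (alpha (((i : ℕ) : ℤ) + 1) f)) := by
      rw [← braHom_apply, LinearMap.sub_apply, map_sub]
      rfl
    simp only [h2] at h1
    rw [sub_eq_iff_eq_add] at h1
    have h3 : bra N g ((if ((i + 1 : ℕ) : ℤ) + -r = 0 then ((i + 1 : ℕ) : FockEnd) else 0) f) =
        (if r = i + 1 then (r : ℂ) else 0) • bra N g f := by
      by_cases hr : r = i + 1
      · rw [if_pos (by omega), if_pos hr, ← hr, ← braHom_apply, ← braHom_apply, ← map_smul]
        congr 1
        rw [← Nat.smul_one_eq_cast, ← Nat.cast_smul_eq_nsmul ℂ, LinearMap.smul_apply,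
          Module.End.one_apply]
      · rw [if_neg (by omega), if_neg hr, zero_smul, ← braHom_apply, LinearMap.zero_apply, map_zero]
    rw [map_sub, smul_sub, smul_pderiv_bra hg, h1, h3, Derivation.map_smul, Derivation.leibniz,
      map_sub, pderiv_time, MvPowerSeries.pderiv_C, sub_zero, smul_comm g, smul_add,
      smul_comm g (time N b r - _), smul_pderiv_bra hg]
    simp only [smul_eq_mul, mul_ite, mul_one, mul_zero, smul_add, smul_ite, smul_zero, ite_smul,
      zero_smul, smul_smul]
    have : g⁻¹ * r * g = (r : ℂ) := by field_simp
    split_ifs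
    · rw [this]; abel
    · abel
  · rw [map_sub, MvPowerSeries.smul_eq_C_mul, (MvPowerSeries.constantCoeff).map_mul,
      (MvPowerSeries.constantCoeff).map_mul (_ - _), map_sub, constantCoeff_time,
      MvPowerSeries.constantCoeff_C, MvPowerSeries.constantCoeff_C, sub_self, zero_mul, mul_zero,
      sub_zero, ← MvPowerSeries.coeff_zero_eq_constantCoeff_apply, coeff_bra, flowCoeff_zero]
    exact alpha_apply_empty (by omega) f

theorem alphaAt_of_pos {n : ℤ} (hn : 0 < n) : alphaAt g b n = alpha n := by
  rw [alphaAt, Finset.sum_eq_zero, smul_zero, add_zero]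
  intro m _
  rw [bracket_alpha, if_neg (by omega), smul_zero]

theorem alphaAt_neg (r : ℕ) : alphaAt g b (-r : ℤ) = alpha (-r : ℤ) + (g⁻¹ * (r * b r)) • 1 := by
  rw [alphaAt, Finset.sum_eq_single r, bracket_alpha, if_pos (by omega), mul_smul]
  · congr 2
    rw [← Nat.smul_one_eq_cast, ← Nat.cast_smul_eq_nsmul ℂ, smul_smul, mul_comm]
  · intro m _ hm
    rw [bracket_alpha, if_neg (by omega), smul_zero]
  · intro h
    rw [Finsupp.notMem_support_iff.mp h, zero_smul]

/-- The scalar from conjugation by the background supplies `g⁻¹ r b_r`, completing `t_r` to the full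
time `x_r`. -/
theorem bra_alphaAt_neg (hg : g ≠ 0) (r : ℕ) (f : Fock ℂ) :
    bra N g (alphaAt g b (-r : ℤ) f) = (g⁻¹ * r) • (time N b r * bra N g f) := by
  rw [alphaAt_neg, ← braHom_apply, LinearMap.add_apply, map_add, LinearMap.smul_apply,
    Module.End.one_apply, map_smul, braHom_apply, braHom_apply, bra_alpha_neg hg (b := b), sub_mul,
    smul_sub, ← MvPowerSeries.smul_eq_C_mul, smul_smul, mul_assoc, sub_add_cancel]

end Currents

/-! ## The current correlator as a Laurent series -/

section CurrentSeries

variable {N : ℕ} [NeZero N] {g : ℂ} {b : ℕ →₀ ℂ} {W : PsiDO N}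

theorem coeff_vertexCorr (l : ℕ) :
    (vertexCorr g W).coeff l = bra N g (expPhiPlus l (ketAt g W)) := by
  rw [vertexCorr, LaurentSeries.coeff_coe_powerSeries, PowerSeries.coeff_mk]

theorem lowBound_vertexCorr : LowBound (vertexCorr g W) 0 := fun i hi => by
  rw [vertexCorr, PowerSeries.coeff_coe, if_pos hi]

/-- `⟨x/g| ∂φ(λ) e^{φ₊(λ)} |Φ⟩ = (∂/∂λ + g⁻¹ ∑ n x_n λ^(n-1)) ⟨x/g| e^{φ₊(λ)} |Φ⟩`. -/
def currentSeries (g : ℂ) (b : ℕ →₀ ℂ) (W : PsiDO N) : LaurentSeries (TimeRing N) :=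
  hasseLam 1 (vertexCorr g W) + g⁻¹ • (timeSeries N b * vertexCorr g W)

/-- The recursion for `e^{φ₊}` shows that its `λ`-derivative is the insertion of the positive
current modes. -/
theorem coeff_hasseLam_vertexCorr (k : ℤ) :
    (hasseLam 1 (vertexCorr g W)).coeff (-k) = ∑ l ∈ Finset.range (-k - 1).toNat,
      bra N g (alpha (-k - 1 - l) (expPhiPlus l (ketAt g W))) := by
  rw [coeff_hasseLam, Ring.choose_one_right]
  push_cast
  rcases lt_or_ge (-k - 1) 0 with hk | hk
  · rw [lowBound_vertexCorr _ (by omega), smul_zero]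
    have : (-k - 1).toNat = 0 := by omega
    rw [this, Finset.sum_range_zero]
  · obtain ⟨L, hL⟩ := Int.eq_ofNat_of_zero_le hk
    have hk' : (1 : ℤ) - -k = -L := by omega
    rw [hL, Int.toNat_natCast, coeff_vertexCorr, hk', neg_smul, natCast_zsmul,
      ← Nat.cast_smul_eq_nsmul ℂ, ← braHom_apply, ← map_smul, ← LinearMap.smul_apply,
      (expPhiPlus_mem_adjoin_and_recursion L).2, LinearMap.neg_apply, map_neg, neg_neg,
      LinearMap.sum_apply, map_sum, ← Finset.sum_range_reflect]
    refine Finset.sum_congr rfl fun l hl => ?_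
    rw [Finset.mem_range] at hl
    have e1 : L - 1 - (L - 1 - l) = l := by omega
    have e2 : (((L - 1 - l : ℕ) : ℤ) + 1) = L - l := by omega
    rw [e1, e2]
    rfl

/-- The sum over modes splits at zero: positive modes give the `λ`-derivative, the others give the
time series. Only finitely many terms survive because `x_n = 0` for large `n`. -/
theorem coeff_currentSeries (hg : g ≠ 0) (k : ℤ) :
    (currentSeries g b W).coeff (-k) = currentCorr g b W k := by
  obtain ⟨K, hK⟩ := exists_time_eq_zero N b
  set M : ℕ := (-k - 1).toNat + K + k.toNat + k.natAbs + 1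
  have hts : LowBound (timeSeries N b) (-k - M) := fun j hj => by
    rw [coeff_timeSeries, hK _ (by omega), smul_zero]
  have hu : ∀ l : ℕ, bra N g (alphaAt g b (-k - 1 - l) (expPhiPlus l (ketAt g W))) =
      (if l < (-k - 1).toNat then bra N g (alpha (-k - 1 - l) (expPhiPlus l (ketAt g W))) else 0) +
      g⁻¹ • ((timeSeries N b).coeff (-k - l) * (vertexCorr g W).coeff l) := by
    intro l
    rw [coeff_timeSeries, coeff_vertexCorr]
    by_cases h : l < (-k - 1).toNat
    · have : (1 - (-k - l)).toNat = 0 := by omega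
      rw [if_pos h, alphaAt_of_pos (by omega), this, Nat.cast_zero, zero_smul, zero_mul, smul_zero,
        add_zero]
    · obtain ⟨r, hr⟩ := Int.eq_ofNat_of_zero_le (a := k + 1 + l) (by omega)
      have h1 : -k - 1 - l = -(r : ℤ) := by omega
      have h2 : (1 - (-k - l)).toNat = r := by omega
      rw [if_neg h, h1, bra_alphaAt_neg hg, h2, zero_add, mul_smul, smul_mul_assoc]
  rw [currentCorr, finsum_eq_sum_of_support_subset (s := Finset.range (M + 1))]
  · rw [Finset.sum_congr rfl fun l _ => hu l, Finset.sum_add_distrib, currentSeries,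
      HahnSeries.coeff_add, coeff_hasseLam_vertexCorr, HahnSeries.coeff_smul, ← Finset.smul_sum]
    congr 1
    · rw [Finset.sum_ite, Finset.sum_const_zero, add_zero]
      refine Finset.sum_congr ?_ fun _ _ => rfl
      ext l
      simp only [Finset.mem_range, Finset.mem_filter]
      omega
    · congr 1
      rw [mul_comm, coeff_mul_eq_sum lowBound_vertexCorr hts]
      refine Finset.sum_nbij' (fun i => i.toNat) (fun l : ℕ => (l : ℤ)) ?_ ?_ ?_ ?_ ?_
      · intro l hl; simp at hl ⊢; omega
      · intro l hl; simp at hl ⊢; omega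
      · intro l hl; simp at hl ⊢; omega
      · intro l hl; simp
      · intro l hl
        rw [Finset.mem_Icc] at hl
        rw [mul_comm, Int.toNat_of_nonneg hl.1]
  · intro l hl
    rw [Finset.coe_range, Set.mem_Iio]
    by_contra hM
    apply hl
    simp only
    rw [hu, if_neg (by omega), hts _ (by omega), zero_mul, smul_zero, add_zero]

theorem coeff_currentSeriesZeta (hg : g ≠ 0) (p : ℕ) (k : ℤ) :
    ((p : ℂ)⁻¹ • (delPow N (1 - p) * currentSeries g b W)).coeff (-k) =
      currentCorrZeta p g b W k := by
  have e : -k + (1 - (p : ℤ)) = -(k + p - 1) := by ring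
  rw [HahnSeries.coeff_smul, coeff_delPow_mul, e, coeff_currentSeries hg, currentCorr,
    currentCorrZeta]
  have e2 : -(k + p - 1) - 1 = -k - p := by ring
  rw [e2]

/-! ## The eigenvalues of `P` and `Q` -/

theorem isUnit_of_isUnit_coeff_zero {σ : Type*} {F : LaurentSeries (MvPowerSeries σ ℂ)}
    (h : LowBound F 0)
    (h0 : IsUnit (F.coeff 0)) : IsUnit F := by
  have hne : F ≠ 0 := by
    rintro rfl
    exact not_isUnit_zero h0
  have hord : F.order = 0 := by
    refine le_antisymm (HahnSeries.order_le_of_coeff_ne_zero h0.ne_zero) ?_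
    by_contra! hlt
    exact hne (HahnSeries.coeff_order_eq_zero.mp (h _ hlt))
  have : IsDomain (MvPowerSeries σ ℂ) := NoZeroDivisors.to_isDomain _
  rw [HahnSeries.isUnit_iff, HahnSeries.leadingCoeff_eq, hord]
  exact h0

theorem isUnit_tau (hW0 : W.coeff 0 = 1) (hWneg : ∀ i : ℤ, i < 0 → W.coeff i = 0) :
    IsUnit (tau g W) := by
  rw [MvPowerSeries.isUnit_iff_constantCoeff, constantCoeff_tau hW0 hWneg]
  exact isUnit_one

omit [NeZero N] in
theorem csmul_eq_mul (c : ℂ) (A : LaurentSeries (TimeRing N)) :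
    c • A = (HahnSeries.C.comp MvPowerSeries.C : ℂ →+* LaurentSeries (TimeRing N)) c * A := by
  rw [csmul_eq_smul]
  exact HahnSeries.C_mul_eq_smul.symm

variable {p : ℕ} {γ : ℂ}

theorem bakerAkhiezer_eq (W : PsiDO N) : bakerAkhiezer g W = W := by
  rw [bakerAkhiezer, act, ← delPow_zero, comp_delPow, delPow_zero, mul_one]

theorem DouglasSolution.W_ne_zero (sol : DouglasSolution N p g b γ) : sol.W ≠ 0 := fun h => by
  have := sol.sato_coeff_zero
  rw [h] at this
  exact zero_ne_one this

theorem DouglasSolution.isUnit_vertexCorr (hg : g ≠ 0) (sol : DouglasSolution N p g b γ) :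
    IsUnit (vertexCorr g sol.W) := by
  refine isUnit_of_isUnit_coeff_zero lowBound_vertexCorr ?_
  rw [← tau_smul_eq_vertexCorr hg sol.sato_coeff_zero sol.sato_coeff_neg sol.sato,
    HahnSeries.coeff_smul, sol.sato_coeff_zero, smul_eq_mul, mul_one]
  exact isUnit_tau sol.sato_coeff_zero sol.sato_coeff_neg

theorem DouglasSolution.P_eigen_iff (sol : DouglasSolution N p g b γ)
    (Pf : LaurentSeries (TimeRing N)) :
    act g sol.P (bakerAkhiezer g sol.W) = Pf * bakerAkhiezer g sol.W ↔ Pf = lam N p := by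
  rw [bakerAkhiezer_eq, act, sol.P_comp_W, comp_delPow, mul_comm]
  constructor
  · intro h
    exact (mul_right_cancel₀ sol.W_ne_zero h).symm
  · rintro rfl
    rfl

/-- After multiplication by `τ`, Sato's formula replaces `W` by the vertex correlator, also under
`∂/∂λ`, because `τ` does not depend on `λ`. -/
theorem DouglasSolution.Q_eigen (hp : 0 < p) (hg : g ≠ 0) (sol : DouglasSolution N p g b γ) :
    comp g sol.Q sol.W = (g • ((p : ℂ)⁻¹ • lam N (1 - p) *
      (currentSeries g b sol.W * Ring.inverse (vertexCorr g sol.W))) +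
        (g * γ / p) • lam N (-p)) * sol.W := by
  have hτ := isUnit_tau (g := g) sol.sato_coeff_zero sol.sato_coeff_neg
  have hvc := tau_smul_eq_vertexCorr hg sol.sato_coeff_zero sol.sato_coeff_neg sol.sato
  have hinv := Ring.mul_inverse_cancel _ (sol.isUnit_vertexCorr hg)
  have hlam : ∀ k, lam N k = delPow N k := fun _ => rfl
  have hne : HahnSeries.C (tau g sol.W) ≠ (0 : LaurentSeries (TimeRing N)) :=
    HahnSeries.C_ne_zero hτ.ne_zero
  have hd : hasseLam 1 (vertexCorr g sol.W) = HahnSeries.C (tau g sol.W) * hasseLam 1 sol.W := by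
    rw [← hvc, map_smul, HahnSeries.C_mul_eq_smul]
  refine mul_left_cancel₀ hne ?_
  set V := vertexCorr g sol.W with hV
  rw [← HahnSeries.C_mul_eq_smul] at hvc
  rw [sol.Q_comp_W hp hg, currentSeries, ← hV, hd]
  simp only [csmul_eq_mul, hlam]
  set κ : ℂ →+* LaurentSeries (TimeRing N) := HahnSeries.C.comp MvPowerSeries.C
  have hκ : κ g * κ g⁻¹ = 1 := by rw [← map_mul, mul_inv_cancel₀ hg, map_one]
  rw [map_mul κ g]
  set T : LaurentSeries (TimeRing N) := HahnSeries.C (tau g sol.W)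
  set I := Ring.inverse V
  set X := κ g * κ (p : ℂ)⁻¹ * delPow N (1 - p) *
    (T * hasseLam 1 sol.W + κ g⁻¹ * (timeSeries N b * V))
  linear_combination (κ (p : ℂ)⁻¹ * delPow N (1 - p) * timeSeries N b - X * I) * hvc - X * hinv -
    κ (p : ℂ)⁻¹ * delPow N (1 - p) * timeSeries N b * V * hκ

theorem DouglasSolution.Q_eigen_iff (hp : 0 < p) (hg : g ≠ 0) (sol : DouglasSolution N p g b γ)
    (Qf : LaurentSeries (TimeRing N)) :
    act g sol.Q (bakerAkhiezer g sol.W) = Qf * bakerAkhiezer g sol.W ↔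
      Qf = g • ((p : ℂ)⁻¹ • lam N (1 - p) *
        (currentSeries g b sol.W * Ring.inverse (vertexCorr g sol.W))) +
          (g * γ / p) • lam N (-p) := by
  rw [bakerAkhiezer_eq, act, sol.Q_eigen hp hg]
  constructor
  · intro h
    exact (mul_right_cancel₀ sol.W_ne_zero h).symm
  · rintro rfl
    rfl

theorem DouglasSolution.Q_eigen_iff_zeta (hp : 0 < p) (hg : g ≠ 0) (sol : DouglasSolution N p g b γ)
    (Qf : LaurentSeries (TimeRing N)) :
    act g sol.Q (bakerAkhiezer g sol.W) = Qf * bakerAkhiezer g sol.W ↔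
      Qf = g • ((p : ℂ)⁻¹ • (delPow N (1 - p) * currentSeries g b sol.W) *
        Ring.inverse (vertexCorr g sol.W)) + (g * γ / p) • lam N (-p) := by
  rw [sol.Q_eigen_iff hp hg]
  simp only [csmul_eq_mul, mul_assoc]
  rfl

end CurrentSeries

/-! ## Formal logarithms -/

section Log

variable {σ : Type*} {f : MvPowerSeries σ ℂ}

theorem coeff_flog (hf : MvPowerSeries.constantCoeff f = 1) {m : σ →₀ ℕ} {K : ℕ}
    (hK : m.degree ≤ K) : MvPowerSeries.coeff m (flog f) =
      ∑ k ∈ Finset.range K,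
        ((-1) ^ k / ((k : ℂ) + 1)) * MvPowerSeries.coeff m ((f - 1) ^ (k + 1)) := by
  have h0 : MvPowerSeries.coeff 0 (f - 1) = 0 := by
    rw [MvPowerSeries.coeff_zero_eq_constantCoeff_apply, map_sub, hf, map_one, sub_self]
  change ∑ k ∈ Finset.Icc 1 m.degree, _ = _
  rw [Finset.sum_subset (Finset.Icc_subset_Icc_right hK)]
  · refine Finset.sum_nbij' (fun k => k - 1) (fun k => k + 1) ?_ ?_ ?_ ?_ ?_
    · intro k hk; rw [Finset.mem_Icc] at hk; rw [Finset.mem_range]; omega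
    · intro k hk; rw [Finset.mem_range] at hk; rw [Finset.mem_Icc]; omega
    · intro k hk; rw [Finset.mem_Icc] at hk; omega
    · intro k _; rfl
    · intro k hk
      rw [Finset.mem_Icc] at hk
      obtain ⟨j, rfl⟩ := Nat.exists_eq_add_of_le' hk.1
      rw [Nat.add_sub_cancel, pow_succ, pow_succ]
      push_cast
      ring
  · intro k hk hk'
    rw [Finset.mem_Icc] at hk hk'
    rw [coeff_pow_of_degree_lt h0 k m (by omega), mul_zero]

/-- The logarithmic derivative. -/
theorem pderiv_flog_mul (hf : MvPowerSeries.constantCoeff f = 1) (s : σ) :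
    MvPowerSeries.pderiv ℂ s (flog f) * f = MvPowerSeries.pderiv ℂ s f := by
  classical
  set u := f - 1 with hu
  have hfu : f = u + 1 := by rw [hu]; ring
  have h0 : MvPowerSeries.coeff 0 u = 0 := by
    rw [MvPowerSeries.coeff_zero_eq_constantCoeff_apply, hu, map_sub, hf, map_one, sub_self]
  have hdu : MvPowerSeries.pderiv ℂ s f = MvPowerSeries.pderiv ℂ s u := by
    rw [hfu, map_add, MvPowerSeries.pderiv_one, add_zero]
  ext m
  set K := m.degree + 1 with hK
  -- A truncated geometric series for `u' / (1 + u)`. Its product with `f` misses `u'` only by a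
  -- multiple of `u^K`, invisible up to the degree of `m`.
  set S : MvPowerSeries σ ℂ := MvPowerSeries.pderiv ℂ s u * ∑ k ∈ Finset.range K, (-u) ^ k with hS
  have hcoeff : ∀ x : σ →₀ ℕ, x.degree ≤ m.degree →
      MvPowerSeries.coeff x (MvPowerSeries.pderiv ℂ s (flog f)) = MvPowerSeries.coeff x S := by
    intro x hx
    rw [MvPowerSeries.coeff_pderiv, coeff_flog hf (K := K) (by simp [hK]; omega), Finset.sum_mul,
      hS, Finset.mul_sum, map_sum]
    refine Finset.sum_congr rfl fun k _ => ?_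
    have hk : ((k : ℂ) + 1) ≠ 0 := Nat.cast_add_one_ne_zero k
    have e1 : ((k + 1 : ℕ) : MvPowerSeries σ ℂ) * u ^ k * MvPowerSeries.pderiv ℂ s u =
        MvPowerSeries.C ((k : ℂ) + 1) * (MvPowerSeries.pderiv ℂ s u * u ^ k) := by
      rw [← Nat.cast_add_one, map_natCast]; ring
    have e2 : MvPowerSeries.pderiv ℂ s u * (-u) ^ k =
        MvPowerSeries.C ((-1) ^ k) * (MvPowerSeries.pderiv ℂ s u * u ^ k) := by
      rw [neg_pow, map_pow, map_neg, map_one]; ring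
    rw [mul_assoc, ← MvPowerSeries.coeff_pderiv, MvPowerSeries.pderiv_pow, Nat.add_sub_cancel, e1,
      e2, MvPowerSeries.coeff_C_mul, MvPowerSeries.coeff_C_mul]
    field_simp
  have h1 : MvPowerSeries.coeff m (MvPowerSeries.pderiv ℂ s (flog f) * f) =
      MvPowerSeries.coeff m (S * f) := by
    rw [MvPowerSeries.coeff_mul, MvPowerSeries.coeff_mul]
    refine Finset.sum_congr rfl fun x hx => ?_
    rw [Finset.HasAntidiagonal.mem_antidiagonal] at hx
    rw [hcoeff _ (by rw [← hx, map_add]; omega)]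
  have h2 : S * f = MvPowerSeries.pderiv ℂ s u - MvPowerSeries.pderiv ℂ s u * (-u) ^ K := by
    have := geom_sum_mul_neg (-u) K
    rw [sub_neg_eq_add, add_comm 1 u, ← hfu] at this
    rw [hS, mul_assoc, this]
    ring
  have h3 : MvPowerSeries.coeff m (MvPowerSeries.pderiv ℂ s u * (-u) ^ K) = 0 := by
    rw [MvPowerSeries.coeff_mul]
    refine Finset.sum_eq_zero fun x hx => ?_
    rw [Finset.HasAntidiagonal.mem_antidiagonal] at hx
    rw [coeff_pow_of_degree_lt (by rw [map_neg, h0, neg_zero]) K x.2 (by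
      rw [hK, ← hx, map_add]; omega), mul_zero]
  rw [h1, h2, map_sub, h3, sub_zero, hdu]

end Log

/-! ## Derivatives of coherent correlators -/

section Coherent

variable {σ : Type*} {a : σ → FockEnd}

/-- `⟨0| exp(∑_s t_s a_s)` as a linear map. -/
def coherentHom (a : σ → FockEnd) : Fock ℂ →ₗ[ℂ] MvPowerSeries σ ℂ where
  toFun := coherent a
  map_add' f f' := by
    ext m
    exact congrFun (map_add (MvPowerSeries.coeff m (fexp (linForm a)) : FockEnd) f f') ∅
  map_smul' c f := by
    ext m
    exact congrFun (map_smul (MvPowerSeries.coeff m (fexp (linForm a)) : FockEnd) c f) ∅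

theorem coherentHom_apply (f : Fock ℂ) : coherentHom a f = coherent a f := rfl

theorem coeff_coherent (f : Fock ℂ) (m : σ →₀ ℕ) : MvPowerSeries.coeff m (coherent a f) =
    (MvPowerSeries.coeff m (fexp (linForm a)) : FockEnd) f ∅ := rfl

theorem pderiv_coherent (ha : ∀ s u, a s * a u = a u * a s) (s : σ) (f : Fock ℂ) :
    MvPowerSeries.pderiv ℂ s (coherent a f) = coherent a (a s f) := by
  ext m
  obtain ⟨h1, h2⟩ := mem_adjoin_and_recursion ha m
  have h3 : a s * MvPowerSeries.coeff m (fexp (linForm a)) =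
      MvPowerSeries.coeff m (fexp (linForm a)) * a s :=
    commute_of_mem_adjoin h1 (by rintro _ ⟨u, rfl⟩; exact ha s u)
  have h := congrArg (fun O : FockEnd => O f ∅) (h2 s)
  simp only [h3] at h
  rw [MvPowerSeries.coeff_pderiv, coeff_coherent, coeff_coherent, mul_comm]
  exact h

theorem constantCoeff_coherent (f : Fock ℂ) :
    MvPowerSeries.constantCoeff (coherent a f) = f ∅ := by
  rw [← MvPowerSeries.coeff_zero_eq_constantCoeff_apply, coeff_coherent, coeff_zero_fexp]
  rfl

/-- The modes `α_{n+1}`, `n ≥ 0`. -/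
def posMode (n : ℕ) : FockEnd := alpha ((n : ℤ) + 1)

theorem posMode_comm (n k : ℕ) : posMode n * posMode k = posMode k * posMode n := by
  have := alpha_mul_comm (n + 1) (k + 1)
  push_cast at this
  exact this

variable {N : ℕ} {g : ℂ}

/-- The substitution `j_{i+1} = t_{i+1} / g`, with `t_n = 0` for `n > N`. -/
def toTimes (N : ℕ) (g : ℂ) : MvPowerSeries ℕ ℂ →+* TimeRing N :=
  (MvPowerSeries.rescale fun _ => g⁻¹).comp
    (MvPowerSeries.killCompl (R := ℂ) (Fin.valEmbedding : Fin N ↪ ℕ)).toRingHom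

theorem coeff_toTimes (F : MvPowerSeries ℕ ℂ) (m : Fin N →₀ ℕ) :
    MvPowerSeries.coeff m (toTimes N g F) =
      g⁻¹ ^ m.degree * MvPowerSeries.coeff (m.mapDomain fun i : Fin N => (i : ℕ)) F := by
  have h : m.mapDomain (fun i : Fin N => (i : ℕ)) = m.embDomain Fin.valEmbedding :=
    (Finsupp.embDomain_eq_mapDomain Fin.valEmbedding m).symm
  rw [toTimes, RingHom.comp_apply, MvPowerSeries.coeff_rescale, Finsupp.prod, h]
  congr 1
  · rw [Finset.prod_pow_eq_pow_sum]; rfl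

theorem smul_pderiv_toTimes (hg : g ≠ 0) (i : Fin N) (F : MvPowerSeries ℕ ℂ) :
    g • MvPowerSeries.pderiv ℂ i (toTimes N g F) =
      toTimes N g (MvPowerSeries.pderiv ℂ (i : ℕ) F) := by
  ext m
  rw [map_smul, MvPowerSeries.coeff_pderiv, coeff_toTimes, coeff_toTimes, MvPowerSeries.coeff_pderiv,
    Finsupp.mapDomain_add, Finsupp.mapDomain_single, map_add, Finsupp.degree_single,
    Finsupp.mapDomain_apply Fin.val_injective, smul_eq_mul, pow_succ]
  field_simp

/-- Setting `j_n = t_n / g` and the sources beyond `N` to zero recovers the evolved bra, again by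
uniqueness from `t = 0`. -/
theorem toTimes_coherent (hg : g ≠ 0) (f : Fock ℂ) :
    toTimes N g (coherent posMode f) = bra N g f := by
  rw [← sub_eq_zero]
  refine eq_zero_of_smul_pderiv (G := fun f => toTimes N g (coherent posMode f) - bra N g f)
    (fun i f => ?_) hg (fun f => ?_) f
  · rw [map_sub, smul_sub, smul_pderiv_bra hg, smul_pderiv_toTimes hg, pderiv_coherent posMode_comm]
    rfl
  · rw [map_sub, ← MvPowerSeries.coeff_zero_eq_constantCoeff_apply, coeff_toTimes]
    simp only [map_zero, pow_zero, one_mul, Finsupp.mapDomain_zero,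
      MvPowerSeries.coeff_zero_eq_constantCoeff_apply, constantCoeff_coherent, bra, sub_self]

end Coherent

/-! ## The vertex correlator with all sources -/

section Sources

variable {N : ℕ} [NeZero N] {g : ℂ} {W : PsiDO N}

/-- `⟨0| exp(∑ j_n α_n) e^{φ₊(λ)} |f⟩`. -/
def sourceVertex (f : Fock ℂ) : LaurentSeries (MvPowerSeries ℕ ℂ) :=
  HahnSeries.ofPowerSeries ℤ _ (PowerSeries.mk fun l => coherent posMode (expPhiPlus l f))

theorem coeff_sourceVertex (f : Fock ℂ) (l : ℕ) :
    (sourceVertex f).coeff l = coherent posMode (expPhiPlus l f) := by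
  rw [sourceVertex, LaurentSeries.coeff_coe_powerSeries, PowerSeries.coeff_mk]

theorem lowBound_sourceVertex (f : Fock ℂ) : LowBound (sourceVertex f) 0 := fun i hi => by
  rw [sourceVertex, PowerSeries.coeff_coe, if_pos hi]

/-- The logarithmic derivative of the vertex correlator by a source. -/
def sourceLogDer (f : Fock ℂ) (n : ℕ) : LaurentSeries (MvPowerSeries ℕ ℂ) :=
  mapDer (MvPowerSeries.pderiv ℂ n) (sourceVertex f) * Ring.inverse (sourceVertex f)

variable {f : Fock ℂ}

theorem coeff_zero_sourceVertex (f : Fock ℂ) :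
    (sourceVertex f).coeff 0 = coherent posMode f := by
  have := coeff_sourceVertex f 0
  rwa [expPhiPlus_zero, Nat.cast_zero] at this

theorem isUnit_sourceVertex (hf : f ∅ = 1) : IsUnit (sourceVertex f) := by
  refine isUnit_of_isUnit_coeff_zero (lowBound_sourceVertex f) ?_
  rw [coeff_zero_sourceVertex, MvPowerSeries.isUnit_iff_constantCoeff, constantCoeff_coherent, hf]
  exact isUnit_one

theorem lowBound_inverse {σ : Type*} {F : LaurentSeries (MvPowerSeries σ ℂ)} (h : LowBound F 0)
    (h0 : IsUnit (F.coeff 0)) : LowBound (Ring.inverse F) 0 := by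
  have hF := isUnit_of_isUnit_coeff_zero h h0
  by_contra hlow
  have hne : Ring.inverse F ≠ 0 := fun h' => hlow (by rw [h']; exact lowBound_zero 0)
  have hb : LowBound (Ring.inverse F) (Ring.inverse F).order :=
    fun i hi => HahnSeries.coeff_eq_zero_of_lt_order hi
  have hord : (Ring.inverse F).order < 0 := by
    by_contra! hge
    exact hlow (hb.mono hge)
  have h1 : (F * Ring.inverse F).coeff (Ring.inverse F).order = 0 := by
    rw [Ring.mul_inverse_cancel _ hF, HahnSeries.coeff_one, if_neg hord.ne]
  rw [coeff_mul_eq_sum h hb, sub_self, Finset.Icc_self, Finset.sum_singleton, sub_zero,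
    h0.mul_right_eq_zero] at h1
  exact hne (HahnSeries.coeff_order_eq_zero.mp h1)

theorem lowBound_inverse_sourceVertex (hf : f ∅ = 1) :
    LowBound (Ring.inverse (sourceVertex f)) 0 := by
  refine lowBound_inverse (lowBound_sourceVertex f) ?_
  rw [coeff_zero_sourceVertex, MvPowerSeries.isUnit_iff_constantCoeff, constantCoeff_coherent, hf]
  exact isUnit_one

theorem lowBound_sourceLogDer (hf : f ∅ = 1) (n : ℕ) : LowBound (sourceLogDer f n) 0 := by
  have := ((lowBound_sourceVertex f).mapDer (MvPowerSeries.pderiv ℂ n)).mul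
    (lowBound_inverse_sourceVertex hf)
  rwa [add_zero] at this

theorem sourceLogDer_mul (hf : f ∅ = 1) (n : ℕ) : sourceLogDer f n * sourceVertex f =
    mapDer (MvPowerSeries.pderiv ℂ n) (sourceVertex f) := by
  rw [sourceLogDer, mul_assoc, Ring.inverse_mul_cancel _ (isUnit_sourceVertex hf), mul_one]

theorem coeff_zero_sourceLogDer_mul (hf : f ∅ = 1) (n : ℕ) :
    (sourceLogDer f n).coeff 0 * coherent posMode f = coherent posMode (posMode n f) := by
  have h := congrArg (fun A : LaurentSeries (MvPowerSeries ℕ ℂ) => A.coeff 0) (sourceLogDer_mul hf n)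
  simp only [coeff_mapDer] at h
  rw [coeff_mul_eq_sum (lowBound_sourceLogDer hf n) (lowBound_sourceVertex f), sub_self,
    Finset.Icc_self, Finset.sum_singleton, sub_self, coeff_zero_sourceVertex,
    pderiv_coherent posMode_comm] at h
  exact h

/-- A source derivative inserts a positive mode. The `λ`-derivative of the vertex correlator is
therefore a sum of source derivatives; keeping all sources is essential, since modes beyond `N`
occur. -/
theorem coeff_hasseLam_sourceVertex (l : ℕ) :
    (hasseLam 1 (sourceVertex f)).coeff (l + 1) = ∑ j ∈ Finset.range l,
      MvPowerSeries.pderiv ℂ j ((sourceVertex f).coeff (l - 1 - j)) := by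
  have hl : (l : ℤ) + 1 - (1 : ℕ) = l := by push_cast; ring
  have hl' : ((1 : ℕ) : ℤ) - (l + 1) = -l := by push_cast; ring
  rw [coeff_hasseLam, Ring.choose_one_right, hl, hl', coeff_sourceVertex, neg_smul, natCast_zsmul,
    ← Nat.cast_smul_eq_nsmul ℂ, ← coherentHom_apply, ← map_smul, ← LinearMap.smul_apply,
    (expPhiPlus_mem_adjoin_and_recursion l).2, LinearMap.neg_apply, map_neg, neg_neg,
    LinearMap.sum_apply, map_sum]
  refine Finset.sum_congr rfl fun j hj => ?_
  rw [Finset.mem_range] at hj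
  have e : (l : ℤ) - 1 - j = (l - 1 - j : ℕ) := by omega
  rw [e, coeff_sourceVertex, pderiv_coherent posMode_comm]
  rfl

/-- `∂/∂λ` of the logarithm of the vertex correlator is `∑_n λ^(-n-1)` times its logarithmic
derivative by the `n`th source. -/
theorem coeff_hasseLam_sourceVertex_mul_inverse (hf : f ∅ = 1) (l : ℕ) :
    (hasseLam 1 (sourceVertex f) * Ring.inverse (sourceVertex f)).coeff (l + 1) =
      ∑ j ∈ Finset.range l, (sourceLogDer f j).coeff (l - 1 - j) := by
  -- The sum over all sources, cut where its terms no longer reach the coefficient at `l + 1`.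
  set U : LaurentSeries (MvPowerSeries ℕ ℂ) :=
    ∑ j ∈ Finset.range l, HahnSeries.single ((j : ℤ) + 2) 1 * sourceLogDer f j with hU
  have hUc : U.coeff (l + 1) = ∑ j ∈ Finset.range l, (sourceLogDer f j).coeff (l - 1 - j) := by
    rw [hU, HahnSeries.coeff_sum]
    refine Finset.sum_congr rfl fun j _ => ?_
    rw [HahnSeries.coeff_single_mul, one_mul]
    congr 1
    ring
  have hlow : LowBound (hasseLam 1 (sourceVertex f) - U * sourceVertex f) (l + 2) := by
    intro i hi
    have hUV : U * sourceVertex f = ∑ j ∈ Finset.range l, HahnSeries.single ((j : ℤ) + 2) 1 *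
        mapDer (MvPowerSeries.pderiv ℂ j) (sourceVertex f) := by
      rw [hU, Finset.sum_mul]
      refine Finset.sum_congr rfl fun j _ => ?_
      rw [mul_assoc, sourceLogDer_mul hf]
    rw [hUV, HahnSeries.coeff_sub, HahnSeries.coeff_sum, sub_eq_zero]
    have hc : ∀ j : ℕ, (HahnSeries.single ((j : ℤ) + 2) 1 *
        mapDer (MvPowerSeries.pderiv ℂ j) (sourceVertex f)).coeff i =
        MvPowerSeries.pderiv ℂ j ((sourceVertex f).coeff (i - (j + 2))) := fun j => by
      rw [HahnSeries.coeff_single_mul, one_mul, coeff_mapDer]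
    simp only [hc]
    by_cases hi0 : i < 1
    · rw [((lowBound_sourceVertex f).hasseLam 1) i (by push_cast; omega), Finset.sum_eq_zero]
      intro j _
      rw [lowBound_sourceVertex f _ (by omega), map_zero]
    · obtain ⟨k, hk⟩ := Int.eq_ofNat_of_zero_le (a := i - 1) (by omega)
      have hik : i = k + 1 := by omega
      rw [hik, coeff_hasseLam_sourceVertex]
      refine Finset.sum_subset_zero_on_sdiff (Finset.range_mono (by omega)) ?_ ?_
      · intro j hj
        rw [Finset.mem_sdiff, Finset.mem_range, Finset.mem_range] at hj
        rw [lowBound_sourceVertex f _ (by omega), map_zero]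
      · intro j _
        congr 2
        ring
  have h1 := hlow.mul (lowBound_inverse_sourceVertex hf) (l + 1) (by omega)
  rw [sub_mul, mul_assoc, Ring.mul_inverse_cancel _ (isUnit_sourceVertex hf), mul_one,
    HahnSeries.coeff_sub, sub_eq_zero] at h1
  rw [h1, hUc]

/-- Equality of the mixed derivatives `∂_λ ∂_n log V = ∂_n ∂_λ log V`, derived from the quotients
`V'/V` without a logarithm of `V`. -/
theorem sourceLogDer_recursion (hf : f ∅ = 1) (n l : ℕ) :
    (l : ℂ) • (sourceLogDer f n).coeff l = -MvPowerSeries.pderiv ℂ n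
      (∑ j ∈ Finset.range l, (sourceLogDer f j).coeff (l - 1 - j)) := by
  set V := sourceVertex f with hV
  set I := Ring.inverse V with hI
  set d := MvPowerSeries.pderiv (σ := ℕ) ℂ n with hd
  have hVI : V * I = 1 := Ring.mul_inverse_cancel _ (isUnit_sourceVertex hf)
  have hY : sourceLogDer f n * V = mapDer d V := sourceLogDer_mul hf n
  have hT : hasseLam 1 V * I * V = hasseLam 1 V := by rw [mul_assoc, mul_comm I, hVI, mul_one]
  have h1 : hasseLam 1 (sourceLogDer f n) * V + sourceLogDer f n * hasseLam 1 V =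
      mapDer d (hasseLam 1 V) := by
    rw [← hasseLam_one_mul, hY, mapDer_hasseLam]
  have h2 : mapDer d (hasseLam 1 V * I) * V + hasseLam 1 V * I * mapDer d V =
      mapDer d (hasseLam 1 V) := by
    rw [← mapDer_mul, hT]
  have h3 : hasseLam 1 (sourceLogDer f n) = mapDer d (hasseLam 1 V * I) := by
    have hne : V ≠ 0 := by
      intro h; rw [h, zero_mul] at hVI; exact zero_ne_one hVI
    refine mul_right_cancel₀ hne ?_
    linear_combination h1 - h2 - hasseLam 1 V * I * hY + sourceLogDer f n * hT
  have h4 := congrArg (fun A : LaurentSeries (MvPowerSeries ℕ ℂ) => A.coeff (l + 1)) h3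
  have hl : (l : ℤ) + 1 - (1 : ℕ) = l := by push_cast; ring
  have hl' : ((1 : ℕ) : ℤ) - (l + 1) = -l := by push_cast; ring
  simp only [coeff_mapDer] at h4
  rw [coeff_hasseLam_sourceVertex_mul_inverse hf, coeff_hasseLam, Ring.choose_one_right, hl, hl',
    neg_smul, natCast_zsmul, ← Nat.cast_smul_eq_nsmul ℂ] at h4
  rw [← h4, neg_neg]

/-! ### Specialization to the times -/

theorem toTimes_sourceVertex (hg : g ≠ 0) :
    (sourceVertex (ketAt g W)).map (toTimes N g) = vertexCorr g W := by
  ext j : 2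
  rw [HahnSeries.map_coeff]
  by_cases hj : j < 0
  · rw [lowBound_sourceVertex _ j hj, lowBound_vertexCorr j hj, map_zero]
  · obtain ⟨l, rfl⟩ := Int.eq_ofNat_of_zero_le (not_lt.mp hj)
    rw [coeff_sourceVertex, coeff_vertexCorr, toTimes_coherent hg]

theorem coeff_hasseLam_vertexCorr_mul_inverse (hg : g ≠ 0) (hf : ketAt g W ∅ = 1)
    (hu : IsUnit (vertexCorr g W)) (l : ℕ) :
    (hasseLam 1 (vertexCorr g W) * Ring.inverse (vertexCorr g W)).coeff (l + 1) =
      ∑ j ∈ Finset.range l, toTimes N g ((sourceLogDer (ketAt g W) j).coeff (l - 1 - j)) := by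
  rw [← map_sum, ← coeff_hasseLam_sourceVertex_mul_inverse hf]
  have hmap : hasseLam 1 (vertexCorr g W) =
      (hasseLam 1 (sourceVertex (ketAt g W))).map (toTimes N g) := by
    ext j : 2
    rw [HahnSeries.map_coeff, coeff_hasseLam, coeff_hasseLam, ← toTimes_sourceVertex hg,
      HahnSeries.map_coeff, map_zsmul]
  set T := hasseLam 1 (sourceVertex (ketAt g W)) * Ring.inverse (sourceVertex (ketAt g W)) with hT
  have h1 : T * sourceVertex (ketAt g W) = hasseLam 1 (sourceVertex (ketAt g W)) := by
    rw [hT, mul_assoc, Ring.inverse_mul_cancel _ (isUnit_sourceVertex hf), mul_one]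
  have h2 : T.map (toTimes N g) * vertexCorr g W = hasseLam 1 (vertexCorr g W) := by
    have h3 : (T * sourceVertex (ketAt g W)).map (toTimes N g) =
        T.map (toTimes N g) * (sourceVertex (ketAt g W)).map (toTimes N g) :=
      HahnSeries.map_mul ((toTimes N g : MvPowerSeries ℕ ℂ →+* TimeRing N) :
        MvPowerSeries ℕ ℂ →ₙ+* TimeRing N)
    rw [hmap, ← h1, h3, toTimes_sourceVertex hg]
  rw [← h2, mul_assoc, Ring.mul_inverse_cancel _ hu, mul_one]
  rfl

theorem lowBound_hasseLam_vertexCorr_mul_inverse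
    (hu : IsUnit ((vertexCorr g W).coeff 0)) :
    LowBound (hasseLam 1 (vertexCorr g W) * Ring.inverse (vertexCorr g W)) 1 := by
  have := ((lowBound_vertexCorr (g := g) (W := W)).hasseLam 1).mul
    (lowBound_inverse lowBound_vertexCorr hu)
  simpa using this

end Sources

/-! ## Weak coupling -/

section Factorial

variable {σ : Type*}

theorem multiFactorial_ne_zero (m : σ →₀ ℕ) : multiFactorial m ≠ 0 :=
  Finset.prod_ne_zero_iff.mpr fun _ _ => Nat.cast_ne_zero.mpr (Nat.factorial_ne_zero _)

theorem multiFactorial_add_single (m : σ →₀ ℕ) (s : σ) :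
    multiFactorial (m + Finsupp.single s 1) = multiFactorial m * (m s + 1) := by
  classical
  have h : ∀ m' : σ →₀ ℕ, m'.support ⊆ insert s m.support → multiFactorial m' =
      ((m' s).factorial : ℂ) * ∏ x ∈ (insert s m.support).erase s, ((m' x).factorial : ℂ) := by
    intro m' hm'
    rw [multiFactorial, Finsupp.prod_of_support_subset _ hm' _ fun _ _ => by simp,
      ← Finset.mul_prod_erase _ _ (Finset.mem_insert_self s _)]
  rw [h m (Finset.subset_insert _ _), h (m + Finsupp.single s 1)]
  · have e : ∏ x ∈ (insert s m.support).erase s, (((m + Finsupp.single s 1 : σ →₀ ℕ) x).factorial : ℂ) =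
        ∏ x ∈ (insert s m.support).erase s, ((m x).factorial : ℂ) := by
      refine Finset.prod_congr rfl fun x hx => ?_
      rw [Finsupp.add_apply, Finsupp.single_eq_of_ne (Finset.ne_of_mem_erase hx), add_zero]
    rw [e, Finsupp.add_apply, Finsupp.single_eq_same, Nat.factorial_succ]
    push_cast
    ring
  · intro x hx
    by_contra hxs
    rw [Finset.mem_insert, not_or, Finsupp.notMem_support_iff] at hxs
    rw [Finsupp.mem_support_iff, Finsupp.add_apply, hxs.2, Finsupp.single_eq_of_ne hxs.1] at hx
    exact hx rfl

theorem multiFactorial_mapDomain {τ : Type*} {e : σ → τ} (he : Function.Injective e)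
    (m : σ →₀ ℕ) : multiFactorial (m.mapDomain e) = multiFactorial m :=
  Finsupp.prod_mapDomain_index_inj he

end Factorial

section FreeEnergy

variable {N : ℕ} [NeZero N] {g : ℂ} {W : PsiDO N}

theorem ketAt_empty (hW0 : W.coeff 0 = 1) (hWneg : ∀ i : ℤ, i < 0 → W.coeff i = 0) :
    ketAt g W ∅ = 1 := decomposable_empty (frame_eq_zero hWneg) (frame_self hW0 hWneg)

/-- At `λ = ∞` the vertex insertion is trivial, so the logarithmic derivative is that of the
generating function without it. -/
theorem coeff_zero_sourceLogDer (hf : ketAt g W ∅ = 1) (n : ℕ) :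
    (sourceLogDer (ketAt g W) n).coeff 0 = MvPowerSeries.pderiv ℂ n (freeEnergy g W) := by
  have hZ : MvPowerSeries.constantCoeff (coherent posMode (ketAt g W)) = 1 := by
    rw [constantCoeff_coherent, hf]
  have hne : coherent posMode (ketAt g W) ≠ 0 := by
    intro h
    rw [h, map_zero] at hZ
    exact zero_ne_one hZ
  have hF : freeEnergy g W = flog (coherent posMode (ketAt g W)) := by
    rw [freeEnergy, hf, inv_one, one_smul]
    rfl
  refine mul_right_cancel₀ hne ?_
  rw [coeff_zero_sourceLogDer_mul hf, hF, pderiv_flog_mul hZ, pderiv_coherent posMode_comm]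

theorem coeff_coeff_zero_sourceLogDer (hf : ketAt g W ∅ = 1) (n : ℕ) (d : ℕ →₀ ℕ) :
    MvPowerSeries.coeff d ((sourceLogDer (ketAt g W) n).coeff 0) =
      (multiFactorial d)⁻¹ * connected g W (d + Finsupp.single n 1) := by
  have h := multiFactorial_ne_zero d
  rw [coeff_zero_sourceLogDer hf, MvPowerSeries.coeff_pderiv, connected, multiFactorial_add_single]
  field_simp

end FreeEnergy

/-! ### Powers of the coupling and the planar limit. -/

section Limits

variable {N : ℕ} [NeZero N] {p : ℕ} {b : ℕ →₀ ℂ} {γ : ℂ} {S : Set ℂ}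
  {sol : (g : S) → DouglasSolution N p g b γ} {V : ℕ → (ℕ →₀ ℕ) → ℂ}

theorem tendsto_coupling : Tendsto (fun g : S => (g : ℂ)) (comap Subtype.val (𝓝 (0 : ℂ)))
    (𝓝 0) := tendsto_comap

theorem coupling_ne_zero (hS : (0 : ℂ) ∉ S) (g : S) : (g : ℂ) ≠ 0 := fun h => hS (h ▸ g.2)

theorem isBigO_zpow_of_le (hS : (0 : ℂ) ∉ S) {j k : ℤ} (h : j ≤ k) :
    (fun g : S => (g : ℂ) ^ k) =O[comap Subtype.val (𝓝 (0 : ℂ))] fun g : S => (g : ℂ) ^ j := by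
  refine IsBigO.of_bound 1 ?_
  have h1 : ∀ᶠ g : S in comap Subtype.val (𝓝 (0 : ℂ)), ‖(g : ℂ)‖ < 1 := by
    have := (tendsto_coupling (S := S)).norm
    rw [norm_zero] at this
    exact this.eventually_lt_const one_pos
  filter_upwards [h1] with g hg
  rw [one_mul, norm_zpow, norm_zpow]
  exact zpow_le_zpow_right_of_le_one₀ (norm_pos_iff.mpr (coupling_ne_zero hS g)) hg.le h

theorem tendsto_zero_of_isBigO_zpow (hS : (0 : ℂ) ∉ S) {f : S → ℂ} {k : ℤ} (hk : 1 ≤ k)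
    (h : f =O[comap Subtype.val (𝓝 (0 : ℂ))] fun g : S => (g : ℂ) ^ k) :
    Tendsto f (comap Subtype.val (𝓝 (0 : ℂ))) (𝓝 0) := by
  refine (h.trans (isBigO_zpow_of_le hS hk)).trans_tendsto ?_
  simp only [zpow_one]
  exact tendsto_coupling

theorem isBigO_zpow_mul (hS : (0 : ℂ) ∉ S) {f : S → ℂ} {k : ℤ} (j : ℤ)
    (h : f =O[comap Subtype.val (𝓝 (0 : ℂ))] fun g : S => (g : ℂ) ^ k) :
    (fun g : S => (g : ℂ) ^ j * f g) =O[comap Subtype.val (𝓝 (0 : ℂ))]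
      fun g : S => (g : ℂ) ^ (j + k) := by
  refine ((isBigO_refl (fun g : S => (g : ℂ) ^ j) _).mul h).congr_right fun g => ?_
  rw [zpow_add₀ (coupling_ne_zero hS g)]

theorem HasGenusExpansion.tendsto_connected (hS : (0 : ℂ) ∉ S) (hV : HasGenusExpansion sol V)
    {m : ℕ →₀ ℕ} (hm : m ≠ 0) :
    Tendsto (fun g : S => (g : ℂ) ^ (2 - (m.degree : ℤ)) * connected (g : ℂ) (sol g).W m)
      (comap Subtype.val (𝓝 (0 : ℂ))) (𝓝 (V 0 m)) := by
  -- The truncation at genus zero suffices: its error is two powers of `g` below the leading term.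
  have h := hV m hm 0
  simp only [zero_add, Finset.sum_range_one, Nat.cast_zero, mul_zero] at h
  have h1 := tendsto_zero_of_isBigO_zpow hS (by omega) (isBigO_zpow_mul hS (2 - (m.degree : ℤ)) h)
  have h3 := h1.add_const (V 0 m)
  rw [zero_add] at h3
  refine h3.congr fun g => ?_
  have hg := coupling_ne_zero hS g
  rw [mul_sub, ← mul_assoc, ← zpow_add₀ hg]
  have : (2 - (m.degree : ℤ)) + ((m.degree : ℤ) - 2) = 0 := by ring
  rw [this, zpow_zero, one_mul, sub_add_cancel]

theorem HasGenusExpansion.connected_isBigO (hS : (0 : ℂ) ∉ S) (hV : HasGenusExpansion sol V)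
    {m : ℕ →₀ ℕ} (hm : m ≠ 0) :
    (fun g : S => connected (g : ℂ) (sol g).W m) =O[comap Subtype.val (𝓝 (0 : ℂ))]
      fun g : S => (g : ℂ) ^ ((m.degree : ℤ) - 2) := by
  have h := (hV.tendsto_connected hS hm).isBigO_one ℂ
  have h1 := isBigO_zpow_mul hS (k := 0) ((m.degree : ℤ) - 2) (by simpa only [zpow_zero] using h)
  rw [add_zero] at h1
  refine h1.congr_left fun g => ?_
  have hg := coupling_ne_zero hS g
  rw [← mul_assoc, ← zpow_add₀ hg]
  have : ((m.degree : ℤ) - 2) + (2 - (m.degree : ℤ)) = 0 := by ring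
  rw [this, zpow_zero, one_mul]

theorem DouglasSolution.ketAt_empty {g : ℂ} (s : DouglasSolution N p g b γ) :
    ketAt g s.W ∅ = 1 := MinimalString.ketAt_empty s.sato_coeff_zero s.sato_coeff_neg

/-- The recursion trades a positive power of `λ⁻¹` for an additional source derivative, and each
source costs one power of `g`. -/
theorem sourceLogDer_isBigO_of_lt {l : ℕ} (hl : l ≠ 0)
    (h : ∀ l' < l, ∀ (n : ℕ) (d : ℕ →₀ ℕ), (fun g : S => MvPowerSeries.coeff d
      ((sourceLogDer (ketAt (g : ℂ) (sol g).W) n).coeff (l' : ℤ)))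
        =O[comap Subtype.val (𝓝 (0 : ℂ))] fun g : S => (g : ℂ) ^ ((d.degree : ℤ) - 1))
    (n : ℕ) (d : ℕ →₀ ℕ) : (fun g : S => MvPowerSeries.coeff d
      ((sourceLogDer (ketAt (g : ℂ) (sol g).W) n).coeff (l : ℤ)))
        =O[comap Subtype.val (𝓝 (0 : ℂ))] fun g : S => (g : ℂ) ^ (d.degree : ℤ) := by
  have hl' : (l : ℂ) ≠ 0 := Nat.cast_ne_zero.mpr hl
  have e : ∀ g : S, MvPowerSeries.coeff d
      ((sourceLogDer (ketAt (g : ℂ) (sol g).W) n).coeff (l : ℤ)) =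
      ∑ j ∈ Finset.range l, (-(l : ℂ)⁻¹ * (d n + 1)) * MvPowerSeries.coeff (d + Finsupp.single n 1)
        ((sourceLogDer (ketAt (g : ℂ) (sol g).W) j).coeff ((l - 1 - j : ℕ) : ℤ)) := by
    intro g
    have h1 := congrArg (MvPowerSeries.coeff d)
      (sourceLogDer_recursion (sol g).ketAt_empty n l)
    rw [map_smul, map_neg, MvPowerSeries.coeff_pderiv, map_sum, smul_eq_mul] at h1
    rw [← Finset.mul_sum]
    have h2 : ∑ j ∈ Finset.range l, MvPowerSeries.coeff (d + Finsupp.single n 1)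
        ((sourceLogDer (ketAt (g : ℂ) (sol g).W) j).coeff ((l - 1 - j : ℕ) : ℤ)) =
        ∑ j ∈ Finset.range l, MvPowerSeries.coeff (d + Finsupp.single n 1)
        ((sourceLogDer (ketAt (g : ℂ) (sol g).W) j).coeff ((l : ℤ) - 1 - j)) := by
      refine Finset.sum_congr rfl fun j hj => ?_
      rw [Finset.mem_range] at hj
      congr 2
      omega
    rw [h2]
    refine mul_left_cancel₀ hl' ?_
    rw [h1]
    field_simp
  simp only [e]
  refine IsBigO.fun_sum fun j hj => ?_
  refine IsBigO.const_mul_left ?_ _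
  rw [Finset.mem_range] at hj
  refine (h (l - 1 - j) (by omega) j (d + Finsupp.single n 1)).congr_right fun g => ?_
  rw [map_add, Finsupp.degree_single]
  push_cast
  rw [add_sub_cancel_right]

theorem HasGenusExpansion.sourceLogDer_isBigO (hS : (0 : ℂ) ∉ S) (hV : HasGenusExpansion sol V)
    (l n : ℕ) (d : ℕ →₀ ℕ) : (fun g : S => MvPowerSeries.coeff d
      ((sourceLogDer (ketAt (g : ℂ) (sol g).W) n).coeff (l : ℤ)))
        =O[comap Subtype.val (𝓝 (0 : ℂ))] fun g : S => (g : ℂ) ^ ((d.degree : ℤ) - 1) := by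
  induction l using Nat.strong_induction_on generalizing n d with
  | _ l ih =>
  rcases Nat.eq_zero_or_pos l with rfl | hl
  · simp only [Nat.cast_zero, coeff_coeff_zero_sourceLogDer (sol _).ketAt_empty]
    refine IsBigO.const_mul_left ?_ _
    refine (hV.connected_isBigO hS (m := d + Finsupp.single n 1) ?_).congr_right fun g => ?_
    · intro h
      have := DFunLike.congr_fun h n
      simp at this
    · rw [map_add, Finsupp.degree_single]
      push_cast
      congr 1
      ring
  · exact (sourceLogDer_isBigO_of_lt hl.ne' ih n d).trans (isBigO_zpow_of_le hS (by omega))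

/-- Only the zeroth coefficients of the logarithmic derivatives survive at weak coupling. -/
theorem HasGenusExpansion.tendsto_sourceLogDer (hS : (0 : ℂ) ∉ S) (hV : HasGenusExpansion sol V)
    {l : ℕ} (hl : l ≠ 0) (n : ℕ) (m : Fin N →₀ ℕ) :
    Tendsto (fun g : S => (g : ℂ) * MvPowerSeries.coeff m (toTimes N (g : ℂ)
      ((sourceLogDer (ketAt (g : ℂ) (sol g).W) n).coeff (l : ℤ))))
      (comap Subtype.val (𝓝 (0 : ℂ))) (𝓝 0) := by
  have h := sourceLogDer_isBigO_of_lt (sol := sol) hl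
    (fun l' _ => hV.sourceLogDer_isBigO hS l') n (m.mapDomain fun i : Fin N => (i : ℕ))
  rw [Finsupp.degree_mapDomain] at h
  refine (tendsto_zero_of_isBigO_zpow hS (by omega)
    (isBigO_zpow_mul hS (1 - (m.degree : ℤ)) h)).congr fun g => ?_
  have hg := coupling_ne_zero hS g
  rw [coeff_toTimes, ← mul_assoc, zpow_sub₀ hg, zpow_one, zpow_natCast, inv_pow, div_eq_mul_inv]

/-- The substitution `j = t/g` contributes `g^(-|m|)` and the prefactor `g`; the planar correlator
with `|m| + 1` insertions is of order `g^(|m|-1)`, so the powers balance. -/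
theorem HasGenusExpansion.tendsto_coeff_zero_sourceLogDer (hS : (0 : ℂ) ∉ S)
    (hV : HasGenusExpansion sol V) (n : ℕ) (m : Fin N →₀ ℕ) :
    Tendsto (fun g : S => (g : ℂ) * MvPowerSeries.coeff m (toTimes N (g : ℂ)
      ((sourceLogDer (ketAt (g : ℂ) (sol g).W) n).coeff 0)))
      (comap Subtype.val (𝓝 (0 : ℂ))) (𝓝 (MvPowerSeries.coeff m (sphereOnePoint N V (n + 1)))) := by
  set d : ℕ →₀ ℕ := m.mapDomain (fun i : Fin N => (i : ℕ)) + Finsupp.single n 1 with hd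
  have hd0 : d ≠ 0 := by
    intro h
    have := DFunLike.congr_fun h n
    simp [hd] at this
  have hdeg : (d.degree : ℤ) = m.degree + 1 := by
    rw [hd, map_add, Finsupp.degree_single, Finsupp.degree_mapDomain]
    push_cast
    rfl
  refine ((hV.tendsto_connected hS hd0).const_mul (multiFactorial m)⁻¹).congr fun g => ?_
  have hg := coupling_ne_zero hS g
  have e : (2 : ℤ) - d.degree = 1 - m.degree := by rw [hdeg]; ring
  rw [coeff_toTimes, coeff_coeff_zero_sourceLogDer (sol g).ketAt_empty,
    multiFactorial_mapDomain Fin.val_injective, e, zpow_sub₀ hg, zpow_one, zpow_natCast, inv_pow,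
    div_eq_mul_inv]
  ring

theorem natCast_toNat {k : ℤ} (hk : 0 ≤ k) : (k.toNat : ℂ) = (k : ℂ) := by
  obtain ⟨n, rfl⟩ := Int.eq_ofNat_of_zero_le hk
  rw [Int.toNat_natCast, Int.cast_natCast]

theorem smul_onePoint_of_nonneg {g : ℂ} (hg : g ≠ 0) (s : DouglasSolution N p g b γ) {k : ℤ}
    (hk : 0 ≤ k + p) : g • onePoint p g b s.W k =
      (p : ℂ)⁻¹ • (((k + p).toNat : ℂ) • time N b (k + p).toNat) := by
  obtain ⟨r, hr⟩ := Int.eq_ofNat_of_zero_le hk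
  have e : -k - (p : ℤ) = -(r : ℤ) := by omega
  have hτ := isUnit_tau (g := g) s.sato_coeff_zero s.sato_coeff_neg
  rw [onePoint, e, bra_alphaAt_neg hg, hr, Int.toNat_natCast, smul_smul]
  rw [smul_mul_assoc, mul_assoc]
  change g • ((p : ℂ)⁻¹ * (g⁻¹ * r)) • (time N b r * (tau g s.W * _)) = _
  rw [Ring.mul_inverse_cancel _ hτ, mul_one, smul_smul, smul_smul]
  congr 1
  field_simp

theorem onePoint_of_neg {g : ℂ} (hg : g ≠ 0) (s : DouglasSolution N p g b γ) {k : ℤ} {n : ℕ}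
    (hk : k + p = -(n + 1)) : onePoint p g b s.W k =
      (p : ℂ)⁻¹ • toTimes N g ((sourceLogDer (ketAt g s.W) n).coeff 0) := by
  have e : -k - (p : ℤ) = n + 1 := by omega
  have hτ := isUnit_tau (g := g) s.sato_coeff_zero s.sato_coeff_neg
  have h := congrArg (toTimes N g) (coeff_zero_sourceLogDer_mul s.ketAt_empty n)
  rw [map_mul, toTimes_coherent hg, toTimes_coherent hg] at h
  rw [onePoint, e, alphaAt_of_pos (by omega), smul_mul_assoc]
  congr 1
  rw [show bra N g (alpha ((n : ℤ) + 1) (ketAt g s.W)) = _ from h.symm, mul_assoc]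
  change _ * (tau g s.W * _) = _
  rw [Ring.mul_inverse_cancel _ hτ, mul_one]

/-- Dividing the current series by the vertex correlator splits `Q` into a logarithmic
`λ`-derivative, the exact time series, and the `γ` term at `k + p = 0`. -/
theorem DouglasSolution.coeff_Q_eigen (hp : 0 < p) {g : ℂ} (hg : g ≠ 0)
    (s : DouglasSolution N p g b γ) {Qf : LaurentSeries (TimeRing N)}
    (hQ : act g s.Q (bakerAkhiezer g s.W) = Qf * bakerAkhiezer g s.W) (k : ℤ) :
    Qf.coeff (-k) = (g * (p : ℂ)⁻¹) • (hasseLam 1 (vertexCorr g s.W) *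
        Ring.inverse (vertexCorr g s.W)).coeff (1 - (k + p)) +
      (p : ℂ)⁻¹ • ((((k + p).toNat : ℂ)) • time N b (k + p).toNat) +
      (g * γ / p) • (if k + p = 0 then 1 else 0) := by
  have hinv := Ring.mul_inverse_cancel _ (s.isUnit_vertexCorr hg)
  have hQf : Qf = (g * (p : ℂ)⁻¹) • (delPow N (1 - p) * (hasseLam 1 (vertexCorr g s.W) *
        Ring.inverse (vertexCorr g s.W))) + (p : ℂ)⁻¹ • (delPow N (1 - p) * timeSeries N b) +
      (g * γ / p) • delPow N (-p) := by
    rw [(s.Q_eigen_iff hp hg Qf).mp hQ, currentSeries]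
    have hlam : ∀ k, lam N k = delPow N k := fun _ => rfl
    simp only [csmul_eq_mul, hlam]
    set κ : ℂ →+* LaurentSeries (TimeRing N) := HahnSeries.C.comp MvPowerSeries.C
    have hκ : κ g * κ g⁻¹ = 1 := by rw [← map_mul, mul_inv_cancel₀ hg, map_one]
    rw [map_mul κ g]
    linear_combination κ g * κ g⁻¹ * κ (p : ℂ)⁻¹ * delPow N (1 - p) * timeSeries N b * hinv +
      κ (p : ℂ)⁻¹ * delPow N (1 - p) * timeSeries N b * hκ
  have e : -k + (1 - (p : ℤ)) = 1 - (k + p) := by ring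
  rw [hQf, HahnSeries.coeff_add, HahnSeries.coeff_add, HahnSeries.coeff_smul, HahnSeries.coeff_smul,
    HahnSeries.coeff_smul, coeff_delPow_mul, coeff_delPow_mul, e, coeff_timeSeries, sub_sub_cancel,
    delPow, HahnSeries.coeff_single]
  congr 3
  apply propext
  omega

theorem HasGenusExpansion.tendsto_onePoint (hS : (0 : ℂ) ∉ S) (hV : HasGenusExpansion sol V)
    (k : ℤ) (m : Fin N →₀ ℕ) :
    Tendsto (fun g : S => (g : ℂ) * MvPowerSeries.coeff m (onePoint p (g : ℂ) b (sol g).W k))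
      (comap Subtype.val (𝓝 (0 : ℂ))) (𝓝 (MvPowerSeries.coeff m (diskAmplitude N p b V k))) := by
  by_cases hk : 0 ≤ k + p
  · refine tendsto_const_nhds.congr fun g => ?_
    rw [← smul_eq_mul, ← map_smul, smul_onePoint_of_nonneg (coupling_ne_zero hS g) (sol g) hk,
      diskAmplitude]
    rcases hk.lt_or_eq with hk' | hk'
    · rw [if_pos hk']
      rw [natCast_toNat hk]
    · simp [← hk']
  · obtain ⟨n, hn⟩ := Int.eq_ofNat_of_zero_le (a := -(k + p) - 1) (by omega)
    have hk' : k + p = -(n + 1) := by omega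
    have hn' : (-(k + (p : ℤ))).toNat = n + 1 := by omega
    rw [diskAmplitude, if_neg (by omega), if_pos (by omega), hn', map_smul, smul_eq_mul]
    refine ((hV.tendsto_coeff_zero_sourceLogDer hS n m).const_mul _).congr fun g => ?_
    rw [onePoint_of_neg (coupling_ne_zero hS g) (sol g) hk', map_smul, smul_eq_mul]
    ring

theorem HasGenusExpansion.tendsto_Q_eigen (hp : 0 < p) (hS : (0 : ℂ) ∉ S)
    (hV : HasGenusExpansion sol V) {Qf : S → LaurentSeries (TimeRing N)}
    (hQ : ∀ g : S, act (g : ℂ) (sol g).Q (bakerAkhiezer (g : ℂ) (sol g).W) =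
      Qf g * bakerAkhiezer (g : ℂ) (sol g).W) (k : ℤ) (m : Fin N →₀ ℕ) :
    Tendsto (fun g : S => MvPowerSeries.coeff m ((Qf g).coeff (-k)))
      (comap Subtype.val (𝓝 (0 : ℂ))) (𝓝 (MvPowerSeries.coeff m (diskAmplitude N p b V k))) := by
  have hunit : ∀ g : S, IsUnit ((vertexCorr (g : ℂ) (sol g).W).coeff 0) := fun g => by
    rw [← tau_smul_eq_vertexCorr (coupling_ne_zero hS g) (sol g).sato_coeff_zero
      (sol g).sato_coeff_neg (sol g).sato, HahnSeries.coeff_smul, (sol g).sato_coeff_zero,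
      smul_eq_mul, mul_one]
    exact isUnit_tau (sol g).sato_coeff_zero (sol g).sato_coeff_neg
  have hcoeff := fun g : S => (sol g).coeff_Q_eigen hp (coupling_ne_zero hS g) (hQ g) k
  by_cases hk : 0 ≤ k + p
  · rcases hk.lt_or_eq with hk' | hk'
    · refine tendsto_const_nhds.congr fun g => ?_
      rw [hcoeff, lowBound_hasseLam_vertexCorr_mul_inverse (hunit g) _ (by omega), smul_zero,
        zero_add, if_neg hk'.ne', smul_zero, add_zero, diskAmplitude, if_pos hk']
      rw [natCast_toNat hk]
    -- At `k + p = 0` only the `γ` term is left. It is proportional to `g`, and the disk amplitude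
    -- has no such coefficient.
    · have hz : ∀ g : S, (hasseLam 1 (vertexCorr (g : ℂ) (sol g).W) *
          Ring.inverse (vertexCorr (g : ℂ) (sol g).W)).coeff 1 = 0 := fun g => by
        have := coeff_hasseLam_vertexCorr_mul_inverse (coupling_ne_zero hS g) (sol g).ketAt_empty
          ((sol g).isUnit_vertexCorr (coupling_ne_zero hS g)) 0
        simpa using this
      have hdisk : diskAmplitude N p b V k = 0 := by
        rw [diskAmplitude, if_neg (by omega), if_neg (by omega), smul_zero]
      rw [hdisk, map_zero]
      have h1 : Tendsto (fun g : S => (g : ℂ) *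
          (γ / p * MvPowerSeries.coeff m (1 : TimeRing N))) (comap Subtype.val (𝓝 (0 : ℂ)))
          (𝓝 0) := by
        have := (tendsto_coupling (S := S)).mul_const
          (γ / p * MvPowerSeries.coeff m (1 : TimeRing N))
        rwa [zero_mul] at this
      refine h1.congr fun g => ?_
      rw [hcoeff, ← hk', sub_zero, hz, Int.toNat_zero, Nat.cast_zero, zero_smul, smul_zero,
        smul_zero, zero_add, zero_add, if_pos rfl, map_smul, smul_eq_mul]
      ring
  · obtain ⟨n, hn⟩ := Int.eq_ofNat_of_zero_le (a := -(k + p) - 1) (by omega)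
    have hk' : 1 - (k + (p : ℤ)) = ((n + 1 : ℕ) : ℤ) + 1 := by push_cast; omega
    have hn' : (-(k + (p : ℤ))).toNat = n + 1 := by omega
    have hn0 : (k + (p : ℤ)).toNat = 0 := by omega
    rw [diskAmplitude, if_neg (by omega), if_pos (by omega), hn', map_smul, smul_eq_mul]
    -- The coefficient is a sum over `j ≤ n` of the `λ^(-(n-j))` term of the `j`th logarithmic
    -- derivative. All terms with `j < n` tend to zero, and `j = n` gives the planar one-point
    -- function of `O_{n+1}`.
    have hsum := (tendsto_finsetSum (Finset.range n) fun j hj =>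
      hV.tendsto_sourceLogDer (l := n - j) hS (by rw [Finset.mem_range] at hj; omega) j m).add
      (hV.tendsto_coeff_zero_sourceLogDer hS n m)
    rw [Finset.sum_const_zero, zero_add] at hsum
    refine (hsum.const_mul _).congr fun g => ?_
    rw [hcoeff, hk', coeff_hasseLam_vertexCorr_mul_inverse (coupling_ne_zero hS g)
      (sol g).ketAt_empty ((sol g).isUnit_vertexCorr (coupling_ne_zero hS g)), hn0, Nat.cast_zero,
      zero_smul, smul_zero, add_zero, if_neg (by omega), smul_zero, add_zero, map_smul, map_sum,
      smul_eq_mul, Finset.sum_range_succ]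
    have e : ((n + 1 : ℕ) : ℤ) - 1 - n = 0 := by push_cast; ring
    have e2 : ∑ j ∈ Finset.range n, MvPowerSeries.coeff m (toTimes N (g : ℂ)
        ((sourceLogDer (ketAt (g : ℂ) (sol g).W) j).coeff (((n + 1 : ℕ) : ℤ) - 1 - j))) =
        ∑ j ∈ Finset.range n, MvPowerSeries.coeff m (toTimes N (g : ℂ)
        ((sourceLogDer (ketAt (g : ℂ) (sol g).W) j).coeff ((n - j : ℕ) : ℤ))) := by
      refine Finset.sum_congr rfl fun j hj => ?_
      rw [Finset.mem_range] at hj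
      congr 3
      omega
    rw [e, e2, ← Finset.mul_sum]
    ring

end Limits

end MinimalString

end

theorem theorem4 (N : ℕ) [NeZero N] (p : ℕ) (hp : 0 < p) (b : ℕ →₀ ℂ) (γ : ℂ) :
    (∀ (g : ℂ), g ≠ 0 → ∀ sol : DouglasSolution N p g b γ,
      IsUnit (vertexCorr g sol.W) ∧
      ∃ C C₀ : LaurentSeries (TimeRing N),
        (∀ k : ℤ, C.coeff (-k) = currentCorr g b sol.W k) ∧
        (∀ k : ℤ, C₀.coeff (-k) = currentCorrZeta p g b sol.W k) ∧
        (∀ Pf : LaurentSeries (TimeRing N),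
          act g sol.P (bakerAkhiezer g sol.W) = Pf * bakerAkhiezer g sol.W ↔ Pf = lam N p) ∧
        (∀ Qf : LaurentSeries (TimeRing N),
          act g sol.Q (bakerAkhiezer g sol.W) = Qf * bakerAkhiezer g sol.W ↔
            Qf = g • ((p : ℂ)⁻¹ • lam N (1 - p) * (C * Ring.inverse (vertexCorr g sol.W)))
              + (g * γ / p) • lam N (-p)) ∧
        (∀ Qf : LaurentSeries (TimeRing N),
          act g sol.Q (bakerAkhiezer g sol.W) = Qf * bakerAkhiezer g sol.W ↔
            Qf = g • (C₀ * Ring.inverse (vertexCorr g sol.W)) + (g * γ / p) • lam N (-p))) ∧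
    (∀ (S : Set ℂ), (0 : ℂ) ∉ S → ∀ (sol : (g : S) → DouglasSolution N p g b γ)
      (V : ℕ → (ℕ →₀ ℕ) → ℂ), HasGenusExpansion sol V →
      ∀ Qf : S → LaurentSeries (TimeRing N),
        (∀ g : S, act (g : ℂ) (sol g).Q (bakerAkhiezer (g : ℂ) (sol g).W) =
          Qf g * bakerAkhiezer (g : ℂ) (sol g).W) →
        ∀ (k : ℤ) (m : Fin N →₀ ℕ),
          Tendsto (fun g : S => (g : ℂ) * MvPowerSeries.coeff m (onePoint p (g : ℂ) b (sol g).W k))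
            (comap Subtype.val (𝓝 (0 : ℂ)))
            (𝓝 (MvPowerSeries.coeff m (diskAmplitude N p b V k))) ∧
          Tendsto (fun g : S => MvPowerSeries.coeff m ((Qf g).coeff (-k)))
            (comap Subtype.val (𝓝 (0 : ℂ)))
            (𝓝 (MvPowerSeries.coeff m (diskAmplitude N p b V k)))) := by
  refine ⟨fun g hg sol => ⟨sol.isUnit_vertexCorr hg, currentSeries g b sol.W,
    (p : ℂ)⁻¹ • (delPow N (1 - p) * currentSeries g b sol.W), coeff_currentSeries hg,
    coeff_currentSeriesZeta hg p, sol.P_eigen_iff, sol.Q_eigen_iff hp hg,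
    sol.Q_eigen_iff_zeta hp hg⟩, fun S hS sol V hV Qf hQ k m =>
    ⟨hV.tendsto_onePoint hS k m, hV.tendsto_Q_eigen hp hS hQ k m⟩⟩
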